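/- **Candidate Deletion-Kemeny Score with one input ranking.** An instance consists of a finite set $C$ of candidates, one ranking (linear order) $R$ of $C$, a ranking $X$ of $C$, a cost function $\mathrm{cost}\colon C\to\mathbb{N}$, a budget $\mathrm{bgt}\in\mathbb{N}$ and an integer $k$. The question is whether there is a set $Z\subseteq C$ with $\sum_{c\in Z}\mathrm{cost}(c)\le \mathrm{bgt}$ such that, after deleting the candidates of $Z$ from $R$ and $X$, the Kendall tau distance of $X|_{C\setminus Z}$ and $R|_{C\setminus Z}$ (the number of unordered pairs of remaining candidates whose relative order differs in the two rankings) is at most $k$. **Weighted Partial Vertex Cover on permutation graphs.** A permutation graph is a graph whose vertices can be identified with the elements of a permutation so that two vertices are adjacent if and only if the permutation reverses their order. An instance consists of a permutation graph $G$ (given as a graph, without a realising permutation), vertex weights $w\colon V(G)\to\mathbb{N}$, and integers $W,t$. The question is whether there is a set $S\subseteq V(G)$ with $\sum_{v\in S}w(v)\le W$ such that at least $t$ edges of $G$ have at least one endpoint in $S$. In both problems numbers are written in binary, and polynomial time refers to (multi-stack) Turing machines. **Theorem.** Each of the two problems has a polynomial-time many-one reduction to the other. Moreover, Candidate Deletion-Kemeny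 Score with one input ranking can be solved in polynomial time if and only if Weighted Partial Vertex Cover on permutation graphs can be solved in polynomial time. -/

import Mathlib

/-! ### Rankings and the Kendall tau distance -/

/-- A ranking of the candidates `0, …, m - 1`: `π i` is the candidate at position `i`. -/
abbrev Ranking (m : ℕ) : Type := Equiv.Perm (Fin m)

/-- `x` is placed before `y` in the ranking `π`. -/
def Ranking.Before {m : ℕ} (π : Ranking m) (x y : Fin m) : Prop :=
  π.symm x < π.symm y

open Classical in
/-- The Kendall tau distance of the restrictions of `π` and `π'` to the set `Y` of candidates:
the number of unordered pairs of candidates of `Y` whose relative order differs in `π` and `π'`.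
(Restricting a ranking does not change the relative order of the candidates that remain.) -/
noncomputable def kendallTauOn {m : ℕ} (Y : Finset (Fin m)) (π π' : Ranking m) : ℕ :=
  ((Y.powersetCard 2).filter
    (fun p => ∃ x ∈ p, ∃ y ∈ p, π.Before x y ∧ π'.Before y x)).card

/-! ### Candidate Deletion-Kemeny Score -/

/-- An instance: the candidates are `0, …, m - 1`, `R` is the tuple of input rankings, `X` is the
target ranking, `cost c` is the price of deleting the candidate `c`, `bgt` is the budget and `k`
is the bound on the distance. -/
structure CDInstance where
  m : ℕ
  R : List (Ranking m)
  X : Ranking m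
  cost : Fin m → ℕ
  bgt : ℕ
  k : ℤ

/-- Some set `Z` of candidates of total cost at most `bgt` can be deleted (from all rankings and
from `X`) so that the total Kendall tau distance of `X` from the input rankings is at most `k`. -/
def CDInstance.IsYes (I : CDInstance) : Prop :=
  ∃ Z : Finset (Fin I.m), ∑ c ∈ Z, I.cost c ≤ I.bgt ∧
    (((I.R.map (fun π => kendallTauOn Zᶜ I.X π)).sum : ℕ) : ℤ) ≤ I.k

/-- There is exactly one input ranking. -/
def CDInstance.OneRanking (I : CDInstance) : Prop := I.R.length = 1

/-! ### Weighted Partial Vertex Cover on permutation graphs -/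

/-- An instance: a graph `G` with vertices `0, …, n - 1`, vertex weights `w`, the bound `W` on the
weight of the cover and the number `t` of edges that are to be covered. -/
structure WPVCInstance where
  n : ℕ
  G : SimpleGraph (Fin n)
  w : Fin n → ℕ
  W : ℤ
  t : ℤ

/-- Some set `S` of vertices has weight at most `W` and covers at least `t` edges. -/
def WPVCInstance.IsYes (I : WPVCInstance) : Prop :=
  ∃ S : Finset (Fin I.n), ((∑ v ∈ S, I.w v : ℕ) : ℤ) ≤ I.W ∧
    I.t ≤ (({e ∈ I.G.edgeSet | ∃ v ∈ S, v ∈ e}.ncard : ℕ) : ℤ)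

/-- The graph of the pairs that are reversed by the permutation `π`. -/
def inversionGraph {n : ℕ} (π : Equiv.Perm (Fin n)) : SimpleGraph (Fin n) where
  Adj i j := (i < j ∧ π j < π i) ∨ (j < i ∧ π i < π j)
  symm := ⟨fun _ _ h => h.symm⟩
  loopless := ⟨fun i h => by rcases h with h | h <;> exact lt_irrefl i h.1⟩

/-- A graph is a permutation graph if its vertices can be identified with the elements of some
permutation in such a way that the edges are exactly the reversed pairs. -/
def IsPermutationGraph {V : Type*} (G : SimpleGraph V) : Prop :=
  ∃ (n : ℕ) (π : Equiv.Perm (Fin n)), Nonempty (G ≃g inversionGraph π)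

/-- The graph of the instance is a permutation graph. -/
def WPVCInstance.OnPermutationGraph (I : WPVCInstance) : Prop := IsPermutationGraph I.G

/-! ### Encodings of instances as strings

All numbers are written in binary (least significant bit first), rankings are the lists of their
candidates from first to last, graphs are given by their adjacency matrices. -/

namespace InstEnc

open Computability

/-- A natural number: its binary digits, closed by a comma. -/
def nat (a : ℕ) : List Γ' := (encodeNat a).map Γ'.bit ++ [Γ'.comma]

/-- An integer: a sign bit, then the absolute value. -/
def int (z : ℤ) : List Γ' := Γ'.bit (decide (z < 0)) :: nat z.natAbs

/-- A list: the entries one after the other, between brackets. -/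
def list {α : Type} (e : α → List Γ') (l : List α) : List Γ' :=
  Γ'.bra :: (l.flatMap e ++ [Γ'.ket])

/-- A family indexed by `0, …, m - 1`, written as a list. -/
def family {α : Type} (e : α → List Γ') {m : ℕ} (f : Fin m → α) : List Γ' :=
  list e (List.ofFn f)

/-- A ranking: its candidates from first to last. -/
def ranking {m : ℕ} (π : Ranking m) : List Γ' :=
  family (fun c : Fin m => nat c) π

/-- An instance of Candidate Deletion-Kemeny Score. -/
def cd (I : CDInstance) : List Γ' :=
  ranking I.X ++ list ranking I.R ++ family nat I.cost ++ nat I.bgt ++ int I.k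

open Classical in
/-- An instance of Weighted Partial Vertex Cover. -/
noncomputable def wpvc (I : WPVCInstance) : List Γ' :=
  family (fun i => family (fun j => [Γ'.bit (decide (I.G.Adj i j))]) id) id ++
    family nat I.w ++ int I.W ++ int I.t

end InstEnc

/-! ### Polynomial time -/

/-- The decision problem `P`, on the instances from the class `C`, is solvable in polynomial time:
some Turing machine answers correctly on every instance from `C`, within a number of steps that is
polynomial in the length of the encoding of the instance. -/
def PolyTimeSolvableOn {α : Type} (enc : α → List Computability.Γ') (C P : α → Prop) : Prop :=
  ∃ f : {a // C a} → Bool,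
    Nonempty (Turing.TM2ComputableInPolyTime
      (fun a : {a // C a} => enc a) Computability.encodeBool f) ∧
    ∀ a : {a // C a}, f a = true ↔ P a

/-- There is a polynomial-time many-one reduction from the problem `P` on the class `C` to the
problem `Q` on the class `D`. -/
def PolyTimeReducesOn {α β : Type} (encα : α → List Computability.Γ') (C P : α → Prop)
    (encβ : β → List Computability.Γ') (D Q : β → Prop) : Prop :=
  ∃ f : {a // C a} → {b // D b},
    Nonempty (Turing.TM2ComputableInPolyTime
      (fun a : {a // C a} => encα a) (fun b : {b // D b} => encβ b) f) ∧
    ∀ a : {a // C a}, P a ↔ Q (f a)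

/-! ### Composition of polynomial time machines -/

namespace Turing

open Computability StateTransition

/-! Take the graph whose edges are the discordant pairs of the two rankings. Deleting `Z` removes
exactly the discordant pairs that meet `Z`, so the remaining distance plus the number of edges
covered by `Z` is the number `e` of all edges (`kendallTauOn_add_covered`). Hence a distance of at
most `k` means that at least `e - k` edges are covered, for the same set and the same weights. This
gives the reduction from candidate deletion (`CDInstance.exists_wpvc`).

The reduction back (`WPVCInstance.exists_cd`) has to find two rankings for a graph that is only
known to possess them. Colour every pair by whether it is adjacent. If `xy` and `xz` have the same
colour and `yz` has the other one, then in every realizing order `x` lies on the same side of `y`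
and of `z`; the pairs `(x, y)` and `(x, z)` are linked, and links generate the classes `Conn`. A
class therefore has one direction as a whole. Each class, taken together with its reverse, is
directed so that its lexicographically first pair points forwards. The resulting tournament is
transitive: a cyclic triangle with two colours contradicts a link, and a cyclic triangle with one
colour is excluded by the triangle lemma `Conn.triangle` combined with the lexicographic choice
(`Realizes.no_cycle`). Reversing the adjacent pairs gives a second transitive tournament by the same
argument, and sorting by the two yields the rankings (`exists_rankings`). A realizer enters only the
proof, never the program.

For the running time, both reductions are functions on strings assembled from closure properties of
`PT`, the functions computed by flowcharts on tree codes in polynomial time and with polynomial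
output size. Numbers inside these programs are unary. Weights, costs and budgets are therefore
copied as strings, while `k` and `t` are cut off at `e + 1`, beyond which they make no difference.
Flowcharts become Turing machines (`Frag.computable`), and solvability is transferred by running two
machines one after the other (`TM2ComputableInPolyTime.comp_of_length_le`). -/

theorem iterate_bind_none {C : Type*} (f : C → Option C) (n : ℕ) :
    (flip bind f)^[n] none = none := by
  induction n with
  | zero => rfl
  | succ n ih => rw [Function.iterate_succ_apply]; exact ih

theorem iterate_bind_succ {C : Type*} (f : C → Option C) (n : ℕ) (c : C) :
    (flip bind f)^[n + 1] (some c) = (flip bind f)^[n] (f c) := by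
  rw [Function.iterate_succ_apply]; rfl

namespace FinTM2

section Sequence

variable (M₁ M₂ : FinTM2)

/-- The stacks of the sequential composition: those of both machines and an auxiliary one. -/
abbrev SeqK : Type := M₁.K ⊕ (M₂.K ⊕ Unit)

/-- The alphabets of the sequential composition. -/
abbrev SeqΓ : SeqK M₁ M₂ → Type
  | .inl k => M₁.Γ k
  | .inr (.inl k) => M₂.Γ k
  | .inr (.inr _) => Γ'

/-- The labels of the sequential composition. -/
abbrev SeqΛ : Type := M₁.Λ ⊕ (M₂.Λ ⊕ Bool)

/-- The internal states of the sequential composition. -/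
abbrev Seqσ : Type := (M₁.σ × M₂.σ) × Option Γ'

/-- A statement of the first machine, continued by the copying loop. -/
def seqLeft : TM2.Stmt M₁.Γ M₁.Λ M₁.σ → TM2.Stmt (SeqΓ M₁ M₂) (SeqΛ M₁ M₂) (Seqσ M₁ M₂)
  | .push k f q => .push (Sum.inl k) (fun s => f s.1.1) (seqLeft q)
  | .peek k f q => .peek (Sum.inl k) (fun s o => ((f s.1.1 o, s.1.2), s.2)) (seqLeft q)
  | .pop k f q => .pop (Sum.inl k) (fun s o => ((f s.1.1 o, s.1.2), s.2)) (seqLeft q)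
  | .load a q => .load (fun s => ((a s.1.1, s.1.2), s.2)) (seqLeft q)
  | .branch f q₁ q₂ => .branch (fun s => f s.1.1) (seqLeft q₁) (seqLeft q₂)
  | .goto f => .goto fun s => Sum.inl (f s.1.1)
  | .halt => .goto fun _ => Sum.inr (Sum.inr false)

/-- A statement of the second machine. -/
def seqRight : TM2.Stmt M₂.Γ M₂.Λ M₂.σ → TM2.Stmt (SeqΓ M₁ M₂) (SeqΛ M₁ M₂) (Seqσ M₁ M₂)
  | .push k f q => .push (Sum.inr (Sum.inl k)) (fun s => f s.1.2) (seqRight q)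
  | .peek k f q => .peek (Sum.inr (Sum.inl k)) (fun s o => ((s.1.1, f s.1.2 o), s.2)) (seqRight q)
  | .pop k f q => .pop (Sum.inr (Sum.inl k)) (fun s o => ((s.1.1, f s.1.2 o), s.2)) (seqRight q)
  | .load a q => .load (fun s => ((s.1.1, a s.1.2), s.2)) (seqRight q)
  | .branch f q₁ q₂ => .branch (fun s => f s.1.2) (seqRight q₁) (seqRight q₂)
  | .goto f => .goto fun s => Sum.inr (Sum.inl (f s.1.2))
  | .halt => .halt

/-- The configurations of the sequential composition. -/
abbrev SeqCfg : Type := TM2.Cfg (SeqΓ M₁ M₂) (SeqΛ M₁ M₂) (Seqσ M₁ M₂)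

variable (e₁ : M₁.Γ M₁.k₁ ≃ Γ') (e₂ : M₂.Γ M₂.k₀ ≃ Γ')

/-- The program of the sequential composition: the first machine, two loops that copy its output
to the input stack of the second machine, and the second machine. -/
def seqCode : SeqΛ M₁ M₂ → TM2.Stmt (SeqΓ M₁ M₂) (SeqΛ M₁ M₂) (Seqσ M₁ M₂)
  | .inl l => seqLeft M₁ M₂ (M₁.m l)
  | .inr (.inl l) => seqRight M₁ M₂ (M₂.m l)
  | .inr (.inr false) =>
    .pop (Sum.inl M₁.k₁) (fun s (o : Option (M₁.Γ M₁.k₁)) => (s.1, o.map e₁))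
      (.branch (fun s => s.2.isSome)
        (.push (Sum.inr (Sum.inr ())) (fun s => (s.2.getD .blank : Γ'))
          (.goto fun _ => Sum.inr (Sum.inr false)))
        (.goto fun _ => Sum.inr (Sum.inr true)))
  | .inr (.inr true) =>
    .pop (Sum.inr (Sum.inr ())) (fun s (o : Option Γ') => (s.1, o))
      (.branch (fun s => s.2.isSome)
        (.push (Sum.inr (Sum.inl M₂.k₀)) (fun s => (e₂.symm (s.2.getD .blank) : M₂.Γ M₂.k₀))
          (.goto fun _ => Sum.inr (Sum.inr true)))
        (.goto fun _ => Sum.inr (Sum.inl M₂.main)))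

variable {M₁ M₂}

/-- The stacks of the sequential composition, put together from their parts. -/
def seqStk (S₁ : ∀ k, List (M₁.Γ k)) (S₂ : ∀ k, List (M₂.Γ k)) (A : List Γ') :
    ∀ k, List (SeqΓ M₁ M₂ k)
  | .inl k => S₁ k
  | .inr (.inl k) => S₂ k
  | .inr (.inr _) => A

theorem update_seqStk_left (S₁ : ∀ k, List (M₁.Γ k)) (S₂ : ∀ k, List (M₂.Γ k)) (A : List Γ')
    (k : M₁.K) (x : List (M₁.Γ k)) :
    Function.update (seqStk S₁ S₂ A) (Sum.inl k) x = seqStk (Function.update S₁ k x) S₂ A := by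
  funext j
  rcases j with j | j | j
  · by_cases h : j = k
    · subst h; simp [seqStk]
    · rw [Function.update_of_ne (by simpa using h)]; simp [seqStk, h]
  · simp [seqStk]
  · simp [seqStk]

theorem update_seqStk_right (S₁ : ∀ k, List (M₁.Γ k)) (S₂ : ∀ k, List (M₂.Γ k)) (A : List Γ')
    (k : M₂.K) (x : List (M₂.Γ k)) :
    Function.update (seqStk S₁ S₂ A) (Sum.inr (Sum.inl k)) x
      = seqStk S₁ (Function.update S₂ k x) A := by
  funext j
  rcases j with j | j | j
  · simp [seqStk]
  · by_cases h : j = k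
    · subst h; simp [seqStk]
    · rw [Function.update_of_ne (by simpa using h)]; simp [seqStk, h]
  · simp [seqStk]

theorem update_seqStk_aux (S₁ : ∀ k, List (M₁.Γ k)) (S₂ : ∀ k, List (M₂.Γ k)) (A x : List Γ') :
    Function.update (seqStk S₁ S₂ A) (Sum.inr (Sum.inr ())) x = seqStk S₁ S₂ x := by
  funext j
  rcases j with j | j | j <;> simp [seqStk]

/-- A configuration of the first machine inside the sequential composition. -/
def seqCfgLeft (S₂ : ∀ k, List (M₂.Γ k)) (v₂ : M₂.σ) (c : M₁.Cfg) : SeqCfg M₁ M₂ :=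
  ⟨match c.l with
    | some l => some (Sum.inl l)
    | none => some (Sum.inr (Sum.inr false)), ((c.var, v₂), none), seqStk c.stk S₂ []⟩

/-- A configuration of the second machine inside the sequential composition. -/
def seqCfgRight (S₁ : ∀ k, List (M₁.Γ k)) (v₁ : M₁.σ) (c : M₂.Cfg) : SeqCfg M₁ M₂ :=
  ⟨match c.l with
    | some l => some (Sum.inr (Sum.inl l))
    | none => none, ((v₁, c.var), none), seqStk S₁ c.stk []⟩

/-- The translated statements touch neither the auxiliary stack nor the extra register. Since `halt`
is translated to a jump, a halted configuration of the first machine corresponds to the entry of the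
first copying loop. -/
theorem stepAux_seqLeft (S₂ : ∀ k, List (M₂.Γ k)) (v₂ : M₂.σ)
    (q : TM2.Stmt M₁.Γ M₁.Λ M₁.σ) (v : M₁.σ) (S : ∀ k, List (M₁.Γ k)) :
    (TM2.stepAux (seqLeft M₁ M₂ q) ((v, v₂), none) (seqStk S S₂ []) : SeqCfg M₁ M₂)
      = seqCfgLeft S₂ v₂ (TM2.stepAux q v S) := by
  induction q generalizing v S with
  | push k f q ih =>
    simp only [seqLeft, TM2.stepAux]
    rw [← ih, update_seqStk_left]; rfl
  | peek k f q ih => simp only [seqLeft, TM2.stepAux]; rw [← ih]; rfl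
  | pop k f q ih =>
    simp only [seqLeft, TM2.stepAux]
    rw [← ih, update_seqStk_left]; rfl
  | load a q ih => simp only [seqLeft, TM2.stepAux]; rw [← ih]
  | branch f q₁ q₂ ih₁ ih₂ =>
    simp only [seqLeft, TM2.stepAux]
    cases f v
    · exact ih₂ v S
    · exact ih₁ v S
  | goto f => rfl
  | halt => rfl

theorem stepAux_seqRight (S₁ : ∀ k, List (M₁.Γ k)) (v₁ : M₁.σ)
    (q : TM2.Stmt M₂.Γ M₂.Λ M₂.σ) (v : M₂.σ) (S : ∀ k, List (M₂.Γ k)) :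
    (TM2.stepAux (seqRight M₁ M₂ q) ((v₁, v), none) (seqStk S₁ S []) : SeqCfg M₁ M₂)
      = seqCfgRight S₁ v₁ (TM2.stepAux q v S) := by
  induction q generalizing v S with
  | push k f q ih =>
    simp only [seqRight, TM2.stepAux]
    rw [← ih, update_seqStk_right]; rfl
  | peek k f q ih => simp only [seqRight, TM2.stepAux]; rw [← ih]; rfl
  | pop k f q ih =>
    simp only [seqRight, TM2.stepAux]
    rw [← ih, update_seqStk_right]; rfl
  | load a q ih => simp only [seqRight, TM2.stepAux]; rw [← ih]
  | branch f q₁ q₂ ih₁ ih₂ =>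
    simp only [seqRight, TM2.stepAux]
    cases f v
    · exact ih₂ v S
    · exact ih₁ v S
  | goto f => rfl
  | halt => rfl

theorem iterate_seqLeft (S₂ : ∀ k, List (M₂.Γ k)) (v₂ : M₂.σ) (n : ℕ) (c c' : M₁.Cfg)
    (h : (flip bind M₁.step)^[n] (some c) = some c') :
    (flip bind (TM2.step (seqCode M₁ M₂ e₁ e₂)))^[n] (some (seqCfgLeft S₂ v₂ c))
      = some (seqCfgLeft S₂ v₂ c') := by
  induction n generalizing c with
  | zero => cases h; rfl
  | succ n ih =>
    rw [iterate_bind_succ] at h ⊢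
    obtain ⟨_ | l, v, S⟩ := c
    · change (flip bind M₁.step)^[n] none = _ at h
      rw [iterate_bind_none] at h; cases h
    · rw [← ih _ h]
      exact congrArg _ (congrArg some (stepAux_seqLeft S₂ v₂ (M₁.m l) v S))

theorem iterate_seqRight (S₁ : ∀ k, List (M₁.Γ k)) (v₁ : M₁.σ) (n : ℕ) (c c' : M₂.Cfg)
    (h : (flip bind M₂.step)^[n] (some c) = some c') :
    (flip bind (TM2.step (seqCode M₁ M₂ e₁ e₂)))^[n] (some (seqCfgRight S₁ v₁ c))
      = some (seqCfgRight S₁ v₁ c') := by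
  induction n generalizing c with
  | zero => cases h; rfl
  | succ n ih =>
    rw [iterate_bind_succ] at h ⊢
    obtain ⟨_ | l, v, S⟩ := c
    · change (flip bind M₂.step)^[n] none = _ at h
      rw [iterate_bind_none] at h; cases h
    · rw [← ih _ h]
      exact congrArg _ (congrArg some (stepAux_seqRight S₁ v₁ (M₂.m l) v S))

/-- The stacks that hold `s` on the stack `k` and are empty otherwise. -/
def singleStk {K : Type} [DecidableEq K] {Γ : K → Type} (k : K) (s : List (Γ k)) :
    ∀ j, List (Γ j) :=
  Function.update (fun _ => []) k s

theorem initList_eq (M : FinTM2) (s : List (M.Γ M.k₀)) :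
    initList M s = ⟨some M.main, M.initialState, singleStk M.k₀ s⟩ := by
  simp only [initList, singleStk]
  congr 1
  funext j
  by_cases h : j = M.k₀
  · subst h; simp
  · simp [h]

theorem haltList_eq (M : FinTM2) (s : List (M.Γ M.k₁)) :
    haltList M s = ⟨none, M.initialState, singleStk M.k₁ s⟩ := by
  simp only [haltList, singleStk]
  congr 1
  funext j
  by_cases h : j = M.k₁
  · subst h; simp
  · simp [h]

/-- Popping reverses the string, which is why a second loop must follow. The register content `b` is
arbitrary because every round overwrites it before reading it. -/
theorem iterate_copy_out (v₁ : M₁.σ) (v₂ : M₂.σ) (S₂ : ∀ k, List (M₂.Γ k))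
    (s : List (M₁.Γ M₁.k₁)) (A : List Γ') (b : Option Γ') :
    (flip bind (TM2.step (seqCode M₁ M₂ e₁ e₂)))^[s.length + 1]
      (some (⟨some (Sum.inr (Sum.inr false)), ((v₁, v₂), b), seqStk (singleStk M₁.k₁ s) S₂ A⟩ :
        SeqCfg M₁ M₂))
      = some (⟨some (Sum.inr (Sum.inr true)), ((v₁, v₂), none),
          seqStk (fun _ => []) S₂ ((s.map e₁).reverse ++ A)⟩ :
        SeqCfg M₁ M₂) := by
  induction s generalizing A b with
  | nil =>
    rw [iterate_bind_succ]
    change some (TM2.stepAux (seqCode M₁ M₂ e₁ e₂ (Sum.inr (Sum.inr false))) _ _) = _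
    simp only [seqCode, TM2.stepAux]
    have : (seqStk (singleStk M₁.k₁ []) S₂ A (Sum.inl M₁.k₁)) = [] := by simp [seqStk, singleStk]
    rw [this]
    simp only [List.tail_nil, update_seqStk_left]
    simp [singleStk]
  | cons a s ih =>
    rw [List.length_cons, iterate_bind_succ, List.map_cons, List.reverse_cons, List.append_assoc,
      List.singleton_append, ← ih (e₁ a :: A) (some (e₁ a))]
    congr 1
    change some (TM2.stepAux (seqCode M₁ M₂ e₁ e₂ (Sum.inr (Sum.inr false))) _ _) = _
    simp only [seqCode, TM2.stepAux]
    have : (seqStk (singleStk M₁.k₁ (a :: s)) S₂ A (Sum.inl M₁.k₁)) = a :: s := by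
      simp [seqStk, singleStk]
    rw [this]
    simp only [List.tail_cons, update_seqStk_left]
    simp only [List.head?_cons, Option.map_some, Option.isSome_some, Option.getD_some, cond_true]
    rw [update_seqStk_aux]
    simp [singleStk, seqStk]

theorem iterate_copy_in (v₁ : M₁.σ) (v₂ : M₂.σ) (S₁ : ∀ k, List (M₁.Γ k))
    (s : List (M₂.Γ M₂.k₀)) (A : List Γ') (b : Option Γ') :
    (flip bind (TM2.step (seqCode M₁ M₂ e₁ e₂)))^[A.length + 1]
      (some (⟨some (Sum.inr (Sum.inr true)), ((v₁, v₂), b), seqStk S₁ (singleStk M₂.k₀ s) A⟩ :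
        SeqCfg M₁ M₂))
      = some (⟨some (Sum.inr (Sum.inl M₂.main)), ((v₁, v₂), none),
          seqStk S₁ (singleStk M₂.k₀ ((A.map e₂.symm).reverse ++ s)) []⟩ :
        SeqCfg M₁ M₂) := by
  induction A generalizing s b with
  | nil =>
    rw [iterate_bind_succ]
    change some (TM2.stepAux (seqCode M₁ M₂ e₁ e₂ (Sum.inr (Sum.inr true))) _ _) = _
    simp only [seqCode, TM2.stepAux]
    rw [update_seqStk_aux]
    simp [seqStk]
  | cons a A ih =>
    rw [List.length_cons, iterate_bind_succ, List.map_cons, List.reverse_cons, List.append_assoc,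
      List.singleton_append, ← ih (e₂.symm a :: s) (some a)]
    congr 1
    change some (TM2.stepAux (seqCode M₁ M₂ e₁ e₂ (Sum.inr (Sum.inr true))) _ _) = _
    simp only [seqCode, TM2.stepAux]
    rw [update_seqStk_aux]
    have : seqStk S₁ (singleStk M₂.k₀ s) (a :: A) (Sum.inr (Sum.inr ())) = a :: A := rfl
    rw [this]
    simp only [List.tail_cons]
    simp only [List.head?_cons, Option.isSome_some, Option.getD_some, cond_true]
    rw [update_seqStk_right]
    simp [singleStk, seqStk]

/-- The phases fit together because `haltList` prescribes the initial state and empties every stack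
except the output. After the two copying loops the second machine thus stands in its own initial
configuration. -/
theorem iterate_seqCfg {s₀ : List (M₁.Γ M₁.k₀)} {w : List Γ'} {s₂ : List (M₂.Γ M₂.k₁)} {n₁ n₂ : ℕ}
    (h₁ : (flip bind M₁.step)^[n₁] (some (initList M₁ s₀))
      = some (haltList M₁ (w.map e₁.symm)))
    (h₂ : (flip bind M₂.step)^[n₂] (some (initList M₂ (w.map e₂.symm))) = some (haltList M₂ s₂)) :
    (flip bind (TM2.step (seqCode M₁ M₂ e₁ e₂)))^[n₂ + (w.length + 1) + (w.length + 1) + n₁]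
      (some (seqCfgLeft (fun _ => []) M₂.initialState (initList M₁ s₀)))
      = some (seqCfgRight (fun _ => []) M₁.initialState (haltList M₂ s₂)) := by
  rw [Function.iterate_add_apply, iterate_seqLeft _ _ _ _ _ _ _ h₁,
    Function.iterate_add_apply, haltList_eq]
  have key := iterate_copy_out (M₁ := M₁) (M₂ := M₂) e₁ e₂ M₁.initialState M₂.initialState
    (fun _ => []) (w.map e₁.symm) [] none
  rw [List.length_map] at key
  have key' := iterate_copy_in (M₁ := M₁) (M₂ := M₂) e₁ e₂ M₁.initialState M₂.initialState
    (fun _ => []) [] w.reverse none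
  rw [List.length_reverse] at key'
  have e : (List.map e₁ (List.map e₁.symm w)).reverse ++ [] = w.reverse := by simp
  rw [e] at key
  have e' : (singleStk M₂.k₀ [] : ∀ k, List (M₂.Γ k)) = fun _ => [] := by simp [singleStk]
  rw [e'] at key'
  have e'' : (List.map e₂.symm w.reverse).reverse ++ [] = w.map e₂.symm := by simp
  rw [e''] at key'
  refine (congrArg _ key).trans ?_
  rw [Function.iterate_add_apply]
  refine (congrArg _ key').trans ?_
  refine Eq.trans ?_ (iterate_seqRight e₁ e₂ (fun _ => []) M₁.initialState n₂ _ _ h₂)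
  rw [initList_eq]
  rfl

variable (M₁ M₂) in
/-- The sequential composition of two machines. -/
def seq : FinTM2 :=
  letI := M₁.kDecidableEq
  letI := M₂.kDecidableEq
  letI := M₁.kFin
  letI := M₂.kFin
  letI := M₁.ΛFin
  letI := M₂.ΛFin
  letI := M₁.σFin
  letI := M₂.σFin
  letI := M₁.Γk₀Fin
  { K := SeqK M₁ M₂
    k₀ := Sum.inl M₁.k₀
    k₁ := Sum.inr (Sum.inl M₂.k₁)
    Γ := SeqΓ M₁ M₂
    Λ := SeqΛ M₁ M₂
    main := Sum.inl M₁.main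
    σ := Seqσ M₁ M₂
    initialState := ((M₁.initialState, M₂.initialState), none)
    Γk₀Fin := M₁.Γk₀Fin
    m := seqCode M₁ M₂ e₁ e₂ }

theorem initList_seq (s₀ : List (M₁.Γ M₁.k₀)) :
    initList (seq M₁ M₂ e₁ e₂) s₀
      = (seqCfgLeft (fun _ => []) M₂.initialState (initList M₁ s₀) : SeqCfg M₁ M₂) := by
  refine (initList_eq (seq M₁ M₂ e₁ e₂) s₀).trans ?_
  rw [initList_eq M₁ s₀]
  refine congrArg (fun S => (⟨_, _, S⟩ : SeqCfg M₁ M₂)) ?_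
  have := update_seqStk_left (M₁ := M₁) (M₂ := M₂) (fun _ => []) (fun _ => []) [] M₁.k₀ s₀
  refine Eq.trans ?_ this
  refine congrArg (fun S : ∀ k, List (SeqΓ M₁ M₂ k) => Function.update S (Sum.inl M₁.k₀) s₀) ?_
  funext j
  rcases j with j | j | j <;> rfl

theorem haltList_seq (s₂ : List (M₂.Γ M₂.k₁)) :
    haltList (seq M₁ M₂ e₁ e₂) s₂
      = (seqCfgRight (fun _ => []) M₁.initialState (haltList M₂ s₂) : SeqCfg M₁ M₂) := by
  refine (haltList_eq (seq M₁ M₂ e₁ e₂) s₂).trans ?_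
  rw [haltList_eq M₂ s₂]
  refine congrArg (fun S => (⟨_, _, S⟩ : SeqCfg M₁ M₂)) ?_
  have := update_seqStk_right (M₁ := M₁) (M₂ := M₂) (fun _ => []) (fun _ => []) [] M₂.k₁ s₂
  refine Eq.trans ?_ this
  refine congrArg
    (fun S : ∀ k, List (SeqΓ M₁ M₂ k) => Function.update S (Sum.inr (Sum.inl M₂.k₁)) s₂) ?_
  funext j
  rcases j with j | j | j <;> rfl

end Sequence

end FinTM2

theorem polynomial_eval_mono (p : Polynomial ℕ) {a b : ℕ} (h : a ≤ b) : p.eval a ≤ p.eval b := by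
  rw [Polynomial.eval_eq_sum, Polynomial.eval_eq_sum]
  exact Finset.sum_le_sum fun i _ => Nat.mul_le_mul_left _ (Nat.pow_le_pow_left h i)

/-- The composition of polynomial time computable functions is polynomial time computable, if the
intermediate result has polynomial length. -/
theorem TM2ComputableInPolyTime.comp_of_length_le {α β γ : Type} {γΓ : Type}
    {eα : α → List Γ'} {eβ : β → List Γ'} {eγ : γ → List γΓ} {f : α → β} {g : β → γ}
    (h₁ : TM2ComputableInPolyTime eα eβ f) (h₂ : TM2ComputableInPolyTime eβ eγ g)
    (p : Polynomial ℕ) (hp : ∀ a, (eβ (f a)).length ≤ p.eval (eα a).length) :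
    Nonempty (TM2ComputableInPolyTime eα eγ (g ∘ f)) := by
  refine ⟨{ tm := FinTM2.seq h₁.tm h₂.tm h₁.outputAlphabet h₂.inputAlphabet
            inputAlphabet := h₁.inputAlphabet
            outputAlphabet := h₂.outputAlphabet
            -- The second machine is timed at `p`, the bound on the length of its input; each `p +
            -- 1` pays for one copying loop.
            time := h₂.time.comp p + (p + 1) + (p + 1) + h₁.time
            outputsFun := fun a => ?_ }⟩
  have o₁ := h₁.outputsFun a
  have o₂ := h₂.outputsFun (f a)
  refine ⟨⟨o₂.steps + ((eβ (f a)).length + 1) + ((eβ (f a)).length + 1) + o₁.steps, ?_⟩, ?_⟩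
  · have h := FinTM2.iterate_seqCfg h₁.outputAlphabet h₂.inputAlphabet o₁.evals_in_steps
      o₂.evals_in_steps
    exact (congrArg (fun c => _^[_] (some c)) (FinTM2.initList_seq _ _ _)).trans
      (h.trans (congrArg some (FinTM2.haltList_seq _ _ _)).symm)
  · have b₁ := o₁.steps_le_m
    have b₂ := o₂.steps_le_m.trans (polynomial_eval_mono h₂.time (hp a))
    have b₃ := hp a
    simp only [Polynomial.eval_add, Polynomial.eval_comp, Polynomial.eval_one]
    omega

end Turing

/-- A polynomial time reduction whose outputs have polynomial length transfers polynomial time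
solvability. -/
theorem PolyTimeSolvableOn.of_reduction {α β : Type} {encα : α → List Computability.Γ'}
    {C P : α → Prop} {encβ : β → List Computability.Γ'} {D Q : β → Prop}
    {f : {a // C a} → {b // D b}}
    (hf : Nonempty (Turing.TM2ComputableInPolyTime
      (fun a : {a // C a} => encα a) (fun b : {b // D b} => encβ b) f))
    (p : Polynomial ℕ) (hp : ∀ a, (encβ (f a)).length ≤ p.eval (encα a).length)
    (hPQ : ∀ a : {a // C a}, P a ↔ Q (f a)) (h : PolyTimeSolvableOn encβ D Q) :
    PolyTimeSolvableOn encα C P := by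
  obtain ⟨g, ⟨hg⟩, hgQ⟩ := h
  obtain ⟨hf⟩ := hf
  exact ⟨g ∘ f, hf.comp_of_length_le hg p hp, fun a => (hgQ (f a)).trans (hPQ a).symm⟩

/-! ### Flowcharts over four stacks -/

namespace StackProg

open Computability Turing

/-- The contents of the four stacks. -/
abbrev Stk : Type := Fin 4 → List Γ'

/-- An instruction with continuations in `L`. -/
inductive Instr (L : Type) : Type
  | push (k : Fin 4) (a : Γ') (l : L)
  | pop (k : Fin 4) (l : Option Γ' → L)

/-- Renaming of the continuations. -/
def Instr.map {L L' : Type} (f : L → L') : Instr L → Instr L'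
  | push k a l => push k a (f l)
  | pop k l => pop k fun o => f (l o)

/-- The effect of an instruction. -/
def Instr.exec {L : Type} : Instr L → Stk → L × Stk
  | push k a l, st => (l, Function.update st k (a :: st k))
  | pop k l, st => (l (st k).head?, Function.update st k (st k).tail)

theorem Instr.exec_map {L L' : Type} (f : L → L') (i : Instr L) (st : Stk) :
    (i.map f).exec st = (f (i.exec st).1, (i.exec st).2) := by
  cases i <;> rfl

/-- A flowchart with entry `start` and exits `E`. -/
structure Frag (E : Type) where
  Λ : Type
  [fin : Fintype Λ]
  start : Λ
  code : Λ → Instr (Λ ⊕ E)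

namespace Frag

/-- One step; exits are fixed points. -/
def step {E : Type} (F : Frag E) : (F.Λ ⊕ E) × Stk → (F.Λ ⊕ E) × Stk
  | (.inl l, st) => (F.code l).exec st
  | (.inr e, st) => (.inr e, st)

/-- `c'` is reached from `c` in at most `T` steps. -/
def Reach {E : Type} (F : Frag E) (T : ℕ) (c c' : (F.Λ ⊕ E) × Stk) : Prop :=
  ∃ t ≤ T, F.step^[t] c = c'

/-- Started with the stacks `st`, the flowchart reaches the exit `e` with the stacks `st'` in at
most `T` steps. -/
def Run {E : Type} (F : Frag E) (st : Stk) (T : ℕ) (e : E) (st' : Stk) : Prop :=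
  F.Reach T (.inl F.start, st) (.inr e, st')

variable {E X : Type}

theorem Reach.trans {F : Frag E} {T T' : ℕ} {c c' c''} (h : F.Reach T c c')
    (h' : F.Reach T' c' c'') : F.Reach (T + T') c c'' := by
  obtain ⟨t, ht, rfl⟩ := h
  obtain ⟨t', ht', rfl⟩ := h'
  exact ⟨t' + t, by omega, Function.iterate_add_apply ..⟩

theorem Reach.mono {F : Frag E} {T T' : ℕ} {c c'} (h : F.Reach T c c') (hT : T ≤ T') :
    F.Reach T' c c' := by
  obtain ⟨t, ht, e⟩ := h
  exact ⟨t, ht.trans hT, e⟩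

theorem Run.mono {F : Frag E} {T T' : ℕ} {st st' e} (h : F.Run st T e st') (hT : T ≤ T') :
    F.Run st T' e st' :=
  Reach.mono h hT

theorem iterate_step_exit (F : Frag E) (n : ℕ) (e : E) (st : Stk) :
    F.step^[n] (.inr e, st) = (.inr e, st) := by
  induction n with
  | zero => rfl
  | succ n ih => rw [Function.iterate_succ_apply]; exact ih

section Graph

variable {Q : Type} [Fintype Q] {E : Q → Type} (F : ∀ q, Frag (E q)) (start : Q)
  (next : ∀ q, E q → Q ⊕ X)

/-- The place where a connection leads to. -/
def graphGoto : Q ⊕ X → (Σ q, (F q).Λ) ⊕ X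
  | .inl q => .inl ⟨q, (F q).start⟩
  | .inr x => .inr x

/-- Flowcharts connected to a larger flowchart. -/
def graph : Frag X :=
  letI := fun q => (F q).fin
  { Λ := Σ q, (F q).Λ
    start := ⟨start, (F start).start⟩
    code := fun l => ((F l.1).code l.2).map
      (Sum.elim (fun l' => .inl ⟨l.1, l'⟩) fun e => graphGoto F (next l.1 e)) }

/-- Only an upper bound on the number of steps can be transferred: the component may exit before
step `t` and rest there, while the large flowchart moves on. -/
theorem graph_iterate {q : Q} {t : ℕ} {l : (F q).Λ} {st st' : Stk} {e : E q}
    (h : (F q).step^[t] (.inl l, st) = (.inr e, st')) :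
    (graph F start next).Reach t (.inl ⟨q, l⟩, st) (graphGoto F (next q e), st') := by
  induction t generalizing l st with
  | zero => simp at h
  | succ t ih =>
    rw [Function.iterate_succ_apply] at h
    have hs : (graph F start next).step (.inl ⟨q, l⟩, st)
        = (Sum.elim (fun l' => .inl ⟨q, l'⟩) (fun e => graphGoto F (next q e))
            ((F q).step (.inl l, st)).1, ((F q).step (.inl l, st)).2) :=
      Instr.exec_map _ _ _
    rcases hc : (F q).step (.inl l, st) with ⟨l' | e', st₁⟩
    · rw [hc] at h hs
      obtain ⟨t', ht', e⟩ := ih h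
      refine ⟨t' + 1, by omega, ?_⟩
      rw [Function.iterate_succ_apply, hs]
      exact e
    · rw [hc] at h hs
      rw [iterate_step_exit] at h
      cases h
      exact ⟨1, by omega, hs⟩

theorem graph_reach {q : Q} {T : ℕ} {st st' : Stk} {e : E q} (h : (F q).Run st T e st') :
    (graph F start next).Reach T (graphGoto F (.inl q), st) (graphGoto F (next q e), st') := by
  obtain ⟨t, ht, e⟩ := h
  exact (graph_iterate F start next e).mono ht

end Graph

/-- Push a symbol. -/
def push (k : Fin 4) (a : Γ') : Frag Unit where
  Λ := Unit
  start := ()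
  code _ := .push k a (.inr ())

/-- Pop a symbol. -/
def pop (k : Fin 4) : Frag (Option Γ') where
  Λ := Unit
  start := ()
  code _ := .pop k fun o => .inr o

/-- No effect. -/
def pure (e : E) : Frag E where
  Λ := Bool
  start := false
  -- The entry is a label and never an exit, so some instruction is needed; a push that is undone
  -- leaves the stacks as they were.
  code b := if b then .pop 0 fun _ => .inr e else .push 0 .blank (.inl true)

/-- Sequential composition, where the exit of the first flowchart selects the second one. -/
def bind [Fintype E] (F : Frag E) (G : E → Frag X) : Frag X :=
  graph (Q := Option E) (E := fun q => q.elim E fun _ => X)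
    (fun q => match q with
      | none => F
      | some e => G e) none
    (fun q => match q with
      | none => fun e => .inl (some e)
      | some _ => fun x => .inr x)

/-- Repetition, as long as the exit is on the left. -/
def loop (F : Frag (Unit ⊕ X)) : Frag X :=
  graph (Q := Unit) (E := fun _ => Unit ⊕ X) (fun _ => F) () (fun _ e => e)

theorem run_push (k : Fin 4) (a : Γ') (st : Stk) :
    (push k a).Run st 1 () (Function.update st k (a :: st k)) :=
  ⟨1, le_rfl, rfl⟩

theorem run_pop (k : Fin 4) (st : Stk) :
    (pop k).Run st 1 (st k).head? (Function.update st k (st k).tail) :=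
  ⟨1, le_rfl, rfl⟩

theorem run_pure (e : E) (st : Stk) : (pure e).Run st 2 e st := by
  refine ⟨2, le_rfl, ?_⟩
  have h : (pure e).step^[2] (.inl false, st)
      = (.inr e, Function.update (Function.update st 0 (.blank :: st 0)) 0
          (Function.update st 0 (.blank :: st 0) 0).tail) := rfl
  refine h.trans ?_
  simp

theorem Run.bind [Fintype E] {F : Frag E} {G : E → Frag X} {st st₁ st₂ : Stk} {T T' : ℕ}
    {e : E} {x : X} (h : F.Run st T e st₁) (h' : (G e).Run st₁ T' x st₂) :
    (F.bind G).Run st (T + T') x st₂ :=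
  (graph_reach (Q := Option E) (E := fun q => q.elim E fun _ => X)
      (fun q => match q with
        | none => F
        | some e => G e) none
      (fun q => match q with
        | none => fun e => .inl (some e)
        | some _ => fun x => .inr x) (q := none) h).trans
    (graph_reach (Q := Option E) (E := fun q => q.elim E fun _ => X)
      (fun q => match q with
        | none => F
        | some e => G e) none
      (fun q => match q with
        | none => fun e => .inl (some e)
        | some _ => fun x => .inr x) (q := some e) h')

theorem Run.loop_exit {F : Frag (Unit ⊕ X)} {st st₁ : Stk} {T : ℕ} {x : X}
    (h : F.Run st T (.inr x) st₁) : F.loop.Run st T x st₁ :=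
  graph_reach (Q := Unit) (E := fun _ => Unit ⊕ X) (fun _ => F) () (fun _ e => e) (q := ()) h

theorem Run.loop_step {F : Frag (Unit ⊕ X)} {st st₁ st₂ : Stk} {T T' : ℕ} {x : X}
    (h : F.Run st T (.inl ()) st₁) (h' : F.loop.Run st₁ T' x st₂) :
    F.loop.Run st (T + T') x st₂ :=
  (graph_reach (Q := Unit) (E := fun _ => Unit ⊕ X) (fun _ => F) () (fun _ e => e)
    (q := ()) h).trans h'

/-! #### Translation to machines -/

/-- The machine statement of an instruction. -/
def stmt {L : Type} : Instr (L ⊕ Unit) → TM2.Stmt (fun _ : Fin 4 => Γ') (Option L) (Option Γ')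
  | .push k a l => .push k (fun _ => a) (.goto fun _ => l.elim some fun _ => none)
  | .pop k l => .pop k (fun _ o => o) (.goto fun o => (l o).elim some fun _ => none)

/-- The machine of a flowchart; its input and output are on the stack `0`. -/
def machine (F : Frag Unit) : FinTM2 :=
  letI := F.fin
  { K := Fin 4
    k₀ := 0
    k₁ := 0
    Γ := fun _ => Γ'
    Λ := Option F.Λ
    main := some F.start
    σ := Option Γ'
    initialState := none
    m := fun l => match l with
      | some l => stmt (F.code l)
      -- The internal state still holds the last popped symbol, but `haltList` demands the initial
      -- one.
      | none => .load (fun _ => none) .halt }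

theorem machine_step (F : Frag Unit) (l : F.Λ) (v : Option Γ') (st : Stk) :
    ∃ v', F.machine.step ⟨some (some l), v, st⟩
      = some ⟨some ((F.step (.inl l, st)).1.elim some fun _ => none), v',
          (F.step (.inl l, st)).2⟩ := by
  rcases h : F.code l with ⟨k, a, l'⟩ | ⟨k, l'⟩
  · refine ⟨v, ?_⟩
    change some (TM2.stepAux (stmt (F.code l)) v st) = _
    simp only [step, h]
    rfl
  · refine ⟨(st k).head?, ?_⟩
    change some (TM2.stepAux (stmt (F.code l)) v st) = _
    simp only [step, h]
    rfl

theorem machine_iterate (F : Frag Unit) {t : ℕ} {l : F.Λ} {v : Option Γ'} {st st' : Stk}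
    (h : F.step^[t] (.inl l, st) = (.inr (), st')) :
    ∃ t' ≤ t + 1, (flip Bind.bind F.machine.step)^[t'] (some ⟨some (some l), v, st⟩)
      = some ⟨none, none, st'⟩ := by
  induction t generalizing l v st with
  | zero => simp at h
  | succ t ih =>
    rw [Function.iterate_succ_apply] at h
    obtain ⟨v', hv⟩ := machine_step F l v st
    rcases hc : F.step (.inl l, st) with ⟨l' | e', st₁⟩
    · rw [hc] at h hv
      obtain ⟨t', ht', e⟩ := ih (v := v') h
      exact ⟨t' + 1, by omega, (iterate_bind_succ _ _ _).trans ((congrArg _ hv).trans e)⟩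
    · rw [hc] at h hv
      rw [iterate_step_exit] at h
      cases h
      exact ⟨2, by omega, (iterate_bind_succ _ _ _).trans ((congrArg _ hv).trans rfl)⟩

/-- A flowchart that transforms encodings within polynomial time gives a polynomial time machine. -/
theorem computable {α β : Type} {ea : α → List Γ'} {eb : β → List Γ'} {f : α → β} (F : Frag Unit)
    (p : Polynomial ℕ)
    (h : ∀ a, F.Run ![ea a, [], [], []] (p.eval (ea a).length) () ![eb (f a), [], [], []]) :
    Nonempty (TM2ComputableInPolyTime ea eb f) := by
  refine ⟨{ tm := F.machine
            inputAlphabet := Equiv.refl _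
            outputAlphabet := Equiv.refl _
            time := p + 1
            outputsFun := fun a => Classical.choice ?_ }⟩
  obtain ⟨t, ht, e⟩ := h a
  obtain ⟨t', ht', e'⟩ := machine_iterate F (v := none) e
  have hsingle : ∀ s : List Γ', (FinTM2.singleStk (0 : Fin 4) s : Fin 4 → List Γ')
      = ![s, [], [], []] := by
    intro s
    funext j
    fin_cases j <;> rfl
  have hi : initList F.machine (List.map (Equiv.refl Γ').invFun (ea a))
      = ⟨some (some F.start), none, ![ea a, [], [], []]⟩ := by
    refine (FinTM2.initList_eq F.machine _).trans ?_
    refine congrArg (fun S => (⟨_, _, S⟩ : TM2.Cfg (fun _ : Fin 4 => Γ') (Option F.Λ) (Option Γ')))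
      (Eq.trans ?_ (hsingle (ea a)))
    exact congrArg _ (List.map_id _)
  have ho : haltList F.machine (List.map (Equiv.refl Γ').invFun (eb (f a)))
      = ⟨none, none, ![eb (f a), [], [], []]⟩ := by
    refine (FinTM2.haltList_eq F.machine _).trans ?_
    refine congrArg (fun S => (⟨_, _, S⟩ : TM2.Cfg (fun _ : Fin 4 => Γ') (Option F.Λ) (Option Γ')))
      (Eq.trans ?_ (hsingle (eb (f a))))
    exact congrArg _ (List.map_id _)
  refine ⟨⟨t', ?_⟩, ?_⟩
  · exact (congrArg (fun c => _^[_] (some c)) hi).trans (e'.trans (congrArg some ho.symm))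
  · rw [Polynomial.eval_add, Polynomial.eval_one]
    exact ht'.trans (Nat.succ_le_succ ht)

end Frag

end StackProg

/-! ### Programs that work on binary trees -/

namespace StackProg

open Computability Turing

/-- Binary trees, the universal data type. -/
inductive Dat : Type
  | nil
  | cons (a b : Dat)

/-- The prefix code of a tree. -/
def Dat.bits : Dat → List Bool
  | nil => [false]
  | cons a b => true :: (a.bits ++ b.bits)

/-- The prefix code of a tree as a string over the machine alphabet. -/
def Dat.enc (x : Dat) : List Γ' := x.bits.map Γ'.bit

theorem Dat.enc_nil : Dat.nil.enc = [.bit false] := rfl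

theorem Dat.enc_cons (a b : Dat) : (Dat.cons a b).enc = .bit true :: (a.enc ++ b.enc) := by
  simp [enc, bits]

@[simp] theorem update_stk_zero (a b c d x : List Γ') :
    Function.update (![a, b, c, d] : Stk) 0 x = ![x, b, c, d] := by
  funext j; fin_cases j <;> rfl

@[simp] theorem update_stk_one (a b c d x : List Γ') :
    Function.update (![a, b, c, d] : Stk) 1 x = ![a, x, c, d] := by
  funext j; fin_cases j <;> rfl

@[simp] theorem update_stk_two (a b c d x : List Γ') :
    Function.update (![a, b, c, d] : Stk) 2 x = ![a, b, x, d] := by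
  funext j; fin_cases j <;> rfl

@[simp] theorem update_stk_three (a b c d x : List Γ') :
    Function.update (![a, b, c, d] : Stk) 3 x = ![a, b, c, x] := by
  funext j; fin_cases j <;> rfl

namespace Frag

variable {E X : Type}

/-- Sequential composition. -/
def seq (F : Frag Unit) (G : Frag X) : Frag X := F.bind fun _ => G

theorem Run.seq {F : Frag Unit} {G : Frag X} {st st₁ st₂ : Stk} {T T' : ℕ} {x : X}
    (h : F.Run st T () st₁) (h' : G.Run st₁ T' x st₂) : (F.seq G).Run st (T + T') x st₂ :=
  Run.bind h h'

theorem run_push_zero (x : Γ') (a b c d : List Γ') :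
    (push 0 x).Run ![a, b, c, d] 1 () ![x :: a, b, c, d] := by
  simpa using run_push 0 x ![a, b, c, d]

theorem run_push_one (x : Γ') (a b c d : List Γ') :
    (push 1 x).Run ![a, b, c, d] 1 () ![a, x :: b, c, d] := by
  simpa using run_push 1 x ![a, b, c, d]

theorem run_push_two (x : Γ') (a b c d : List Γ') :
    (push 2 x).Run ![a, b, c, d] 1 () ![a, b, x :: c, d] := by
  simpa using run_push 2 x ![a, b, c, d]

theorem run_push_three (x : Γ') (a b c d : List Γ') :
    (push 3 x).Run ![a, b, c, d] 1 () ![a, b, c, x :: d] := by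
  simpa using run_push 3 x ![a, b, c, d]

theorem run_pop_zero (x : Γ') (a b c d : List Γ') :
    (pop 0).Run ![x :: a, b, c, d] 1 (some x) ![a, b, c, d] := by
  simpa using run_pop 0 ![x :: a, b, c, d]

theorem run_pop_one (x : Γ') (a b c d : List Γ') :
    (pop 1).Run ![a, x :: b, c, d] 1 (some x) ![a, b, c, d] := by
  simpa using run_pop 1 ![a, x :: b, c, d]

theorem run_pop_three (x : Γ') (a b c d : List Γ') :
    (pop 3).Run ![a, b, c, x :: d] 1 (some x) ![a, b, c, d] := by
  simpa using run_pop 3 ![a, b, c, x :: d]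

/-- One round of moving trees from the stack `0` to the stack `1`; the stack `3` holds a comma for
every tree that is still to be moved. -/
def moveRound : Frag (Unit ⊕ Unit) :=
  (pop 3).bind fun
    | some .comma => (pop 0).bind fun
      | some (.bit true) =>
        (push 1 (.bit true)).seq ((push 3 .comma).seq ((push 3 .comma).seq (pure (.inl ()))))
      | _ => (push 1 (.bit false)).seq (pure (.inl ()))
    | _ => pure (.inr ())

/-- A node spends one comma and earns two, so the commas count the trees still to come, and the
prefix code shows where each of them ends. The hypothesis describes the rest of the run, which lets
the induction chain both subtrees inside one uninterrupted loop. -/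
theorem run_moveRound_loop (x : Dat) {a b c d : List Γ'} {T : ℕ} {st : Stk}
    (h : moveRound.loop.Run ![a, x.enc.reverse ++ b, c, d] T () st) :
    moveRound.loop.Run ![x.enc ++ a, b, c, .comma :: d] (T + 10 * x.enc.length) () st := by
  induction x generalizing a b d T with
  | nil =>
    have h₁ : moveRound.Run ![Dat.nil.enc ++ a, b, c, .comma :: d] (1 + (1 + (1 + 2))) (.inl ())
        ![a, Dat.nil.enc.reverse ++ b, c, d] :=
      (run_pop_three ..).bind <| (run_pop_zero ..).bind <| (run_push_one ..).seq (run_pure ..)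
    exact (h₁.loop_step h).mono (by simp [Dat.enc_nil]; omega)
  | cons x y ihx ihy =>
    rw [Dat.enc_cons] at h ⊢
    have h₁ : moveRound.Run ![.bit true :: (x.enc ++ y.enc) ++ a, b, c, .comma :: d]
        (1 + (1 + (1 + (1 + (1 + 2))))) (.inl ())
        ![x.enc ++ (y.enc ++ a), .bit true :: b, c, .comma :: .comma :: d] := by
      rw [List.cons_append, List.append_assoc]
      exact (run_pop_three ..).bind <| (run_pop_zero ..).bind <| (run_push_one ..).seq <|
        (run_push_three ..).seq <| (run_push_three ..).seq (run_pure ..)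
    have h' : moveRound.loop.Run
        ![a, y.enc.reverse ++ (x.enc.reverse ++ (.bit true :: b)), c, d] T () st := by
      simpa using h
    refine (h₁.loop_step (ihx (ihy h'))).mono ?_
    simp only [List.length_cons, List.length_append]
    omega

/-- Move the topmost tree of the stack `0` to the stack `1`, onto a mark. -/
def stash : Frag Unit :=
  (push 1 .bra).seq ((push 3 .bra).seq ((push 3 .comma).seq moveRound.loop))

theorem run_stash (x : Dat) (a b c d : List Γ') :
    stash.Run ![x.enc ++ a, b, c, d] (10 * x.enc.length + 6) ()
      ![a, x.enc.reverse ++ (.bra :: b), c, d] := by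
  have h : moveRound.Run ![a, x.enc.reverse ++ (.bra :: b), c, .bra :: d] (1 + 2) (.inr ())
      ![a, x.enc.reverse ++ (.bra :: b), c, d] :=
    (run_pop_three ..).bind (run_pure ..)
  exact ((run_push_one ..).seq <| (run_push_three ..).seq <| (run_push_three ..).seq <|
    run_moveRound_loop x h.loop_exit).mono (by omega)

/-- Pop a symbol of the stack `j` and process it, if it is a bit. -/
def unwindRound (j : Fin 4) (act : Γ' → Frag Unit) : Frag (Unit ⊕ Unit) :=
  (pop j).bind fun
    | some (.bit b) => (act (.bit b)).seq (pure (.inl ()))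
    | _ => pure (.inr ())

/-- Pop the symbols of the stack `j` down to a mark and process them. -/
def unwind (j : Fin 4) (act : Γ' → Frag Unit) : Frag Unit := (unwindRound j act).loop

/-- `S u w` stands for the stacks when the bits `u` have been processed, the latest first, and the
bits `w` remain above the mark. -/
theorem run_unwind_aux {j : Fin 4} {act : Γ' → Frag Unit} {c : ℕ}
    (S : List Bool → List Bool → Stk) {t : List Γ'}
    (hpop : ∀ u b w, (S u (b :: w) j).head? = some (.bit b))
    (hact : ∀ u b w, (act (.bit b)).Run (Function.update (S u (b :: w)) j (S u (b :: w) j).tail)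
      c () (S (b :: u) w))
    (hend : ∀ u, S u [] j = .bra :: t) (u w : List Bool) :
    (unwind j act).Run (S u w) ((c + 3) * w.length + 3) ()
      (Function.update (S (w.reverse ++ u) []) j t) := by
  induction w generalizing u with
  | nil =>
    have h := run_pop j (S u [])
    rw [hend] at h
    have h₁ : (unwindRound j act).Run (S u []) (1 + 2) (.inr ()) (Function.update (S u []) j t) :=
      h.bind (run_pure ..)
    exact h₁.loop_exit.mono (by simp)
  | cons b w ih =>
    have h := run_pop j (S u (b :: w))
    rw [hpop] at h
    have h₁ : (unwindRound j act).Run (S u (b :: w)) (1 + (c + 2)) (.inl ()) (S (b :: u) w) :=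
      h.bind ((hact u b w).seq (run_pure _ _))
    rw [List.reverse_cons, List.append_assoc, List.singleton_append]
    refine (h₁.loop_step (ih (b :: u))).mono ?_
    rw [List.length_cons]
    ring_nf
    omega

/-- Both reading directions occur: `stash` leaves a code reversed, and every further transfer
reverses it again. -/
theorem run_unwind {j : Fin 4} {act : Γ' → Frag Unit} {c : ℕ}
    (S : List Γ' → List Γ' → Stk) {t : List Γ'}
    (hpop : ∀ u b w, (S u (.bit b :: w) j).head? = some (.bit b))
    (hact : ∀ u b w, (act (.bit b)).Run
      (Function.update (S u (.bit b :: w)) j (S u (.bit b :: w) j).tail) c () (S (.bit b :: u) w))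
    (hend : ∀ u, S u [] j = .bra :: t) (x : Dat) :
    (unwind j act).Run (S [] x.enc) ((c + 3) * x.enc.length + 3) ()
        (Function.update (S x.enc.reverse []) j t) ∧
      (unwind j act).Run (S [] x.enc.reverse) ((c + 3) * x.enc.length + 3) ()
        (Function.update (S x.enc []) j t) := by
  constructor
  · simpa [Dat.enc] using run_unwind_aux (fun u w => S (u.map .bit) (w.map .bit))
      (fun u b w => hpop _ b _) (fun u b w => hact _ b _) (fun u => hend _) [] x.bits
  · simpa [Dat.enc] using run_unwind_aux (fun u w => S (u.map .bit) (w.map .bit))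
      (fun u b w => hpop _ b _) (fun u b w => hact _ b _) (fun u => hend _) [] x.bits.reverse

/-- Move the topmost tree of the stack `1` back to the stack `0`. -/
def unstash : Frag Unit := unwind 1 (push 0)

theorem run_unstash (x : Dat) (a b c d : List Γ') :
    unstash.Run ![a, x.enc.reverse ++ (.bra :: b), c, d] (4 * x.enc.length + 3) ()
      ![x.enc ++ a, b, c, d] := by
  simpa [unstash] using (run_unwind (j := 1) (act := push 0) (c := 1) (t := b)
    (fun u w => ![u ++ a, w ++ (.bra :: b), c, d])
    (fun u b w => by simp) (fun u b w => by simpa using run_push_zero ..)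
    (fun u => by simp) x).2

/-- Remove the topmost tree of the stack `0`. -/
def drop : Frag Unit := stash.seq (unwind 1 fun _ => pure ())

theorem run_drop (x : Dat) (a b c d : List Γ') :
    drop.Run ![x.enc ++ a, b, c, d] (15 * x.enc.length + 9) () ![a, b, c, d] := by
  have h := (run_unwind (j := 1) (act := fun _ => pure ()) (c := 2) (t := b)
    (fun u w => ![a, w ++ (.bra :: b), c, d])
    (fun u b w => by simp) (fun u b w => by simpa using run_pure ..)
    (fun u => by simp) x).2
  exact ((run_stash x a b c d).seq (by simpa using h)).mono (by omega)

/-- Duplicate the topmost tree of the stack `0`. -/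
def dup : Frag Unit :=
  stash.seq ((push 2 .bra).seq ((unwind 1 fun s => (push 0 s).seq (push 2 s)).seq
    ((push 1 .bra).seq ((unwind 2 (push 1)).seq unstash))))

theorem run_dup (x : Dat) (a b c d : List Γ') :
    dup.Run ![x.enc ++ a, b, c, d] (30 * x.enc.length + 20) ()
      ![x.enc ++ (x.enc ++ a), b, c, d] := by
  have h₁ := (run_unwind (j := 1) (act := fun s => (push 0 s).seq (push 2 s)) (c := 1 + 1) (t := b)
    (fun u w => ![u ++ a, w ++ (.bra :: b), u ++ (.bra :: c), d])
    (fun u b w => by simp)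
    (fun u b w => by simpa using (run_push_zero ..).seq (run_push_two ..))
    (fun u => by simp) x).2
  have h₂ := (run_unwind (j := 2) (act := push 1) (c := 1) (t := c)
    (fun u w => ![x.enc ++ a, u ++ (.bra :: b), w ++ (.bra :: c), d])
    (fun u b w => by simp) (fun u b w => by simpa using run_push_one ..)
    (fun u => by simp) x).1
  exact ((run_stash x a b c d).seq <| (run_push_two ..).seq <|
    Run.seq (st₁ := ![x.enc ++ a, b, x.enc ++ (.bra :: c), d]) (by simpa using h₁) <|
    (run_push_one ..).seq <|
    Run.seq (st₁ := ![x.enc ++ a, x.enc.reverse ++ (.bra :: b), c, d]) (by simpa using h₂) <|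
    run_unstash ..).mono (by omega)

/-- Exchange the two topmost trees of the stack `0`. -/
def swap : Frag Unit :=
  stash.seq (stash.seq ((push 2 .bra).seq ((unwind 1 (push 2)).seq (unstash.seq
    ((push 1 .bra).seq ((unwind 2 (push 1)).seq unstash))))))

theorem run_swap (x y : Dat) (a b c d : List Γ') :
    swap.Run ![x.enc ++ (y.enc ++ a), b, c, d] (30 * x.enc.length + 30 * y.enc.length + 30) ()
      ![y.enc ++ (x.enc ++ a), b, c, d] := by
  have h₁ := (run_unwind (j := 1) (act := push 2) (c := 1) (t := x.enc.reverse ++ (.bra :: b))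
    (fun u w => ![a, w ++ (.bra :: (x.enc.reverse ++ (.bra :: b))), u ++ (.bra :: c), d])
    (fun u b w => by simp)
    (fun u b w => by simpa using run_push_two ..)
    (fun u => by simp) y).2
  have h₂ := (run_unwind (j := 2) (act := push 1) (c := 1) (t := c)
    (fun u w => ![x.enc ++ a, u ++ (.bra :: b), w ++ (.bra :: c), d])
    (fun u b w => by simp) (fun u b w => by simpa using run_push_one ..)
    (fun u => by simp) y).1
  exact ((run_stash x ..).seq <| (run_stash y ..).seq <| (run_push_two ..).seq <|
    Run.seq (st₁ := ![a, x.enc.reverse ++ (.bra :: b), y.enc ++ (.bra :: c), d])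
      (by simpa using h₁) <|
    (run_unstash x ..).seq <| (run_push_one ..).seq <|
    Run.seq (st₁ := ![x.enc ++ a, y.enc.reverse ++ (.bra :: b), c, d]) (by simpa using h₂) <|
    run_unstash ..).mono (by omega)

/-- Push a fixed tree. -/
def pushDat : Dat → Frag Unit
  | .nil => push 0 (.bit false)
  | .cons x y => (pushDat y).seq ((pushDat x).seq (push 0 (.bit true)))

theorem run_pushDat (x : Dat) (a b c d : List Γ') :
    (pushDat x).Run ![a, b, c, d] x.enc.length () ![x.enc ++ a, b, c, d] := by
  induction x generalizing a with
  | nil => exact run_push_zero ..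
  | cons x y ihx ihy =>
    rw [Dat.enc_cons, List.cons_append, List.append_assoc]
    exact ((ihy a).seq <| (ihx _).seq <| run_push_zero ..).mono (by simp; omega)

/-- Replace a pair by its first component. -/
def fst : Frag Unit := (pop 0).bind fun _ => stash.seq (drop.seq unstash)

theorem run_fst (x y : Dat) (a b c d : List Γ') :
    fst.Run ![(Dat.cons x y).enc ++ a, b, c, d] (30 * (Dat.cons x y).enc.length + 30) ()
      ![x.enc ++ a, b, c, d] := by
  rw [Dat.enc_cons, List.cons_append, List.append_assoc]
  exact ((run_pop_zero ..).bind <| (run_stash ..).seq <| (run_drop ..).seq <|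
    run_unstash ..).mono (by simp; omega)

/-- Replace a pair by its second component. -/
def snd : Frag Unit := (pop 0).bind fun _ => drop

theorem run_snd (x y : Dat) (a b c d : List Γ') :
    snd.Run ![(Dat.cons x y).enc ++ a, b, c, d] (30 * (Dat.cons x y).enc.length + 30) ()
      ![y.enc ++ a, b, c, d] := by
  rw [Dat.enc_cons, List.cons_append, List.append_assoc]
  exact ((run_pop_zero ..).bind <| run_drop ..).mono (by simp; omega)

/-- Remove the topmost tree of the stack `0` and branch on whether it is `nil`. -/
def ifNil (F G : Frag Unit) : Frag Unit :=
  (pop 0).bind fun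
    -- The popped bit is the head of a code that has yet to be removed as a whole, so it is put back
    -- first.
    | some (.bit true) => (push 0 (.bit true)).seq (drop.seq G)
    | _ => F

theorem run_ifNil_nil {F G : Frag Unit} {a b c d : List Γ'} {T : ℕ} {st : Stk}
    (h : F.Run ![a, b, c, d] T () st) :
    (ifNil F G).Run ![Dat.nil.enc ++ a, b, c, d] (T + 1) () st :=
  ((run_pop_zero ..).bind h).mono (by omega)

theorem run_ifNil_cons {F G : Frag Unit} {x y : Dat} {a b c d : List Γ'} {T : ℕ} {st : Stk}
    (h : G.Run ![a, b, c, d] T () st) :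
    (ifNil F G).Run ![(Dat.cons x y).enc ++ a, b, c, d]
      (15 * (Dat.cons x y).enc.length + 11 + T) () st := by
  refine Run.mono (T := 1 + (1 + (15 * (Dat.cons x y).enc.length + 9 + T))) ?_ (by omega)
  have h' := (run_drop (Dat.cons x y) a b c d).seq h
  rw [Dat.enc_cons] at h' ⊢
  exact (run_pop_zero ..).bind <| (run_push_zero ..).seq h'

/-- One round of the repetition of `F` on pairs whose first component is a nonempty list. -/
def foldRound (F : Frag Unit) : Frag (Unit ⊕ Unit) :=
  (pop 0).bind fun _ => (pop 0).bind fun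
    | some (.bit true) => (push 0 (.bit true)).seq
        ((push 0 (.bit true)).seq (F.seq (pure (.inl ()))))
    | _ => pure (.inr ())

theorem run_foldRound_nil (F : Frag Unit) (s : Dat) (a b c d : List Γ') :
    (foldRound F).loop.Run ![(Dat.cons .nil s).enc ++ a, b, c, d] 4 () ![s.enc ++ a, b, c, d] := by
  have h : (foldRound F).Run ![(Dat.cons .nil s).enc ++ a, b, c, d] (1 + (1 + 2)) (.inr ())
      ![s.enc ++ a, b, c, d] :=
    (run_pop_zero ..).bind <| (run_pop_zero ..).bind (run_pure ..)
  exact h.loop_exit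

theorem run_foldRound_cons {F : Frag Unit} {x y s : Dat} {a b c d : List Γ'} {T T' : ℕ}
    {st₁ st₂ : Stk} (h : F.Run ![(Dat.cons (.cons x y) s).enc ++ a, b, c, d] T () st₁)
    (h' : (foldRound F).loop.Run st₁ T' () st₂) :
    (foldRound F).loop.Run ![(Dat.cons (.cons x y) s).enc ++ a, b, c, d] (T + T' + 6) () st₂ := by
  have h₁ : (foldRound F).Run ![(Dat.cons (.cons x y) s).enc ++ a, b, c, d]
      (1 + (1 + (1 + (1 + (T + 2))))) (.inl ()) st₁ :=
    (run_pop_zero ..).bind <| (run_pop_zero ..).bind <| (run_push_zero ..).seq <|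
      (run_push_zero ..).seq <| Run.seq h (run_pure ..)
  exact (h₁.loop_step h').mono (by omega)

/-! #### Input and output -/

/-- The tree that represents a symbol. -/
def symDat : Γ' → Dat
  | .blank => .nil
  | .bit false => .cons .nil .nil
  | .bit true => .cons .nil (.cons .nil .nil)
  | .bra => .cons .nil (.cons .nil (.cons .nil .nil))
  | .ket => .cons .nil (.cons .nil (.cons .nil (.cons .nil .nil)))
  | .comma => .cons .nil (.cons .nil (.cons .nil (.cons .nil (.cons .nil .nil))))

/-- The tree that represents a string. -/
def strDat : List Γ' → Dat
  | [] => .nil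
  | s :: l => .cons (symDat s) (strDat l)

theorem length_enc_symDat (s : Γ') : (symDat s).enc.length ≤ 11 := by
  rcases s with _ | (_ | _) | _ | _ | _ <;> simp [symDat, Dat.enc_cons, Dat.enc_nil]

theorem length_enc_strDat (l : List Γ') : (strDat l).enc.length ≤ 12 * l.length + 1 := by
  induction l with
  | nil => simp [strDat, Dat.enc_nil]
  | cons s l ih =>
    have := length_enc_symDat s
    simp only [strDat, Dat.enc_cons, List.length_cons, List.length_append]
    omega

theorem length_le_enc_strDat (l : List Γ') : l.length ≤ (strDat l).enc.length := by
  induction l with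
  | nil => simp
  | cons s l ih =>
    simp only [strDat, Dat.enc_cons, List.length_cons, List.length_append]
    omega

/-- Move a symbol from the stack `0` to the stack `1`. -/
def pourRound : Frag (Unit ⊕ Unit) :=
  (pop 0).bind fun
    | some s => (push 1 s).seq (pure (.inl ()))
    | none => pure (.inr ())

theorem run_pour (a b c d : List Γ') :
    pourRound.loop.Run ![a, b, c, d] (4 * a.length + 3) () ![[], a.reverse ++ b, c, d] := by
  induction a generalizing b with
  | nil =>
    have h : (pop 0).Run ![[], b, c, d] 1 none ![[], b, c, d] := by
      simpa using run_pop 0 ![[], b, c, d]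
    have h₁ : pourRound.Run ![[], b, c, d] (1 + 2) (.inr ()) ![[], b, c, d] :=
      h.bind (run_pure ..)
    exact h₁.loop_exit
  | cons s a ih =>
    have h : pourRound.Run ![s :: a, b, c, d] (1 + (1 + 2)) (.inl ()) ![a, s :: b, c, d] :=
      (run_pop_zero ..).bind ((run_push_one ..).seq (run_pure ..))
    rw [List.reverse_cons, List.append_assoc, List.singleton_append]
    exact (h.loop_step (ih (s :: b))).mono (by simp; omega)

/-- Encode the string on the stack `1`, read backwards, as a tree on the stack `0`. -/
def readRound : Frag (Unit ⊕ Unit) :=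
  (pop 1).bind fun
    | some s => (pushDat (symDat s)).seq ((push 0 (.bit true)).seq (pure (.inl ())))
    | none => pure (.inr ())

theorem run_readRound (l a c d : List Γ') (w : List Γ') :
    readRound.loop.Run ![(strDat w).enc ++ a, l, c, d] (15 * l.length + 3) ()
      ![(strDat (l.reverse ++ w)).enc ++ a, [], c, d] := by
  induction l generalizing w with
  | nil =>
    have h : (pop 1).Run ![(strDat w).enc ++ a, [], c, d] 1 none
        ![(strDat w).enc ++ a, [], c, d] := by
      simpa using run_pop 1 ![(strDat w).enc ++ a, [], c, d]
    have h₁ : readRound.Run ![(strDat w).enc ++ a, [], c, d] (1 + 2) (.inr ())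
        ![(strDat w).enc ++ a, [], c, d] := h.bind (run_pure ..)
    exact h₁.loop_exit
  | cons s l ih =>
    have h₁ : readRound.Run ![(strDat w).enc ++ a, s :: l, c, d]
        (1 + ((symDat s).enc.length + (1 + 2))) (.inl ())
        ![(strDat (s :: w)).enc ++ a, l, c, d] := by
      refine (run_pop_one ..).bind <| (run_pushDat ..).seq <| Run.seq
        (st₁ := ![(strDat (s :: w)).enc ++ a, l, c, d]) ?_ (run_pure ..)
      simpa [strDat, Dat.enc_cons] using run_push_zero ..
    have := length_enc_symDat s
    rw [List.reverse_cons, List.append_assoc, List.singleton_append]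
    exact (h₁.loop_step (ih (s :: w))).mono (by simp; omega)

/-- Encode the string on the stack `0` as a tree. -/
def read : Frag Unit := pourRound.loop.seq ((push 0 (.bit false)).seq readRound.loop)

theorem run_read (l : List Γ') :
    read.Run ![l, [], [], []] (19 * l.length + 7) () ![(strDat l).enc, [], [], []] := by
  have h := run_readRound l.reverse [] [] [] []
  have h₁ := run_pour l [] [] []
  simp only [List.append_nil, List.reverse_reverse] at h h₁
  have h₂ := (run_push_zero (.bit false) [] l.reverse [] []).seq h
  exact (h₁.seq h₂).mono (by simp; omega)

/-- Decode the symbol on the stack `0`, whose index is counted from the head of the given list, and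
push it to the stack `1`. -/
def writeSym : List Γ' → Frag Unit
  | [] => pure ()
  | s :: l => (pop 0).bind fun
    | some (.bit true) => (pop 0).bind fun _ => writeSym l
    | _ => push 1 s

theorem run_writeSym (s : Γ') (a b c d : List Γ') :
    (writeSym [.blank, .bit false, .bit true, .bra, .ket, .comma]).Run
      ![(symDat s).enc ++ a, b, c, d] 12 () ![a, s :: b, c, d] := by
  have h₀ : ∀ s l, (writeSym (s :: l)).Run ![.bit false :: a, b, c, d] (1 + 1) ()
      ![a, s :: b, c, d] := fun s l =>
    (run_pop_zero ..).bind (run_push_one ..)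
  have h₁ : ∀ s l a' T st, (writeSym l).Run ![a', b, c, d] T () st →
      (writeSym (s :: l)).Run ![.bit true :: .bit false :: a', b, c, d] (1 + (1 + T)) () st :=
    fun s l a' T st h => (run_pop_zero ..).bind <| (run_pop_zero ..).bind h
  rcases s with _ | (_ | _) | _ | _ | _
  · exact (h₀ _ _).mono (by omega)
  · exact (h₁ _ _ _ _ _ (h₀ _ _)).mono (by omega)
  · exact (h₁ _ _ _ _ _ (h₁ _ _ _ _ _ (h₀ _ _))).mono (by omega)
  · exact (h₁ _ _ _ _ _ (h₁ _ _ _ _ _ (h₁ _ _ _ _ _ (h₀ _ _)))).mono (by omega)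
  · exact (h₁ _ _ _ _ _ (h₁ _ _ _ _ _ (h₁ _ _ _ _ _ (h₁ _ _ _ _ _ (h₀ _ _))))).mono (by omega)
  · exact (h₁ _ _ _ _ _ (h₁ _ _ _ _ _ (h₁ _ _ _ _ _ (h₁ _ _ _ _ _
      (h₁ _ _ _ _ _ (h₀ _ _)))))).mono (by omega)

/-- Decode the first symbol of the string on the stack `0`. -/
def writeRound : Frag (Unit ⊕ Unit) :=
  (pop 0).bind fun
    | some (.bit true) =>
      (writeSym [.blank, .bit false, .bit true, .bra, .ket, .comma]).seq (pure (.inl ()))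
    | _ => pure (.inr ())

theorem run_writeRound (l b c d : List Γ') :
    writeRound.loop.Run ![(strDat l).enc, b, c, d] (15 * l.length + 3) ()
      ![[], l.reverse ++ b, c, d] := by
  induction l generalizing b with
  | nil =>
    have h : writeRound.Run ![(strDat []).enc, b, c, d] (1 + 2) (.inr ()) ![[], b, c, d] :=
      (run_pop_zero ..).bind (run_pure ..)
    exact h.loop_exit
  | cons s l ih =>
    have h₁ : writeRound.Run ![(strDat (s :: l)).enc, b, c, d] (1 + (12 + 2)) (.inl ())
        ![(strDat l).enc, s :: b, c, d] := by
      rw [strDat, Dat.enc_cons]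
      exact (run_pop_zero ..).bind <| (run_writeSym ..).seq (run_pure ..)
    rw [List.reverse_cons, List.append_assoc, List.singleton_append]
    exact (h₁.loop_step (ih (s :: b))).mono (by simp; omega)

/-- Move a symbol from the stack `1` to the stack `0`. -/
def pourBackRound : Frag (Unit ⊕ Unit) :=
  (pop 1).bind fun
    | some s => (push 0 s).seq (pure (.inl ()))
    | none => pure (.inr ())

theorem run_pourBack (a b c d : List Γ') :
    pourBackRound.loop.Run ![a, b, c, d] (4 * b.length + 3) () ![b.reverse ++ a, [], c, d] := by
  induction b generalizing a with
  | nil =>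
    have h : (pop 1).Run ![a, [], c, d] 1 none ![a, [], c, d] := by
      simpa using run_pop 1 ![a, [], c, d]
    have h₁ : pourBackRound.Run ![a, [], c, d] (1 + 2) (.inr ()) ![a, [], c, d] :=
      h.bind (run_pure ..)
    exact h₁.loop_exit
  | cons s b ih =>
    have h : pourBackRound.Run ![a, s :: b, c, d] (1 + (1 + 2)) (.inl ()) ![s :: a, b, c, d] :=
      (run_pop_one ..).bind ((run_push_zero ..).seq (run_pure ..))
    rw [List.reverse_cons, List.append_assoc, List.singleton_append]
    exact (h.loop_step (ih (s :: a))).mono (by simp; omega)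

/-- Decode the string on the stack `0`. -/
def write : Frag Unit := writeRound.loop.seq pourBackRound.loop

theorem run_write (l : List Γ') :
    write.Run ![(strDat l).enc, [], [], []] (19 * l.length + 6) () ![l, [], [], []] := by
  have h := run_pourBack [] l.reverse [] []
  have h₁ := run_writeRound l [] [] []
  simp only [List.append_nil, List.reverse_reverse, List.length_reverse] at h h₁
  exact (h₁.seq h).mono (by omega)

end Frag

end StackProg

/-! ### Functions computable in polynomial time -/

namespace StackProg

open Computability Turing Frag

/-- Types whose elements are represented by trees. -/
class Coded (α : Type) where
  dat : α → Dat

open Coded (dat)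

/-- The length of the encoding. -/
def size {α : Type} [Coded α] (a : α) : ℕ := (dat a).enc.length

/-- `f` is computed by a flowchart in polynomial time, and its values have polynomial size. -/
@[fun_prop]
def PT {α β : Type} [Coded α] [Coded β] (f : α → β) : Prop :=
  ∃ (F : Frag Unit) (P : Polynomial ℕ), ∀ a, size (f a) ≤ P.eval (size a) ∧
    ∀ r b c d, F.Run ![(dat a).enc ++ r, b, c, d] (P.eval (size a)) ()
      ![(dat (f a)).enc ++ r, b, c, d]

instance : Coded Unit := ⟨fun _ => .nil⟩

instance : Coded Bool := ⟨fun b => cond b (.cons .nil .nil) .nil⟩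

instance : Coded ℕ := ⟨fun n => n.rec .nil fun _ d => .cons .nil d⟩

instance : Coded Γ' := ⟨symDat⟩

instance {α β : Type} [Coded α] [Coded β] : Coded (α × β) := ⟨fun p => .cons (dat p.1) (dat p.2)⟩

instance {α : Type} [Coded α] : Coded (List α) :=
  ⟨fun l => l.rec .nil fun a _ d => .cons (dat a) d⟩

section

variable {α β γ δ : Type} [Coded α] [Coded β] [Coded γ] [Coded δ]

theorem dat_mk (a : α) (b : β) : dat (a, b) = .cons (dat a) (dat b) := rfl
theorem dat_cons (a : α) (l : List α) : dat (a :: l) = .cons (dat a) (dat l) := rfl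

theorem size_mk (a : α) (b : β) : size (a, b) = size a + size b + 1 := by
  simp [size, dat_mk, Dat.enc_cons]

theorem size_pair (p : α × β) : size p = size p.1 + size p.2 + 1 := size_mk ..

theorem size_nil : size ([] : List α) = 1 := rfl

theorem size_cons (a : α) (l : List α) : size (a :: l) = size a + size l + 1 := by
  simp [size, dat_cons, Dat.enc_cons]

theorem size_succ (n : ℕ) : size (n + 1) = size n + 2 := by
  change (Dat.cons .nil (dat n)).enc.length = _
  simp [Dat.enc_cons, Dat.enc_nil, size]

theorem size_nat (n : ℕ) : size n = 2 * n + 1 := by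
  induction n with
  | zero => rfl
  | succ n ih => rw [size_succ, ih]; ring

theorem size_bool (b : Bool) : size b ≤ 3 := by
  cases b <;> simp [size, dat, Dat.enc_cons, Dat.enc_nil]

theorem length_le_size (l : List α) : l.length ≤ size l := by
  induction l with
  | nil => simp
  | cons a l ih => rw [size_cons, List.length_cons]; omega

theorem size_append (l m : List α) : size (l ++ m) + 1 = size l + size m := by
  induction l with
  | nil => rw [List.nil_append, size_nil]; omega
  | cons a l ih => rw [List.cons_append, size_cons, size_cons]; omega

theorem size_suffix_le {l l' : List α} (h : l' <:+ l) : size l' ≤ size l := by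
  obtain ⟨m, rfl⟩ := h
  have := size_append m l'
  have : 1 ≤ size m := by cases m <;> simp [size_nil, size_cons]
  omega

theorem size_prefix_le {l l' : List α} (h : l' <+: l) : size l' ≤ size l := by
  obtain ⟨m, rfl⟩ := h
  have := size_append l' m
  have : 1 ≤ size m := by cases m <;> simp [size_nil, size_cons]
  omega

theorem size_filter_le (p : α → Bool) (l : List α) : size (l.filter p) ≤ size l := by
  induction l with
  | nil => simp
  | cons a l ih =>
    rw [List.filter_cons, size_cons]
    split
    · rw [size_cons]; omega
    · omega

theorem PT.size_le {f : α → β} (hf : PT f) : ∃ P : Polynomial ℕ, ∀ a, size (f a) ≤ P.eval (size a) := by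
  obtain ⟨_, P, h⟩ := hf
  exact ⟨P, fun a => (h a).1⟩

/-- `PT` asks for a single polynomial for time and output size; the sum of two separate bounds
serves for both. -/
theorem PT.of_run {f : α → β} (F : Frag Unit) (P Q : Polynomial ℕ)
    (hQ : ∀ a, size (f a) ≤ Q.eval (size a))
    (hF : ∀ a r b c d, F.Run ![(dat a).enc ++ r, b, c, d] (P.eval (size a)) ()
      ![(dat (f a)).enc ++ r, b, c, d]) : PT f := by
  refine ⟨F, P + Q, fun a => ⟨?_, fun r b c d => (hF a r b c d).mono ?_⟩⟩
  · rw [Polynomial.eval_add]; exact (hQ a).trans (Nat.le_add_left ..)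
  · rw [Polynomial.eval_add]; exact Nat.le_add_right ..

/-- Equal trees leave nothing to compute. The passages between numbers, lists of units and symbols
rest on this. -/
theorem PT.of_dat_eq {f : α → β} (h : ∀ a, dat (f a) = dat a) : PT f := by
  refine PT.of_run (pure ()) 2 .X (fun a => ?_) fun a r b c d => ?_
  · rw [Polynomial.eval_X, size, size, h]
  · rw [h]
    exact (run_pure ..).mono (by simp)

@[fun_prop]
theorem PT.id : PT (fun a : α => a) := PT.of_dat_eq fun _ => rfl

@[fun_prop]
theorem PT.const (b : β) : PT (fun _ : α => b) := by
  refine PT.of_run (drop.seq (pushDat (dat b))) (15 * .X + 9 + .C (size b)) (.C (size b))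
    (fun a => by simp) fun a r b c d => ?_
  refine ((run_drop ..).seq (run_pushDat ..)).mono ?_
  simp [size]

@[fun_prop]
theorem PT.comp {f : β → γ} {g : α → β} (hf : PT f) (hg : PT g) : PT (fun a => f (g a)) := by
  obtain ⟨F, P, hF⟩ := hf
  obtain ⟨G, Q, hG⟩ := hg
  refine PT.of_run (G.seq F) (Q + P.comp Q) (P.comp Q) (fun a => ?_) fun a r b c d => ?_
  · rw [Polynomial.eval_comp]
    exact (hF _).1.trans (polynomial_eval_mono P (hG a).1)
  · refine (((hG a).2 r b c d).seq ((hF (g a)).2 r b c d)).mono ?_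
    rw [Polynomial.eval_add, Polynomial.eval_comp]
    exact Nat.add_le_add_left (polynomial_eval_mono P (hG a).1) _

/-- The common construction of pairs and nonempty lists. -/
theorem PT.of_dat_cons {f : α → β} {g : α → γ} {h : α → δ} (hf : PT f) (hg : PT g)
    (hh : ∀ a, dat (h a) = .cons (dat (f a)) (dat (g a))) : PT h := by
  obtain ⟨F, P, hF⟩ := hf
  obtain ⟨G, Q, hG⟩ := hg
  refine PT.of_run (dup.seq (G.seq (swap.seq (F.seq (push 0 (.bit true))))))
    (30 * .X + 30 * .X + 31 * Q + P + 60) (P + Q + 1) (fun a => ?_) fun a r b c d => ?_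
  · have h₁ := (hF a).1
    have h₂ := (hG a).1
    simp only [size, hh, Dat.enc_cons, List.length_cons, List.length_append, Polynomial.eval_add,
      Polynomial.eval_one] at h₁ h₂ ⊢
    omega
  · have e : (dat (h a)).enc ++ r = .bit true :: ((dat (f a)).enc ++ ((dat (g a)).enc ++ r)) := by
      rw [hh, Dat.enc_cons, List.cons_append, List.append_assoc]
    rw [e]
    refine ((run_dup ..).seq <| ((hG a).2 _ b c d).seq <| (run_swap ..).seq <|
      ((hF a).2 _ b c d).seq (run_push_zero ..)).mono ?_
    have h₂ := (hG a).1
    simp only [size] at h₂ ⊢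
    simp only [Polynomial.eval_add, Polynomial.eval_mul, Polynomial.eval_X, Polynomial.eval_ofNat]
    omega

@[fun_prop]
theorem PT.pair {f : α → β} {g : α → γ} (hf : PT f) (hg : PT g) : PT (fun a => (f a, g a)) :=
  PT.of_dat_cons hf hg fun _ => rfl

@[fun_prop]
theorem PT.cons {f : α → β} {g : α → List β} (hf : PT f) (hg : PT g) :
    PT (fun a => f a :: g a) :=
  PT.of_dat_cons hf hg fun _ => rfl

theorem PT.fst' : PT (Prod.fst : α × β → α) := by
  refine PT.of_run fst (30 * .X + 30) .X (fun p => ?_) fun p r b c d => ?_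
  · rw [size_pair, Polynomial.eval_X]; omega
  · exact (run_fst ..).mono (by simp [size]; rfl)

theorem PT.snd' : PT (Prod.snd : α × β → β) := by
  refine PT.of_run snd (30 * .X + 30) .X (fun p => ?_) fun p r b c d => ?_
  · rw [size_pair, Polynomial.eval_X]; omega
  · exact (run_snd ..).mono (by simp [size]; rfl)

@[fun_prop]
theorem PT.fst {f : α → β × γ} (hf : PT f) : PT (fun a => (f a).1) := PT.fst'.comp hf

@[fun_prop]
theorem PT.snd {f : α → β × γ} (hf : PT f) : PT (fun a => (f a).2) := PT.snd'.comp hf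

/-- Branching on whether a value is represented by the tree `nil`. -/
theorem PT.ifNil {t : α → δ} {f g : α → β} {h : α → β} (ht : PT t) (hf : PT f) (hg : PT g)
    (h₀ : ∀ a, dat (t a) = .nil → h a = f a)
    (h₁ : ∀ a, dat (t a) ≠ .nil → h a = g a) : PT h := by
  obtain ⟨C, R, hC⟩ := ht
  obtain ⟨F, P, hF⟩ := hf
  obtain ⟨G, Q, hG⟩ := hg
  refine PT.of_run (dup.seq (C.seq (Frag.ifNil F G))) (30 * .X + 40 + 16 * R + P + Q) (P + Q)
    (fun a => ?_) fun a r b c d => ?_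
  · rw [Polynomial.eval_add]
    by_cases e : dat (t a) = .nil
    · rw [h₀ a e]; exact (hF a).1.trans (Nat.le_add_right ..)
    · rw [h₁ a e]; exact (hG a).1.trans (Nat.le_add_left ..)
  · refine Run.mono (T := (30 * size a + 20) + (R.eval (size a) +
      (15 * size (t a) + 11 + P.eval (size a) + Q.eval (size a)))) ?_ ?_
    · refine (run_dup ..).seq (((hC a).2 _ b c d).seq ?_)
      rcases e : dat (t a) with _ | ⟨x, y⟩
      · rw [h₀ a e]
        exact (run_ifNil_nil ((hF a).2 r b c d)).mono (by omega)
      · rw [h₁ a (by simp [e])]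
        refine (run_ifNil_cons ((hG a).2 r b c d)).mono ?_
        have : size (t a) = (x.cons y).enc.length := by rw [size, e]
        change _ + Q.eval (size a) ≤ _
        omega
    · have := (hC a).1
      simp only [Polynomial.eval_add, Polynomial.eval_mul, Polynomial.eval_X, Polynomial.eval_ofNat]
      omega

@[fun_prop]
theorem PT.bool_cond {c : α → Bool} {f g : α → β} (hc : PT c) (hf : PT f) (hg : PT g) :
    PT (fun a => cond (c a) (f a) (g a)) := by
  refine PT.ifNil hc hg hf (fun a h => ?_) fun a h => ?_
  · cases e : c a
    · rfl
    · rw [e] at h; cases h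
  · cases e : c a
    · rw [e] at h; exact absurd rfl h
    · rfl

/-- Case distinction on a list. -/
theorem PT.list_cases {l : α → List β} {f : α → γ} {g : α → β → List β → γ} {h : α → γ}
    (hl : PT l) (hf : PT f) (hg : PT fun p : α × β × List β => g p.1 p.2.1 p.2.2)
    (h₀ : ∀ a, l a = [] → h a = f a) (h₁ : ∀ a x t, l a = x :: t → h a = g a x t) : PT h := by
  obtain ⟨N, S, hN⟩ := PT.pair (PT.id (α := α)) hl
  obtain ⟨F, P, hF⟩ := hf
  obtain ⟨G, Q, hG⟩ := hg
  obtain ⟨L, R, hL⟩ := hl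
  refine PT.of_run (dup.seq (L.seq (Frag.ifNil F (N.seq G))))
    (30 * .X + 40 + 16 * R + P + (S + Q.comp S)) (P + Q.comp S)
    (fun a => ?_) fun a r b c d => ?_
  · rw [Polynomial.eval_add, Polynomial.eval_comp]
    rcases e : l a with _ | ⟨x, t⟩
    · rw [h₀ a e]; exact (hF a).1.trans (Nat.le_add_right ..)
    · rw [h₁ a x t e]
      -- A nonempty list has the same tree as the pair of its head and its tail, so the code of `(a,
      -- l a)` already is the code of `(a, x, t)`.
      have e₁ := (hN a).1
      simp only [e] at e₁
      exact ((hG (a, x, t)).1.trans (polynomial_eval_mono Q e₁)).trans (Nat.le_add_left ..)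
  · refine Run.mono (T := (30 * size a + 20) + (R.eval (size a) +
      (15 * size (l a) + 11 + P.eval (size a) + (S + Q.comp S).eval (size a)))) ?_ ?_
    · refine (run_dup ..).seq (((hL a).2 _ b c d).seq ?_)
      rcases e : l a with _ | ⟨x, t⟩
      · rw [h₀ a e]
        exact (run_ifNil_nil ((hF a).2 r b c d)).mono (by omega)
      · rw [h₁ a x t e]
        have e₁ := (hN a).1
        have e₂ := (hN a).2 r b c d
        simp only [e] at e₁ e₂
        refine (run_ifNil_cons (e₂.seq ((hG (a, x, t)).2 r b c d))).mono ?_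
        have := polynomial_eval_mono Q e₁
        rw [Polynomial.eval_add, Polynomial.eval_comp]
        change 15 * size (x :: t) + 11 + _ ≤ _
        have h' : Polynomial.eval (size (a, x, t)) Q = Polynomial.eval (size (a, x :: t)) Q := rfl
        omega
    · have := (hL a).1
      simp only [Polynomial.eval_add, Polynomial.eval_mul, Polynomial.eval_X, Polynomial.eval_ofNat]
      omega

/-- `M` bounds the state after every prefix and the remaining list only shrinks, so one bound on the
argument of `F` is valid in all rounds. -/
theorem run_fold {g : γ → β → γ} {F : Frag Unit} {P : Polynomial ℕ} {M : ℕ}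
    (hF : ∀ (p : (β × List β) × γ) r b c d, F.Run ![(dat p).enc ++ r, b, c, d] (P.eval (size p)) ()
      ![(dat (p.1.2, g p.2 p.1.1)).enc ++ r, b, c, d]) (l : List β) (s : γ)
    (hM : ∀ l', l' <+: l → size (l'.foldl g s) ≤ M) (r b c d : List Γ') :
    (foldRound F).loop.Run ![(dat (l, s)).enc ++ r, b, c, d]
      (l.length * (P.eval (size l + M + 1) + 6) + 4) () ![(dat (l.foldl g s)).enc ++ r, b, c, d] := by
  induction l generalizing s with
  | nil => exact (run_foldRound_nil F (dat s) r b c d).mono (by simp)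
  | cons x l ih =>
    have h := hF ((x, l), s) r b c d
    have hM' : ∀ l', l' <+: l → size (l'.foldl g (g s x)) ≤ M := fun l' hl =>
      hM (x :: l') (List.cons_prefix_cons.2 ⟨rfl, hl⟩)
    refine (run_foldRound_cons h (ih (g s x) hM')).mono ?_
    have h₁ : P.eval (size ((x, l), s)) ≤ P.eval (size (x :: l) + M + 1) := by
      refine polynomial_eval_mono P ?_
      have := hM [] (by simp)
      rw [size_mk, size_mk, size_cons]
      simp only [List.foldl_nil] at this
      omega
    have h₂ : P.eval (size l + M + 1) ≤ P.eval (size (x :: l) + M + 1) := by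
      refine polynomial_eval_mono P ?_
      rw [size_cons]; omega
    rw [List.length_cons, Nat.succ_mul]
    have h₃ := Nat.mul_le_mul_left l.length (Nat.add_le_add_right h₂ 6)
    omega

/-- An iterated polynomial time step may let the state grow exponentially; the bound `B` on all
intermediate states rules this out. -/
theorem PT.foldl_closed {l : α → List β} {s : α → γ} {g : γ → β → γ} (hl : PT l) (hs : PT s)
    (hg : PT fun p : γ × β => g p.1 p.2) (B : Polynomial ℕ)
    (hB : ∀ a l', l' <+: l a → size (l'.foldl g (s a)) ≤ B.eval (size a)) :
    PT (fun a => (l a).foldl g (s a)) := by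
  obtain ⟨N, S, hN⟩ := PT.pair hl hs
  have hu : PT (fun p : (β × List β) × γ => (p.1.2, g p.2 p.1.1)) :=
    PT.pair (by fun_prop) (hg.comp (f := fun p : γ × β => g p.1 p.2)
      (g := fun p : (β × List β) × γ => (p.2, p.1.1)) (by fun_prop))
  obtain ⟨F, P, hF⟩ := hu
  refine PT.of_run (N.seq (foldRound F).loop) (S + (S * (P.comp (S + B + 1) + 6) + 4)) B
    (fun a => hB a _ (List.prefix_refl _)) fun a r b c d => ?_
  refine (((hN a).2 r b c d).seq (run_fold (fun p => (hF p).2) (l a) (s a) (hB a) r b c d)).mono ?_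
  have h₁ : size (l a) ≤ S.eval (size a) := by
    have := (hN a).1
    rw [size_mk] at this
    omega
  simp only [Polynomial.eval_add, Polynomial.eval_mul, Polynomial.eval_comp, Polynomial.eval_ofNat,
    Polynomial.eval_one]
  gcongr
  · exact (length_le_size _).trans h₁
  · exact polynomial_eval_mono P (by omega)

/-- Folds are computable in polynomial time, if the intermediate results have polynomial size. -/
theorem PT.foldl {l : α → List β} {s : α → γ} {g : α → γ → β → γ} (hl : PT l) (hs : PT s)
    (hg : PT fun p : α × γ × β => g p.1 p.2.1 p.2.2) (B : Polynomial ℕ)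
    (hB : ∀ a l', l' <+: l a → size (l'.foldl (g a) (s a)) ≤ B.eval (size a)) :
    PT (fun a => (l a).foldl (g a) (s a)) := by
  -- The step of `PT.foldl_closed` sees only the state and the element, so the parameter `a` travels
  -- in the state.
  have key : ∀ a (l' : List β) (s' : γ), l'.foldl (fun (p : γ × α) x => (g p.2 p.1 x, p.2)) (s', a)
      = (l'.foldl (g a) s', a) := by
    intro a l'
    induction l' with
    | nil => intro s'; rfl
    | cons x l' ih => intro s'; exact ih _
  have h := PT.foldl_closed (l := l) (s := fun a => (s a, a))
    (g := fun (p : γ × α) x => (g p.2 p.1 x, p.2)) hl (by fun_prop)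
    (PT.pair (hg.comp (f := fun p : α × γ × β => g p.1 p.2.1 p.2.2)
      (g := fun p : (γ × α) × β => (p.1.2, p.1.1, p.2)) (by fun_prop)) (by fun_prop)) (B + .X + 1)
    fun a l' hl' => by
      rw [key, size_mk]
      have := hB a l' hl'
      simp only [Polynomial.eval_add, Polynomial.eval_X, Polynomial.eval_one]
      omega
  simp only [key] at h
  exact h.fst

theorem PT.congr {f g : α → β} (hf : PT f) (h : ∀ a, g a = f a) : PT g := by
  rwa [show g = f from funext h]

end

end StackProg

/-! ### A library of polynomial time functions -/

namespace StackProg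

open Computability Turing Frag
open Coded (dat)

/-- Membership in a list. -/
def memb {α : Type} [DecidableEq α] (x : α) (l : List α) : Bool := l.any fun y => decide (y = x)

theorem memb_iff {α : Type} [DecidableEq α] {x : α} {l : List α} : memb x l = true ↔ x ∈ l := by
  simp [memb]

section

variable {α β γ δ : Type} [Coded α] [Coded β] [Coded γ] [Coded δ]

@[fun_prop]
theorem PT.not {f : α → Bool} (hf : PT f) : PT (fun a => !(f a)) :=
  (PT.bool_cond hf (PT.const false) (PT.const true)).congr fun a => by cases f a <;> rfl

@[fun_prop]
theorem PT.and {f g : α → Bool} (hf : PT f) (hg : PT g) : PT (fun a => f a && g a) :=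
  (PT.bool_cond hf hg (PT.const false)).congr fun a => by cases f a <;> rfl

@[fun_prop]
theorem PT.or {f g : α → Bool} (hf : PT f) (hg : PT g) : PT (fun a => f a || g a) :=
  (PT.bool_cond hf (PT.const true) hg).congr fun a => by cases f a <;> rfl

@[fun_prop]
theorem PT.bool_beq {f g : α → Bool} (hf : PT f) (hg : PT g) : PT (fun a => f a == g a) :=
  (PT.bool_cond hf hg (PT.not hg)).congr fun a => by cases f a <;> cases g a <;> rfl

@[fun_prop]
theorem PT.succ {f : α → ℕ} (hf : PT f) : PT (fun a => f a + 1) :=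
  PT.of_dat_cons (PT.const ()) hf fun _ => rfl

/-- Unary numbers are lists of units; through this, recursion on lists also provides recursion on
numbers. -/
theorem dat_replicate (n : ℕ) : dat (List.replicate n ()) = dat n := by
  induction n with
  | zero => rfl
  | succ n ih => rw [List.replicate_succ, dat_cons, ih]; rfl

theorem PT.replicate_unit {f : α → ℕ} (hf : PT f) : PT (fun a => List.replicate (f a) ()) :=
  PT.comp (f := fun n => List.replicate n ()) (PT.of_dat_eq dat_replicate) hf

theorem PT.length_unit : PT (fun l : List Unit => l.length) :=
  PT.of_dat_eq fun l => by
    rw [← dat_replicate]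
    congr 1
    exact (List.eq_replicate_iff.2 ⟨rfl, fun _ _ => rfl⟩).symm

@[fun_prop]
theorem PT.tail {l : α → List β} (hl : PT l) : PT (fun a => (l a).tail) :=
  PT.list_cases hl (PT.const []) (g := fun _ _ t => t) (by fun_prop) (fun a h => by rw [h]; rfl)
    fun a x t h => by rw [h]; rfl

@[fun_prop]
theorem PT.isEmpty {l : α → List β} (hl : PT l) : PT (fun a => (l a).isEmpty) :=
  PT.list_cases hl (PT.const true) (g := fun _ _ _ => false) (by fun_prop)
    (fun a h => by rw [h]; rfl) fun a x t h => by rw [h]; rfl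

@[fun_prop]
theorem PT.reverse {l : α → List β} (hl : PT l) : PT (fun a => (l a).reverse) := by
  have key : ∀ l m : List β, size (l.foldl (fun s x => x :: s) m) + 1 = size l + size m := by
    intro l
    induction l with
    | nil => intro m; rw [List.foldl_nil, size_nil]; omega
    | cons x l ih => intro m; rw [List.foldl_cons, ih, size_cons, size_cons]; omega
  obtain ⟨P, hP⟩ := hl.size_le
  refine (PT.foldl hl (PT.const []) (g := fun _ s x => x :: s) (by fun_prop) P
    fun a l' hl' => ?_).congr fun a => ?_
  · have := key l' []
    rw [size_nil] at this
    have := size_prefix_le hl'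
    have := hP a
    omega
  · have : ∀ l m : List β, l.foldl (fun s x => x :: s) m = l.reverse ++ m := by
      intro l
      induction l with
      | nil => intro m; rfl
      | cons x l ih => intro m; simp [ih]
    rw [this, List.append_nil]

/-- Primitive recursion on lists, if the results have polynomial size. -/
theorem PT.list_rec {l : α → List β} {f : α → List β → γ} {base : α → γ}
    {h : α → β → List β → γ → γ} (hl : PT l) (hbase : PT base)
    (hh : PT fun p : α × β × List β × γ => h p.1 p.2.1 p.2.2.1 p.2.2.2)
    (e₀ : ∀ a, f a [] = base a) (e₁ : ∀ a x t, f a (x :: t) = h a x t (f a t))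
    (B : Polynomial ℕ) (hB : ∀ a l', size (f a l') ≤ B.eval (size a + size l')) :
    PT (fun a => f a (l a)) := by
  obtain ⟨P, hP⟩ := hl.size_le
  -- Recursion from the end is a fold over the reversed list. The state also keeps the suffix
  -- consumed so far, because `h` may use it.
  have key : ∀ a (m : List β), m.reverse.foldl
      (fun (s : List β × γ) x => (x :: s.1, h a x s.1 s.2)) ([], base a) = (m, f a m) := by
    intro a m
    induction m with
    | nil => rw [e₀]; rfl
    | cons x m ih => rw [List.reverse_cons, List.foldl_append, ih, e₁]; rfl
  refine PT.congr (PT.snd (PT.foldl (l := fun a => (l a).reverse) (s := fun a => ([], base a))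
    (g := fun a (s : List β × γ) x => (x :: s.1, h a x s.1 s.2)) (by fun_prop) (by fun_prop)
    (PT.pair (by fun_prop) (hh.comp (f := fun p : α × β × List β × γ => h p.1 p.2.1 p.2.2.1 p.2.2.2)
      (g := fun p : α × (List β × γ) × β => (p.1, p.2.2, p.2.1.1, p.2.1.2)) (by fun_prop)))
    (P + B.comp (.X + P) + 1) fun a l' hl' => ?_)) fun a => ?_
  · have hs : l'.reverse <:+ l a := by
      rw [← List.reverse_prefix, List.reverse_reverse]; exact hl'
    rw [← List.reverse_reverse l', key, size_mk]
    have h₁ := size_suffix_le hs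
    have h₂ := hP a
    have h₃ := hB a l'.reverse
    have h₄ : B.eval (size a + size l'.reverse) ≤ B.eval (size a + P.eval (size a)) :=
      polynomial_eval_mono B (by omega)
    simp only [Polynomial.eval_add, Polynomial.eval_comp, Polynomial.eval_X, Polynomial.eval_one]
    omega
  · rw [key]

/-- Primitive recursion on lists, where every element enlarges the result by a polynomial amount. -/
theorem PT.list_rec_add {l : α → List β} {f : α → List β → γ} {base : α → γ}
    {h : α → β → List β → γ → γ} (hl : PT l) (hbase : PT base)
    (hh : PT fun p : α × β × List β × γ => h p.1 p.2.1 p.2.2.1 p.2.2.2)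
    (e₀ : ∀ a, f a [] = base a) (e₁ : ∀ a x t, f a (x :: t) = h a x t (f a t))
    (Q : Polynomial ℕ)
    (hQ : ∀ a x t, size (f a (x :: t)) ≤ size (f a t) + Q.eval (size a + size x)) :
    PT (fun a => f a (l a)) := by
  obtain ⟨P, hP⟩ := hbase.size_le
  refine PT.list_rec hl hbase hh e₀ e₁ (P + .X * Q) fun a m => ?_
  have key : size (f a m) ≤ P.eval (size a) + m.length * Q.eval (size a + size m) := by
    induction m with
    | nil => rw [e₀]; exact (hP a).trans (Nat.le_add_right ..)
    | cons x m ih =>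
      have h₁ : Q.eval (size a + size m) ≤ Q.eval (size a + size (x :: m)) :=
        polynomial_eval_mono Q (by rw [size_cons]; omega)
      have h₂ : Q.eval (size a + size x) ≤ Q.eval (size a + size (x :: m)) :=
        polynomial_eval_mono Q (by rw [size_cons]; omega)
      have h₃ := hQ a x m
      have h₄ := Nat.mul_le_mul_left m.length h₁
      rw [List.length_cons, Nat.succ_mul]
      omega
  refine key.trans ?_
  have := length_le_size m
  simp only [Polynomial.eval_add, Polynomial.eval_mul, Polynomial.eval_X]
  gcongr
  · exact polynomial_eval_mono P (by omega)
  · omega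

@[fun_prop]
theorem PT.append {l m : α → List β} (hl : PT l) (hm : PT m) : PT (fun a => l a ++ m a) := by
  have h := PT.list_rec_add (l := fun p : List β × List β => p.1)
    (f := fun (p : List β × List β) l => l ++ p.2)
    (base := fun p => p.2) (h := fun _ x _ r => x :: r) (by fun_prop) (by fun_prop) (by fun_prop)
    (fun _ => rfl) (fun _ _ _ => rfl) (.X + 1) fun p x t => by
      simp only [List.cons_append, size_cons, Polynomial.eval_add, Polynomial.eval_X,
        Polynomial.eval_one]
      omega
  exact h.comp (g := fun a => (l a, m a)) (by fun_prop)

@[fun_prop]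
theorem PT.map {l : α → List β} {g : α → β → γ} (hg : PT fun p : α × β => g p.1 p.2) (hl : PT l) :
    PT (fun a => (l a).map (g a)) := by
  obtain ⟨P, hP⟩ := hg.size_le
  refine PT.list_rec_add (f := fun a l => l.map (g a)) (base := fun _ => [])
    (h := fun a x _ r => g a x :: r) hl (by fun_prop)
    (PT.cons (hg.comp (f := fun p : α × β => g p.1 p.2)
      (g := fun p : α × β × List β × List γ => (p.1, p.2.1)) (by fun_prop)) (by fun_prop))
    (fun _ => rfl) (fun _ _ _ => rfl) (P.comp (.X + 1) + 1) fun a x t => ?_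
  have : size (g a x) ≤ P.eval (size a + size x + 1) := by rw [← size_mk]; exact hP (a, x)
  simp only [List.map_cons, size_cons, Polynomial.eval_add, Polynomial.eval_comp,
    Polynomial.eval_X, Polynomial.eval_one]
  omega

@[fun_prop]
theorem PT.flatten {l : α → List (List β)} (hl : PT l) : PT (fun a => (l a).flatten) := by
  refine PT.list_rec_add (f := fun (_ : α) (l : List (List β)) => l.flatten) (base := fun _ => [])
    (h := fun _ x _ r => x ++ r) hl (by fun_prop) (by fun_prop) (fun _ => rfl) (fun _ _ _ => rfl)
    .X fun a x t => ?_
  have := size_append x t.flatten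
  rw [List.flatten_cons, Polynomial.eval_X]
  omega

@[fun_prop]
theorem PT.flatMap {l : α → List β} {g : α → β → List γ} (hg : PT fun p : α × β => g p.1 p.2)
    (hl : PT l) : PT (fun a => (l a).flatMap (g a)) :=
  (PT.flatten (PT.map hg hl)).congr fun _ => List.flatMap_def ..

@[fun_prop]
theorem PT.filter {l : α → List β} {g : α → β → Bool} (hg : PT fun p : α × β => g p.1 p.2)
    (hl : PT l) : PT (fun a => (l a).filter (g a)) := by
  refine (PT.flatMap (g := fun a x => cond (g a x) [x] []) (by fun_prop) hl).congr fun a => ?_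
  induction l a with
  | nil => rfl
  | cons x t ih => rw [List.filter_cons, List.flatMap_cons, ih]; cases g a x <;> rfl

@[fun_prop]
theorem PT.any {l : α → List β} {g : α → β → Bool} (hg : PT fun p : α × β => g p.1 p.2)
    (hl : PT l) : PT (fun a => (l a).any (g a)) := by
  refine (PT.not (PT.isEmpty (PT.filter hg hl))).congr fun a => ?_
  induction l a with
  | nil => rfl
  | cons x t ih => rw [List.filter_cons, List.any_cons, ih]; cases g a x <;> rfl

@[fun_prop]
theorem PT.length {l : α → List β} (hl : PT l) : PT (fun a => (l a).length) :=
  (PT.length_unit.comp (PT.map (g := fun _ _ => ()) (by fun_prop) hl)).congr fun a => by simp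

@[fun_prop]
theorem PT.sub {f g : α → ℕ} (hf : PT f) (hg : PT g) : PT (fun a => f a - g a) := by
  have h := PT.list_rec_add (l := fun p : ℕ × ℕ => List.replicate p.2 ())
    (f := fun p (l : List Unit) => p.1 - l.length) (base := fun p => p.1)
    (h := fun _ _ _ r => (List.replicate r ()).tail.length)
    (PT.replicate_unit (by fun_prop)) (by fun_prop)
    ((PT.tail (PT.replicate_unit (by fun_prop))).length)
    (fun _ => rfl) (fun _ _ _ => by simp; omega) 0 fun p x t => by
      simp only [List.length_cons, size_nat, Polynomial.eval_zero]
      omega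
  exact (h.comp (g := fun a => (f a, g a)) (by fun_prop)).congr fun a => by simp

@[fun_prop]
theorem PT.le {f g : α → ℕ} (hf : PT f) (hg : PT g) : PT (fun a => decide (f a ≤ g a)) :=
  (PT.isEmpty (PT.replicate_unit (PT.sub hf hg))).congr fun a => by
    rw [Bool.eq_iff_iff]
    simp
    omega

@[fun_prop]
theorem PT.lt {f g : α → ℕ} (hf : PT f) (hg : PT g) : PT (fun a => decide (f a < g a)) :=
  (PT.le (PT.succ hf) hg).congr fun _ => rfl

@[fun_prop]
theorem PT.range {f : α → ℕ} (hf : PT f) : PT (fun a => List.range (f a)) := by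
  have h := PT.list_rec (l := fun n : ℕ => List.replicate n ())
    (f := fun (_ : ℕ) (l : List Unit) => List.range l.length) (base := fun _ => [])
    (h := fun _ _ t r => r ++ [t.length]) (PT.replicate_unit (by fun_prop)) (by fun_prop)
    (by fun_prop) (fun _ => rfl) (fun _ _ _ => List.range_succ) (.X * (2 * .X + 2) + 1)
    fun a l => by
      have : ∀ n, size (List.range n) ≤ n * (2 * n + 2) + 1 := by
        intro n
        induction n with
        | zero => rfl
        | succ n ih =>
          have := size_append (List.range n) [n]
          rw [size_cons, size_nil, size_nat] at this
          rw [List.range_succ]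
          nlinarith
      refine (this _).trans ?_
      have := length_le_size l
      simp only [Polynomial.eval_add, Polynomial.eval_mul, Polynomial.eval_X,
        Polynomial.eval_ofNat, Polynomial.eval_one]
      gcongr <;> omega
  exact (h.comp hf).congr fun a => by simp

/-- Types with an equality test in polynomial time. -/
class CodedEq (α : Type) [Coded α] [DecidableEq α] : Prop where
  eq : PT (fun p : α × α => decide (p.1 = p.2))

@[fun_prop]
theorem PT.eq [DecidableEq β] [CodedEq β] {f g : α → β} (hf : PT f) (hg : PT g) :
    PT (fun a => decide (f a = g a)) :=
  CodedEq.eq.comp (PT.pair hf hg)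

instance : CodedEq ℕ :=
  ⟨(PT.and (PT.le PT.fst' PT.snd') (PT.le PT.snd' PT.fst')).congr fun p => by
    rw [Bool.eq_iff_iff]
    simp
    omega⟩

/-- The number that is represented by the same tree as a symbol. -/
def symIndex : Γ' → ℕ
  | .blank => 0
  | .bit false => 1
  | .bit true => 2
  | .bra => 3
  | .ket => 4
  | .comma => 5

@[fun_prop]
theorem PT.symIndex {f : α → Γ'} (hf : PT f) : PT (fun a => symIndex (f a)) :=
  PT.comp (f := StackProg.symIndex)
    (PT.of_dat_eq fun s => by rcases s with _ | (_ | _) | _ | _ | _ <;> rfl) hf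

instance : CodedEq Γ' :=
  ⟨(PT.eq (PT.symIndex PT.fst') (PT.symIndex PT.snd')).congr fun p => by
    rw [Bool.eq_iff_iff]
    obtain ⟨s, t⟩ := p
    rcases s with _ | (_ | _) | _ | _ | _ <;> rcases t with _ | (_ | _) | _ | _ | _ <;>
      simp [StackProg.symIndex]⟩

instance [DecidableEq α] [CodedEq α] [DecidableEq β] [CodedEq β] : CodedEq (α × β) :=
  ⟨PT.congr (f := fun p : (α × β) × (α × β) => decide (p.1.1 = p.2.1) && decide (p.1.2 = p.2.2))
    (by fun_prop) fun p => by
      rw [Bool.eq_iff_iff]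
      simp [Prod.ext_iff]⟩

/-- One round of a comparison in which the first list drives the fold and the second is consumed in
the state. -/
theorem PT.list_beq_step [DecidableEq α] [CodedEq α] :
    PT (fun p : (Bool × List α) × α =>
      (p.2, p.1.2, p.1.1) |> fun q => (q.2.2 && decide (q.2.1.head? = some q.1), q.2.1.tail)) := by
  refine PT.pair (PT.list_cases (l := fun p : (Bool × List α) × α => p.1.2)
    (f := fun _ => false) (g := fun p x _ => p.1.1 && decide (x = p.2)) (by fun_prop) (by fun_prop)
    (by fun_prop) (fun a h => ?_) fun a x t h => ?_) (by fun_prop)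
  · simp [h]
  · simp [h]

instance [DecidableEq α] [CodedEq α] : CodedEq (List α) := by
  -- A second list that is too short fails at `head?`; one that is too long is caught by the final
  -- emptiness test.
  have key : ∀ (l m : List α) (b : Bool),
      (fun s : Bool × List α => s.1 && s.2.isEmpty) (l.foldl (fun s x =>
        (s.1 && decide (s.2.head? = some x), s.2.tail)) (b, m)) = (b && decide (l = m)) := by
    intro l
    induction l with
    | nil => intro m b; cases m <;> simp
    | cons x l ih =>
      intro m b
      refine (ih _ _).trans ?_
      rw [Bool.eq_iff_iff]
      cases m with
      | nil => simp
      | cons y m =>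
        simp only [List.head?_cons, List.tail_cons, Bool.and_eq_true, decide_eq_true_eq,
          Option.some.injEq, List.cons.injEq, eq_comm (a := y), and_assoc]
        exact and_congr_right' (and_congr_right' decide_eq_true_iff)
  have hsize : ∀ (l m : List α) (b : Bool), size (l.foldl (fun (s : Bool × List α) x =>
        (s.1 && decide (s.2.head? = some x), s.2.tail)) (b, m)) ≤ size m + 4 := by
    intro l
    induction l with
    | nil => intro m b; rw [List.foldl_nil, size_mk]; have := size_bool b; omega
    | cons x l ih =>
      intro m b
      refine (ih _ _).trans ?_
      exact Nat.add_le_add_right (size_suffix_le (List.tail_suffix m)) 4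
  have h := PT.foldl (α := List α × List α) (l := fun p => p.1) (s := fun p => (true, p.2))
    (g := fun _ (s : Bool × List α) x => (s.1 && decide (s.2.head? = some x), s.2.tail))
    (by fun_prop) (by fun_prop) (PT.list_beq_step.comp (g := fun
      p : (List α × List α) × (Bool × List α) × α => p.2) (by fun_prop)) (.X + 4)
    fun p l' _ => by
      refine (hsize _ _ _).trans ?_
      rw [size_pair]
      simp only [Polynomial.eval_add, Polynomial.eval_X, Polynomial.eval_ofNat]
      omega
  exact ⟨(PT.and h.fst (PT.isEmpty h.snd)).congr fun p => ((key p.1 p.2 true).trans (by simp)).symm⟩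

@[fun_prop]
theorem polyTime_memb [DecidableEq β] [CodedEq β] {f : α → β} {l : α → List β} (hf : PT f)
    (hl : PT l) : PT (fun a => memb (f a) (l a)) := by
  unfold memb; fun_prop

end

end StackProg

/-! ### The programs of the reductions -/

namespace StackProg

open Computability Turing Frag
open Coded (dat)

section

variable {α β γ : Type} [Coded α] [Coded β] [Coded γ]

@[fun_prop]
theorem polyTime_headD {l : α → List β} {f : α → β} (hl : PT l) (hf : PT f) :
    PT (fun a => (l a).headD (f a)) :=
  PT.list_cases hl hf (g := fun _ x _ => x) (by fun_prop) (fun a h => by rw [h]; rfl)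
    fun a x t h => by rw [h]; rfl

@[fun_prop]
theorem polyTime_drop {l : α → List β} {f : α → ℕ} (hf : PT f) (hl : PT l) :
    PT (fun a => (l a).drop (f a)) := by
  have h := PT.list_rec_add (l := fun p : List β × ℕ => List.replicate p.2 ())
    (f := fun p (l : List Unit) => p.1.drop l.length) (base := fun p => p.1)
    (h := fun _ _ _ r => r.tail) (PT.replicate_unit (by fun_prop)) (by fun_prop) (by fun_prop)
    (fun _ => rfl) (fun _ _ _ => by simp [List.tail_drop]) 0 fun p x t => by
      rw [List.length_cons, ← List.tail_drop]
      exact (size_suffix_le (List.tail_suffix _)).trans (Nat.le_add_right ..)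
  exact (h.comp (g := fun a => (l a, f a)) (by fun_prop)).congr fun a => by simp

/-! ### Splitting of strings, and binary numbers -/

/-- The parts of a string that are closed by the separator `sep`. -/
def chunks (sep : Γ') : List Γ' → List (List Γ')
  | [] => []
  | x :: l => bif decide (x = sep) then [] :: chunks sep l else
      match chunks sep l with
      -- No separator follows, so `x` belongs to an unclosed remainder, which is dropped.
      | [] => []
      | c :: cs => (x :: c) :: cs

@[fun_prop]
theorem polyTime_chunks (sep : Γ') {l : α → List Γ'} (hl : PT l) : PT (fun a => chunks sep (l a)) := by
  refine PT.list_rec_add (f := fun _ l => chunks sep l) (base := fun _ => [])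
    (h := fun _ x _ r => bif decide (x = sep) then [] :: r else
      match r with
      | [] => []
      | c :: cs => (x :: c) :: cs) hl (by fun_prop) ?_
    (fun _ => rfl) (fun _ _ _ => rfl) (.X + 2) fun a x t => ?_
  · refine PT.bool_cond (by fun_prop) (by fun_prop) ?_
    refine PT.list_cases (l := fun p : α × Γ' × List Γ' × List (List Γ') => p.2.2.2)
      (f := fun _ => []) (g := fun p c cs => (p.2.1 :: c) :: cs) (by fun_prop) (by fun_prop)
      (by fun_prop) (fun a h => by rw [h]) fun a x t h => by rw [h]
  · rw [chunks]
    simp only [Polynomial.eval_add, Polynomial.eval_X, Polynomial.eval_ofNat]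
    cases decide (x = sep)
    · rcases chunks sep t with _ | ⟨c, cs⟩
      · simp only [cond_false, size_nil]; omega
      · simp only [cond_false, size_cons]; omega
    · simp only [cond_true, size_cons, size_nil]; omega

/-- The successor of a binary number. -/
def binSucc : List Γ' → List Γ'
  | [] => [.bit true]
  | x :: l => bif decide (x = .bit true) then .bit false :: binSucc l else .bit true :: l

theorem size_binSucc_le (l : List Γ') : size (binSucc l) ≤ size l + 7 := by
  have h₁ : size (Γ'.bit true) = 5 := rfl
  have h₂ : size (Γ'.bit false) = 3 := rfl
  induction l with
  | nil => simp [binSucc, size_cons, size_nil, h₁]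
  | cons x l ih =>
    rw [binSucc]
    by_cases h : x = .bit true
    · simp only [h, decide_true, cond_true, size_cons, h₁, h₂]; omega
    · simp only [h, decide_false, cond_false, size_cons, h₁]; omega

@[fun_prop]
theorem polyTime_binSucc {l : α → List Γ'} (hl : PT l) : PT (fun a => binSucc (l a)) := by
  refine PT.list_rec (f := fun _ l => binSucc l) (base := fun _ => [.bit true])
    (h := fun _ x t r => bif decide (x = .bit true) then .bit false :: r else .bit true :: t)
    hl (by fun_prop) (by fun_prop) (fun _ => rfl) (fun _ _ _ => rfl) (.X + 7) fun a l => ?_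
  have := size_binSucc_le l
  simp only [Polynomial.eval_add, Polynomial.eval_X, Polynomial.eval_ofNat]
  omega

/-- The binary digits of a number. -/
def bin (n : ℕ) : List Γ' := (encodeNat n).map .bit

theorem bin_succ (n : ℕ) : bin (n + 1) = binSucc (bin n) := by
  have key : ∀ p : PosNum, (encodePosNum p.succ).map Γ'.bit
      = binSucc ((encodePosNum p).map .bit) := by
    intro p
    induction p with
    | one => rfl
    | bit0 p ih => rfl
    | bit1 p ih => simp [PosNum.succ, encodePosNum, binSucc, ih]
  unfold bin encodeNat
  rw [Nat.cast_succ, Num.add_one]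
  cases (n : Num) with
  | zero => rfl
  | pos p => exact key p

@[fun_prop]
theorem polyTime_bin {f : α → ℕ} (hf : PT f) : PT (fun a => bin (f a)) := by
  have h := PT.list_rec_add (l := fun n : ℕ => List.replicate n ())
    (f := fun _ (l : List Unit) => bin l.length) (base := fun _ => [])
    (h := fun _ _ _ r => binSucc r) (PT.replicate_unit (by fun_prop)) (by fun_prop)
    (by fun_prop) (fun _ => rfl) (fun _ _ _ => bin_succ _) 7 fun p x t => by
      rw [List.length_cons, bin_succ]
      exact (size_binSucc_le _).trans (by simp)
  exact (h.comp hf).congr fun a => by simp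

/-- The number below `N` with the given binary digits, or `N`. -/
def unbin (N : ℕ) (s : List Γ') : ℕ :=
  ((List.range N).filter fun j => decide (bin j = s)).headD N

-- Only the numbers below a unary `N` are tried, so an arbitrarily large binary number is handled in
-- polynomial time, at the price of being capped at `N`.
@[fun_prop]
theorem polyTime_unbin {f : α → ℕ} {s : α → List Γ'} (hf : PT f) (hs : PT s) :
    PT (fun a => unbin (f a) (s a)) := by
  unfold unbin; fun_prop

/-! ### Link classes, orientation and sorting as programs -/

/-- The pairs of numbers below `n`, in lexicographic order. -/
def pairs (n : ℕ) : List (ℕ × ℕ) :=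
  (List.range n).flatMap fun i => (List.range n).map fun j => (i, j)

@[fun_prop]
theorem polyTime_pairs {f : α → ℕ} (hf : PT f) : PT (fun a => pairs (f a)) := by
  unfold pairs; fun_prop

/-- The adjacency relation of a list of edges. -/
def adjOf (E : List (ℕ × ℕ)) (i j : ℕ) : Bool := memb (i, j) E

@[fun_prop]
theorem polyTime_adjOf {E : α → List (ℕ × ℕ)} {i j : α → ℕ} (hE : PT E) (hi : PT i) (hj : PT j) :
    PT (fun a => adjOf (E a) (i a) (j a)) := by
  unfold adjOf; fun_prop

/-- The pairs `p` and `q` have the same direction in every order that realizes the graph. -/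
def linked (adj : ℕ → ℕ → Bool) (p q : ℕ × ℕ) : Bool :=
  (decide (p.1 = q.1) && (adj p.1 p.2 == adj p.1 q.2) && !(adj p.2 q.2 == adj p.1 p.2)) ||
  (decide (p.2 = q.2) && (adj p.1 p.2 == adj q.1 p.2) && !(adj p.1 q.1 == adj p.1 p.2))

@[fun_prop]
theorem polyTime_linked {E : α → List (ℕ × ℕ)} {p q : α → ℕ × ℕ} (hE : PT E) (hp : PT p) (hq : PT q) :
    PT (fun a => linked (adjOf (E a)) (p a) (q a)) := by
  unfold linked; fun_prop

/-- The pairs that are in `S` or linked to a member of `S`. -/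
def grow (n : ℕ) (adj : ℕ → ℕ → Bool) (S : List (ℕ × ℕ)) : List (ℕ × ℕ) :=
  (pairs n).filter fun p => memb p S || S.any fun q => linked adj q p

@[fun_prop]
theorem polyTime_grow {n : α → ℕ} {E S : α → List (ℕ × ℕ)} (hn : PT n) (hE : PT E) (hS : PT S) :
    PT (fun a => grow (n a) (adjOf (E a)) (S a)) := by
  unfold grow; fun_prop

/-- The pairs that are connected to `p` by links. -/
def linkClass (n : ℕ) (adj : ℕ → ℕ → Bool) (p : ℕ × ℕ) : List (ℕ × ℕ) :=
  (grow n adj)^[(pairs n).length] [p]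

-- From the first round on every iterate is a filtered copy of the fixed list of pairs, so the sizes
-- stay bounded however long the iteration is.
@[fun_prop]
theorem polyTime_linkClass {n : α → ℕ} {E : α → List (ℕ × ℕ)} {p : α → ℕ × ℕ} (hn : PT n) (hE : PT E)
    (hp : PT p) : PT (fun a => linkClass (n a) (adjOf (E a)) (p a)) := by
  obtain ⟨P, hP⟩ := (polyTime_pairs hn).size_le
  obtain ⟨Q, hQ⟩ := hp.size_le
  refine PT.list_rec (l := fun a => pairs (n a))
    (f := fun a l => (grow (n a) (adjOf (E a)))^[l.length] [p a])
    (base := fun a => [p a])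
    (h := fun a _ _ r => grow (n a) (adjOf (E a)) r) (by fun_prop)
    (by fun_prop) (by fun_prop) (fun _ => rfl)
    (fun _ _ _ => by rw [List.length_cons, Function.iterate_succ_apply']) (P + Q + 2)
    fun a l => ?_
  have h₁ : P.eval (size a) ≤ P.eval (size a + size l) := polynomial_eval_mono P (by omega)
  have h₂ : Q.eval (size a) ≤ Q.eval (size a + size l) := polynomial_eval_mono Q (by omega)
  have h₃ := hP a
  have h₄ := hQ a
  simp only [Polynomial.eval_add, Polynomial.eval_ofNat]
  cases l with
  | nil =>
    simp only [List.length_nil, Function.iterate_zero, id_eq, size_cons, size_nil] at h₁ h₂ ⊢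
    omega
  | cons x t =>
    rw [List.length_cons, Function.iterate_succ_apply']
    have : size (grow (n a) (adjOf (E a))
        ((grow (n a) (adjOf (E a)))^[t.length] [p a])) ≤ _ :=
      size_filter_le _ _
    omega

/-- The direction of the pair `(u, v)` in a realizing order: the first pair that is connected to
`(u, v)` or to `(v, u)` is directed forwards. -/
def orient (n : ℕ) (adj : ℕ → ℕ → Bool) (u v : ℕ) : Bool :=
  memb (((pairs n).filter fun p => memb p (linkClass n adj (u, v)) ||
    memb (p.2, p.1) (linkClass n adj (u, v))).headD (0, 0)) (linkClass n adj (u, v))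

@[fun_prop]
theorem polyTime_orient {n u v : α → ℕ} {E : α → List (ℕ × ℕ)} (hn : PT n) (hE : PT E) (hu : PT u)
    (hv : PT v) : PT (fun a => orient (n a) (adjOf (E a)) (u a) (v a)) := by
  unfold orient; fun_prop

/-- The numbers below `n`, sorted by the relation `r`. -/
def sorted (n : ℕ) (r : ℕ → ℕ → Bool) : List ℕ :=
  (List.range n).flatMap fun k => (List.range n).filter fun v =>
    -- The relation may hold on the diagonal; `u = v` is excluded so that the count is the position,
    -- starting from zero.
    decide (((List.range n).filter fun u => r u v && !decide (u = v)).length = k)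

@[fun_prop]
theorem polyTime_sorted {n : α → ℕ} {r : α → ℕ → ℕ → Bool} (hn : PT n)
    (hr : PT fun p : α × ℕ × ℕ => r p.1 p.2.1 p.2.2) : PT (fun a => sorted (n a) (r a)) := by
  have hr' : PT fun p : ((α × ℕ) × ℕ) × ℕ => r p.1.1.1 p.2 p.1.2 :=
    hr.comp (f := fun p : α × ℕ × ℕ => r p.1 p.2.1 p.2.2)
      (g := fun p : ((α × ℕ) × ℕ) × ℕ => (p.1.1.1, p.2, p.1.2)) (by fun_prop)
  unfold sorted
  fun_prop

/-- The edges, each of them once. -/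
def edgeCount (n : ℕ) (adj : ℕ → ℕ → Bool) : ℕ :=
  ((pairs n).filter fun p => decide (p.1 < p.2) && adj p.1 p.2).length

/-! ### Codes, and the two reductions on strings -/

/-- The code of a number. -/
def natStr (n : ℕ) : List Γ' := bin n ++ [.comma]

@[fun_prop]
theorem polyTime_natStr {f : α → ℕ} (hf : PT f) : PT (fun a => natStr (f a)) := by
  unfold natStr; fun_prop

/-- The code of a list of numbers. -/
def listStr (l : List ℕ) : List Γ' := .bra :: (l.flatMap natStr ++ [.ket])

@[fun_prop]
theorem polyTime_listStr {l : α → List ℕ} (hl : PT l) : PT (fun a => listStr (l a)) := by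
  unfold listStr; fun_prop

/-- The edges that are given by the rows of an adjacency matrix. -/
def edgesOfRows (n : ℕ) (rows : List (List Γ')) : List (ℕ × ℕ) :=
  (pairs n).filter fun p => decide (((((rows.drop p.1).headD []).filter fun s =>
    decide (s = .bit true) || decide (s = .bit false)).drop p.2).headD .blank = .bit true)

@[fun_prop]
theorem polyTime_edgesOfRows {n : α → ℕ} {rows : α → List (List Γ')} (hn : PT n) (hr : PT rows) :
    PT (fun a => edgesOfRows (n a) (rows a)) := by
  unfold edgesOfRows; fun_prop

/-- The bound on the distance, for `e` edges and the codes `w`, `t` of the integers `W`, `t`. -/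
def boundStr (e : ℕ) (w t : List Γ') : List Γ' :=
  -- The constant string is the code of `-1`, an unattainable distance; it is used if `W` is
  -- negative or `t` exceeds `e`. A negative `t` demands nothing, and the bound `e` always holds.
  bif decide (w.headD .blank = .bit true) then [.bit true, .bit true, .comma] else
  bif decide (t.headD .blank = .bit true) then .bit false :: natStr e else
  bif decide (unbin (e + 1) t.tail = e + 1) then [.bit true, .bit true, .comma] else
  .bit false :: natStr (e - unbin (e + 1) t.tail)

@[fun_prop]
theorem polyTime_boundStr {e : α → ℕ} {w t : α → List Γ'} (he : PT e) (hw : PT w) (ht : PT t) :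
    PT (fun a => boundStr (e a) (w a) (t a)) := by
  unfold boundStr; fun_prop

/-- The output of the first reduction, from the parts of the input. -/
def cdStr (n : ℕ) (E : List (ℕ × ℕ)) (ws w t : List Γ') : List Γ' :=
  listStr (sorted n (orient n (adjOf E))) ++
    (.bra :: (listStr (sorted n fun u v => !(orient n (adjOf E) u v == adjOf E u v)) ++ [.ket])) ++
    -- Without its sign bit the code of `W` gives the absolute value as budget. For negative `W`
    -- this is harmless, as the bound on the distance is then `-1`.
    (ws ++ [.ket]) ++ (w.tail ++ [.comma]) ++ boundStr (edgeCount n (adjOf E)) w t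

@[fun_prop]
theorem polyTime_cdStr {n : α → ℕ} {E : α → List (ℕ × ℕ)} {ws w t : α → List Γ'} (hn : PT n) (hE : PT E)
    (hws : PT ws) (hw : PT w) (ht : PT t) :
    PT (fun a => cdStr (n a) (E a) (ws a) (w a) (t a)) := by
  unfold cdStr edgeCount; fun_prop

/-- The reduction from partial vertex cover to candidate deletion, on strings. -/
def cdOfWpvc (s : List Γ') : List Γ' :=
  -- The added bracket closes the last segment, which would otherwise be dropped. The weights and
  -- bounds are found from the end, since the number of rows is known only after the weights have
  -- been counted.
  let segs := chunks .ket (s ++ [.ket])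
  let last := chunks .comma (segs.reverse.headD [])
  let ws := segs.reverse.tail.headD []
  let n := (chunks .comma ws).length
  cdStr n (edgesOfRows n segs) ws (last.headD []) (last.tail.headD [])

theorem polyTime_cdOfWpvc : PT cdOfWpvc := by
  unfold cdOfWpvc; fun_prop

/-- Whether `x` is placed before `y` in the list `l`. -/
def beforeIn (l : List ℕ) (x y : ℕ) : Bool :=
  decide ((l.filter fun z => decide (z = x) || decide (z = y)).headD 0 = x)

@[fun_prop]
theorem polyTime_beforeIn {l : α → List ℕ} {x y : α → ℕ} (hl : PT l) (hx : PT x) (hy : PT y) :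
    PT (fun a => beforeIn (l a) (x a) (y a)) := by
  unfold beforeIn; fun_prop

/-- The code of an adjacency matrix. -/
def matrixStr (n : ℕ) (adj : ℕ → ℕ → Bool) : List Γ' :=
  .bra :: ((List.range n).flatMap (fun i => .bra :: ((List.range n).flatMap
    (fun j => [bif adj i j then .bit true else .bit false]) ++ [.ket])) ++ [.ket])

/-- The relation that two lists place `x` and `y` differently. -/
def differ (l l' : List ℕ) (x y : ℕ) : Bool := !(beforeIn l x y == beforeIn l' x y)

@[fun_prop]
theorem polyTime_differ {l l' : α → List ℕ} {x y : α → ℕ} (hl : PT l) (hl' : PT l') (hx : PT x)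
    (hy : PT y) : PT (fun a => differ (l a) (l' a) (x a) (y a)) := by
  unfold differ; fun_prop

/-- The code of the number of edges to be covered, for `e` edges and the code `k` of the bound on
the distance. -/
def coverStr (e : ℕ) (k : List Γ') : List Γ' :=
  bif decide (k.headD .blank = .bit true) then .bit false :: natStr (e + 1)
  else .bit false :: natStr (e - unbin (e + 1) k.tail)

@[fun_prop]
theorem polyTime_coverStr {e : α → ℕ} {k : α → List Γ'} (he : PT e) (hk : PT k) :
    PT (fun a => coverStr (e a) (k a)) := by
  unfold coverStr; fun_prop

/-- The output of the second reduction, from the parts of the input. -/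
def wpvcStr (n : ℕ) (l l' : List ℕ) (cs b k : List Γ') : List Γ' :=
  matrixStr n (differ l l') ++ (cs ++ [.ket]) ++ (.bit false :: (b ++ [.comma])) ++
    coverStr (edgeCount n (differ l l')) k

@[fun_prop]
theorem polyTime_wpvcStr {n : α → ℕ} {l l' : α → List ℕ} {cs b k : α → List Γ'} (hn : PT n) (hl : PT l)
    (hl' : PT l') (hcs : PT cs) (hb : PT b) (hk : PT k) :
    PT (fun a => wpvcStr (n a) (l a) (l' a) (cs a) (b a) (k a)) := by
  unfold wpvcStr matrixStr edgeCount; fun_prop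

/-- The numbers in a segment. -/
def numbers (n : ℕ) (s : List Γ') : List ℕ :=
  (chunks .comma (s.filter fun x => !decide (x = .bra))).map fun c => unbin n c

@[fun_prop]
theorem polyTime_numbers {n : α → ℕ} {s : α → List Γ'} (hn : PT n) (hs : PT s) :
    PT (fun a => numbers (n a) (s a)) := by
  unfold numbers; fun_prop

/-- The reduction from candidate deletion to partial vertex cover, on strings. -/
def wpvcOfCd (s : List Γ') : List Γ' :=
  -- The segments are the target ranking, the input ranking, an empty one between two consecutive
  -- closing brackets, the costs, and finally the budget with `k`.
  let segs := chunks .ket (s ++ [.ket])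
  let last := chunks .comma ((segs.drop 4).headD [])
  let cs := (segs.drop 3).headD []
  let n := (chunks .comma cs).length
  wpvcStr n (numbers n (segs.headD [])) (numbers n (segs.tail.headD [])) cs (last.headD [])
    (last.tail.headD [])

theorem polyTime_wpvcOfCd : PT wpvcOfCd := by
  unfold wpvcOfCd; fun_prop

end

end StackProg

/-! ### Realizing orders of a permutation graph -/

namespace StackProg

section Links

variable {adj : ℕ → ℕ → Bool}

/-- The pairs `p` and `q` are connected by links. -/
def Conn (adj : ℕ → ℕ → Bool) : ℕ × ℕ → ℕ × ℕ → Prop :=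
  Relation.ReflTransGen fun p q => linked adj p q = true

theorem linked_left {a b d : ℕ} (h : adj a b = adj a d) (h' : adj b d ≠ adj a b) :
    Conn adj (a, b) (a, d) :=
  .single (by simp [linked, h, h ▸ h'])

theorem linked_right {a b c : ℕ} (h : adj a b = adj c b) (h' : adj a c ≠ adj a b) :
    Conn adj (a, b) (c, b) :=
  .single (by simp [linked, h, h ▸ h'])

theorem linked_iff {p q : ℕ × ℕ} : linked adj p q = true ↔
    (∃ a b d, p = (a, b) ∧ q = (a, d) ∧ adj a b = adj a d ∧ adj b d ≠ adj a b) ∨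
    (∃ a b c, p = (a, b) ∧ q = (c, b) ∧ adj a b = adj c b ∧ adj a c ≠ adj a b) := by
  obtain ⟨a, b⟩ := p
  obtain ⟨c, d⟩ := q
  constructor
  · intro h
    simp only [linked, Bool.or_eq_true, Bool.and_eq_true, decide_eq_true_eq, beq_iff_eq,
      Bool.not_eq_true', beq_eq_false_iff_ne] at h
    rcases h with ⟨⟨rfl, h₁⟩, h₂⟩ | ⟨⟨rfl, h₁⟩, h₂⟩
    · exact .inl ⟨a, b, d, rfl, rfl, h₁, h₂⟩
    · exact .inr ⟨a, b, c, rfl, rfl, h₁, h₂⟩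
  · rintro (⟨a, b, d, h₁, h₂, h₃, h₄⟩ | ⟨a, b, c, h₁, h₂, h₃, h₄⟩)
    · rw [h₁, h₂]
      simp only [linked, Bool.or_eq_true, Bool.and_eq_true, decide_eq_true_eq, beq_iff_eq,
        Bool.not_eq_true', beq_eq_false_iff_ne]
      exact .inl ⟨⟨trivial, h₃⟩, h₄⟩
    · rw [h₁, h₂]
      simp only [linked, Bool.or_eq_true, Bool.and_eq_true, decide_eq_true_eq, beq_iff_eq,
        Bool.not_eq_true', beq_eq_false_iff_ne]
      exact .inr ⟨⟨trivial, h₃⟩, h₄⟩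

/-! ### Symmetries of links, and the triangle lemma -/

variable (hs : ∀ i j, adj i j = adj j i)
include hs

theorem Conn.symm {p q : ℕ × ℕ} (h : Conn adj p q) : Conn adj q p := by
  induction h with
  | refl => exact .refl
  | tail _ h ih =>
  refine .head ?_ ih
  rw [linked_iff] at h ⊢
  rcases h with ⟨a, b, d, rfl, rfl, h₁, h₂⟩ | ⟨a, b, c, rfl, rfl, h₁, h₂⟩
  · exact .inl ⟨a, d, b, rfl, rfl, h₁.symm, by rwa [hs d b, ← h₁]⟩
  · exact .inr ⟨c, b, a, rfl, rfl, h₁.symm, by rwa [hs c a, ← h₁]⟩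

/-- Reversal exchanges the two kinds of links, those with a common first and those with a common
second entry. -/
theorem Conn.swap {p q : ℕ × ℕ} (h : Conn adj p q) : Conn adj p.swap q.swap := by
  refine Relation.ReflTransGen.lift (p := fun p q => linked adj p q = true) Prod.swap
    (fun p q h => ?_) _ _ h
  change linked adj p.swap q.swap = true
  rw [linked_iff] at h ⊢
  rcases h with ⟨a, b, d, rfl, rfl, h₁, h₂⟩ | ⟨a, b, c, rfl, rfl, h₁, h₂⟩
  · exact .inr ⟨b, a, d, rfl, rfl, by rwa [hs b a, hs d a], by rwa [hs b a]⟩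
  · exact .inl ⟨b, a, c, rfl, rfl, by rwa [hs b a, hs b c], by rwa [hs b a]⟩

/-- The triangle lemma: if the three pairs of a monochromatic triangle lie in different classes,
then the opposite side can be replaced by any pair of its class. -/
theorem Conn.triangle {a b c : ℕ} {k : Bool} (hab : adj a b = k) (hac : adj a c = k)
    (hbc : adj b c = k) (h₁ : ¬Conn adj (b, c) (a, c)) (h₂ : ¬Conn adj (b, c) (b, a)) {p : ℕ × ℕ}
    (h : Conn adj (b, c) p) : Conn adj (a, b) (a, p.1) ∧ Conn adj (a, c) (a, p.2) ∧
      adj a p.1 = k ∧ adj a p.2 = k ∧ adj p.1 p.2 = k := by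
  induction h with
  | refl => exact ⟨.refl, .refl, hab, hac, hbc⟩
  | @tail p q hp hpq ih =>
    rw [linked_iff] at hpq
    obtain ⟨i₁, i₂, i₃, i₄, i₅⟩ := ih
    rcases hpq with ⟨x, y, z, rfl, rfl, e₁, e₂⟩ | ⟨x, y, z, rfl, rfl, e₁, e₂⟩
    · dsimp only at i₁ i₂ i₃ i₄ i₅ ⊢
      have e₃ : adj x z = k := by rw [← e₁, i₅]
      have hq : Conn adj (b, c) (x, z) := hp.trans (linked_left e₁ e₂)
      -- The pair `yz` does not have colour `k`. If `az` has it, then `(a, y)` and `(a, z)` are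
      -- linked and the invariant persists. Otherwise `(x, z)` is linked to `(x, a)`, which brings
      -- `(b, a)` into the class of `(b, c)`.
      by_cases e : adj a z = k
      · exact ⟨i₁, i₂.trans (linked_left (by rw [i₄, e]) (by rw [i₄]; rwa [i₅] at e₂)), i₃, e, e₃⟩
      · have : Conn adj (x, z) (x, a) :=
          linked_left (by rw [e₃, hs x a, i₃]) (by rw [e₃, hs z a]; exact e)
        exact absurd ((hq.trans this).trans ((Conn.swap hs i₁).symm hs)) h₂
    · dsimp only at i₁ i₂ i₃ i₄ i₅ ⊢
      have e₃ : adj z y = k := by rw [← e₁, i₅]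
      have hq : Conn adj (b, c) (z, y) := hp.trans (linked_right e₁ e₂)
      by_cases e : adj a z = k
      · exact ⟨i₁.trans (linked_left (by rw [i₃, e]) (by rw [i₃]; rwa [i₅] at e₂)), i₂, e, i₄, e₃⟩
      · have : Conn adj (z, y) (a, y) :=
          linked_right (by rw [e₃, i₄]) (by rw [e₃, hs z a]; exact e)
        exact absurd ((hq.trans this).trans (i₂.symm hs)) h₁

/-! ### Orientation by lexicographically first representatives -/

omit hs

/-- `p` is the lexicographically first pair that is connected to `(u, v)` or to `(v, u)`. -/
def IsFirst (adj : ℕ → ℕ → Bool) (u v : ℕ) (p : ℕ × ℕ) : Prop :=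
  (Conn adj (u, v) p ∨ Conn adj (u, v) p.swap) ∧
    ∀ q : ℕ × ℕ, Conn adj (u, v) q ∨ Conn adj (u, v) q.swap → toLex p ≤ toLex q

/-- The first pair that is connected to `(u, v)` or to `(v, u)` is connected to `(u, v)`. -/
def Forward (adj : ℕ → ℕ → Bool) (u v : ℕ) : Prop :=
  ∃ p, IsFirst adj u v p ∧ Conn adj (u, v) p

theorem IsFirst.unique {u v : ℕ} {p q : ℕ × ℕ} (hp : IsFirst adj u v p) (hq : IsFirst adj u v q) :
    p = q :=
  toLex.injective (le_antisymm (hp.2 _ hq.1) (hq.2 _ hp.1))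

theorem exists_isFirst (adj : ℕ → ℕ → Bool) (u v : ℕ) : ∃ p, IsFirst adj u v p := by
  obtain ⟨p, hp, hmin⟩ := (wellFounded_lt (α := ℕ ×ₗ ℕ)).has_min
    {p | Conn adj (u, v) (ofLex p) ∨ Conn adj (u, v) (ofLex p).swap} ⟨toLex (u, v), .inl .refl⟩
  exact ⟨ofLex p, hp, fun q hq => not_lt.1 (hmin (toLex q) hq)⟩

include hs

theorem IsFirst.of_conn {u v u' v' : ℕ} (h : Conn adj (u, v) (u', v')) {p : ℕ × ℕ}
    (hp : IsFirst adj u v p) : IsFirst adj u' v' p :=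
  ⟨hp.1.imp ((h.symm hs).trans ·) ((h.symm hs).trans ·),
    fun q hq => hp.2 q (hq.imp (h.trans ·) (h.trans ·))⟩

theorem IsFirst.swap {u v : ℕ} {p : ℕ × ℕ} (hp : IsFirst adj u v p) : IsFirst adj v u p := by
  have key : ∀ q : ℕ × ℕ, ∀ u v, Conn adj (u, v) q.swap → Conn adj (v, u) q :=
    fun q u v h => by simpa using Conn.swap hs h
  have key' : ∀ q : ℕ × ℕ, ∀ u v, Conn adj (u, v) q → Conn adj (v, u) q.swap :=
    fun q u v h => Conn.swap hs h
  exact ⟨hp.1.symm.imp (key _ _ _) (key' _ _ _),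
    fun q hq => hp.2 q (hq.symm.imp (key _ _ _) (key' _ _ _))⟩

theorem Forward.of_conn {u v u' v' : ℕ} (h : Conn adj (u, v) (u', v')) (hf : Forward adj u v) :
    Forward adj u' v' := by
  obtain ⟨p, hp, hc⟩ := hf
  exact ⟨p, hp.of_conn hs h, (h.symm hs).trans hc⟩

theorem Forward.total (u v : ℕ) : Forward adj u v ∨ Forward adj v u := by
  obtain ⟨p, hp⟩ := exists_isFirst adj u v
  rcases hp.1 with h | h
  · exact .inl ⟨p, hp, h⟩
  · exact .inr ⟨p, hp.swap hs, by simpa using Conn.swap hs h⟩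

/-! ### Orientation of a graph that has a realizer -/

omit hs

/-- Both orders place `i` and `j` the same way, unless `i` and `j` are adjacent. -/
def Realizes (p₁ p₂ : ℕ → ℕ) (adj : ℕ → ℕ → Bool) : Prop :=
  ∀ i j, adj i j = true ↔ (p₁ i < p₁ j ∧ p₂ j < p₂ i) ∨ (p₁ j < p₁ i ∧ p₂ i < p₂ j)

variable {p₁ p₂ : ℕ → ℕ}

theorem Realizes.symm (hr : Realizes p₁ p₂ adj) (i j : ℕ) : adj i j = adj j i := by
  rw [Bool.eq_iff_iff, hr, hr]
  exact or_comm

/-- If `x` lay between `y` and `z` in the first order, equal colours of `xy` and `xz` would force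
that colour on `yz` as well. -/
theorem Realizes.linked (hr : Realizes p₁ p₂ adj) (h₁ : p₁.Injective) (h₂ : p₂.Injective)
    {p q : ℕ × ℕ} (h : linked adj p q = true) (hp : p.1 ≠ p.2) :
    q.1 ≠ q.2 ∧ (p₁ p.1 < p₁ p.2 ↔ p₁ q.1 < p₁ q.2) := by
  have key : ∀ x y z, x ≠ y → adj x y = adj x z → adj y z ≠ adj x y →
      x ≠ z ∧ (p₁ x < p₁ y ↔ p₁ x < p₁ z) := by
    intro x y z hxy e₁ e₂
    have hxz : x ≠ z := by
      rintro rfl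
      exact e₂ (hr.symm y x)
    refine ⟨hxz, ?_⟩
    have i₁ := h₁.ne hxy
    have i₂ := h₂.ne hxy
    have i₃ := h₁.ne hxz
    have i₄ := h₂.ne hxz
    have r₁ := hr x y
    have r₂ := hr x z
    have r₃ := hr y z
    rw [← e₁] at r₂
    cases h : adj x y
    · have h' : adj y z = true := by rw [h] at e₂; simpa using e₂
      simp only [h, h', Bool.false_eq_true, false_iff, true_iff] at r₁ r₂ r₃
      omega
    · have h' : adj y z = false := by rw [h] at e₂; simpa using e₂
      simp only [h, h', Bool.false_eq_true, false_iff, true_iff] at r₁ r₂ r₃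
      omega
  rw [linked_iff] at h
  rcases h with ⟨x, y, z, rfl, rfl, e₁, e₂⟩ | ⟨x, y, z, rfl, rfl, e₁, e₂⟩
  · exact key x y z hp e₁ e₂
  · obtain ⟨h, h'⟩ := key y x z hp.symm (by rw [hr.symm y x, hr.symm y z, e₁])
      (by rw [hr.symm y x]; exact e₂)
    have i₁ := h₁.ne h
    have i₂ := h₁.ne hp
    dsimp only at i₂ ⊢
    exact ⟨h.symm, by omega⟩

theorem Realizes.conn (hr : Realizes p₁ p₂ adj) (h₁ : p₁.Injective) (h₂ : p₂.Injective)
    {p q : ℕ × ℕ} (h : Conn adj p q) (hp : p.1 ≠ p.2) :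
    q.1 ≠ q.2 ∧ (p₁ p.1 < p₁ p.2 ↔ p₁ q.1 < p₁ q.2) := by
  induction h with
  | refl => exact ⟨hp, Iff.rfl⟩
  | tail _ h ih =>
    obtain ⟨i₁, i₂⟩ := hr.linked h₁ h₂ h ih.1
    exact ⟨i₁, ih.2.trans i₂⟩

/-- Both orientations refer to the same first pair, so together they would connect `(u, v)` to `(v,
u)`; but a realizer gives all pairs of a class the same direction. -/
theorem Realizes.forward_asymm (hr : Realizes p₁ p₂ adj) (h₁ : p₁.Injective) (h₂ : p₂.Injective)
    {u v : ℕ} (huv : u ≠ v) (h : Forward adj u v) (h' : Forward adj v u) : False := by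
  obtain ⟨p, hp, hc⟩ := h
  obtain ⟨q, hq, hc'⟩ := h'
  obtain rfl := hp.unique (hq.swap hr.symm)
  have := (hr.conn h₁ h₂ (hc.trans (hc'.symm hr.symm)) huv).2
  have := h₁.ne huv
  dsimp only at *
  omega

/-- Being cyclic keeps the sides in the different classes that the triangle lemma requires, so `(b,
c)` can be replaced by its first pair `(x, y)`. Then `(a, x)` is in the class of `(a, b)`, and
minimality makes the first pair `r` of that class start with `x` too. The triangle lemma at the
vertex `y`, with the opposite side `(a, x)` moved to `r`, connects `(y, a)` to `(y, x)`, against the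
direction of `(x, y)`. -/
theorem Realizes.no_cycle_aux (hr : Realizes p₁ p₂ adj) (h₁ : p₁.Injective) (h₂ : p₂.Injective)
    {a b c : ℕ} {k : Bool} (hab : adj a b = k) (hac : adj a c = k) (hbc : adj b c = k)
    (nab : a ≠ b) (nac : a ≠ c) (nbc : b ≠ c) (fab : Forward adj a b) (fbc : Forward adj b c)
    (fca : Forward adj c a) {p r : ℕ × ℕ} (hp : IsFirst adj b c p) (hr' : IsFirst adj a b r)
    (hpr : toLex p ≤ toLex r) : False := by
  have hs := hr.symm
  have asymm := fun {u v} => hr.forward_asymm h₁ h₂ (u := u) (v := v)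
  have cp : Conn adj (b, c) p := by
    obtain ⟨p', hp', h⟩ := fbc
    rwa [hp.unique hp']
  have cr : Conn adj (a, b) r := by
    obtain ⟨r', hr'', h⟩ := fab
    rwa [hr'.unique hr'']
  obtain ⟨x, y⟩ := p
  obtain ⟨z, w⟩ := r
  obtain ⟨t₁, t₂, t₃, t₄, t₅⟩ := Conn.triangle hs hab hac hbc
    (fun h => asymm nac (fbc.of_conn hs h) fca) (fun h => asymm nab fab (fbc.of_conn hs h)) cp
  dsimp only at t₁ t₂ t₃ t₄ t₅
  have nxy : x ≠ y := (hr.conn h₁ h₂ cp nbc).1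
  have nay : a ≠ y := (hr.conn h₁ h₂ t₂ nac).1
  have fxy := fbc.of_conn hs cp
  have fya : Forward adj y a := fca.of_conn hs (Conn.swap hs t₂)
  have l := hr'.2 (x, a) (.inr t₁)
  -- The chain `(x, y) ≤ (z, w) ≤ (x, a)` squeezes the first entries.
  have hz : z = x := by
    rw [Prod.Lex.toLex_le_toLex] at l hpr
    dsimp only at l hpr
    omega
  subst hz
  obtain ⟨u₁, -⟩ := Conn.triangle hs (a := y) (b := a) (c := z) (k := k) (by rw [hs, t₄])
    (by rw [hs, t₅]) t₃
    (fun h => asymm nxy fxy ((fab.of_conn hs t₁).of_conn hs h))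
    (fun h => asymm nay ((fab.of_conn hs t₁).of_conn hs h) fya) ((t₁.symm hs).trans cr)
  exact asymm nxy fxy (fya.of_conn hs u₁)

/-- The first pairs of the three sides cannot strictly increase all the way round the cycle, so some
rotation meets the hypothesis of `no_cycle_aux`. -/
theorem Realizes.no_cycle (hr : Realizes p₁ p₂ adj) (h₁ : p₁.Injective) (h₂ : p₂.Injective)
    {a b c : ℕ} {k : Bool} (hab : adj a b = k) (hac : adj a c = k) (hbc : adj b c = k)
    (nab : a ≠ b) (nac : a ≠ c) (nbc : b ≠ c) (fab : Forward adj a b) (fbc : Forward adj b c)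
    (fca : Forward adj c a) : False := by
  have hs := hr.symm
  obtain ⟨p, hp⟩ := exists_isFirst adj a b
  obtain ⟨q, hq⟩ := exists_isFirst adj b c
  obtain ⟨r, hr'⟩ := exists_isFirst adj c a
  by_cases l₁ : toLex q ≤ toLex p
  · exact hr.no_cycle_aux h₁ h₂ hab hac hbc nab nac nbc fab fbc fca hq hp l₁
  by_cases l₂ : toLex r ≤ toLex q
  · exact hr.no_cycle_aux h₁ h₂ hbc (by rw [hs, hab]) (by rw [hs, hac]) nbc nab.symm nac.symm
      fbc fca fab hr' hq l₂
  · exact hr.no_cycle_aux h₁ h₂ (by rw [hs, hac]) (by rw [hs, hbc]) hab nac.symm nbc.symm nab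
      fca fab fbc hp hr' ((not_le.1 l₁).trans (not_le.1 l₂)).le

/-- A tournament that respects the links and has no monochromatic cyclic triangle is transitive. -/
theorem trans_of_no_cycle (hs : ∀ i j, adj i j = adj j i) {R : ℕ → ℕ → Prop}
    (total : ∀ u v, u ≠ v → R u v ∨ R v u) (asymm : ∀ u v, u ≠ v → R u v → ¬R v u)
    (link : ∀ x y z, adj x y = adj x z → adj y z ≠ adj x y → (R x y ↔ R x z))
    (hR : ∀ a b c, a ≠ b → a ≠ c → b ≠ c → adj a b = adj a c → adj a b = adj b c →
      R a b → R b c → R c a → False) {a b c : ℕ} (nab : a ≠ b) (nac : a ≠ c) (nbc : b ≠ c)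
    (hab : R a b) (hbc : R b c) : R a c := by
  -- A failure is a cyclic triangle. If it has two colours, the two sides of equal colour share a
  -- vertex and are linked, so both leave that vertex or both enter it, which a cycle does not
  -- allow.
  by_contra h
  have hca : R c a := (total a c nac).resolve_left h
  by_cases e₁ : adj a b = adj a c
  · by_cases e₂ : adj a b = adj b c
    · exact hR a b c nab nac nbc e₁ e₂ hab hbc hca
    · exact h ((link a b c e₁ (Ne.symm e₂)).1 hab)
  · by_cases e₂ : adj a b = adj b c
    · refine asymm a b nab hab ((link b a c (by rw [hs b a, e₂]) ?_).2 hbc)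
      rw [hs b a]; exact Ne.symm e₁
    · have e₃ : adj c a = adj c b := by
        rw [hs c a, hs c b]
        cases h₁ : adj a b <;> cases h₂ : adj a c <;> cases h₃ : adj b c <;> simp_all
      refine asymm b c nbc hbc ((link c a b e₃ ?_).1 hca)
      rw [hs c a]; exact e₁

theorem Realizes.forward_link (hr : Realizes p₁ p₂ adj) {x y z : ℕ} (e₁ : adj x y = adj x z)
    (e₂ : adj y z ≠ adj x y) : (Forward adj x y ↔ Forward adj x z) ∧
      (Forward adj y x ↔ Forward adj z x) := by
  have hs := hr.symm
  have h := linked_left e₁ e₂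
  exact ⟨⟨Forward.of_conn hs h, Forward.of_conn hs (h.symm hs)⟩,
    ⟨Forward.of_conn hs (Conn.swap hs h), Forward.of_conn hs (Conn.swap hs (h.symm hs))⟩⟩

theorem Realizes.forward_trans (hr : Realizes p₁ p₂ adj) (h₁ : p₁.Injective) (h₂ : p₂.Injective)
    {a b c : ℕ} (nab : a ≠ b) (nac : a ≠ c) (nbc : b ≠ c) (hab : Forward adj a b)
    (hbc : Forward adj b c) : Forward adj a c :=
  trans_of_no_cycle hr.symm (R := Forward adj) (fun u v _ => Forward.total hr.symm u v)
    (fun _ _ h => hr.forward_asymm h₁ h₂ h) (fun _ _ _ e₁ e₂ => (hr.forward_link e₁ e₂).1)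
    (fun _ _ _ nab nac nbc e₁ e₂ => hr.no_cycle h₁ h₂ rfl e₁.symm e₂.symm nab nac nbc)
    nab nac nbc hab hbc

/-- The second order: adjacent pairs are reversed. -/
def Forward₂ (adj : ℕ → ℕ → Bool) (u v : ℕ) : Prop :=
  if adj u v then Forward adj v u else Forward adj u v

theorem Realizes.forward₂_total (hr : Realizes p₁ p₂ adj) (u v : ℕ) :
    Forward₂ adj u v ∨ Forward₂ adj v u := by
  unfold Forward₂
  rw [hr.symm v u]
  split
  · exact Forward.total hr.symm v u
  · exact Forward.total hr.symm u v

theorem Realizes.forward₂_asymm (hr : Realizes p₁ p₂ adj) (h₁ : p₁.Injective) (h₂ : p₂.Injective)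
    {u v : ℕ} (huv : u ≠ v) (h : Forward₂ adj u v) (h' : Forward₂ adj v u) : False := by
  unfold Forward₂ at h h'
  rw [hr.symm v u] at h'
  split at h
  · rename_i e; rw [if_pos e] at h'; exact hr.forward_asymm h₁ h₂ huv h' h
  · rename_i e; rw [if_neg e] at h'; exact hr.forward_asymm h₁ h₂ huv h h'

/-- Links join pairs of one colour, so they survive the reversal of a colour. A monochromatic cycle
is either kept or reversed as a whole, and `no_cycle` excludes both. -/
theorem Realizes.forward₂_trans (hr : Realizes p₁ p₂ adj) (h₁ : p₁.Injective) (h₂ : p₂.Injective)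
    {a b c : ℕ} (nab : a ≠ b) (nac : a ≠ c) (nbc : b ≠ c) (hab : Forward₂ adj a b)
    (hbc : Forward₂ adj b c) : Forward₂ adj a c := by
  refine trans_of_no_cycle hr.symm (R := Forward₂ adj) (fun u v _ => hr.forward₂_total u v)
    (fun _ _ h => hr.forward₂_asymm h₁ h₂ h) (fun x y z e₁ e₂ => ?_)
    (fun a b c nab nac nbc e₁ e₂ fab fbc fca => ?_) nab nac nbc hab hbc
  · unfold Forward₂
    rw [← e₁]
    split
    · exact (hr.forward_link e₁ e₂).2
    · exact (hr.forward_link e₁ e₂).1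
  · unfold Forward₂ at fab fbc fca
    rw [hr.symm c a, ← e₁] at fca
    rw [← e₂] at fbc
    split at fab
    · rename_i e
      rw [if_pos e] at fbc fca
      exact hr.no_cycle h₁ h₂ (a := a) (b := c) (c := b) rfl e₁ (by rw [hr.symm c b, ← e₁, e₂])
        nac nab nbc.symm fca fbc fab
    · rename_i e
      rw [if_neg e] at fbc fca
      exact hr.no_cycle h₁ h₂ rfl e₁.symm e₂.symm nab nac nbc fab fbc fca

end Links

/-! ### The program computes the orientation -/

section Program

variable {adj : ℕ → ℕ → Bool} {n : ℕ}

theorem mem_pairs {p : ℕ × ℕ} : p ∈ pairs n ↔ p.1 < n ∧ p.2 < n := by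
  obtain ⟨i, j⟩ := p
  simp [pairs]

theorem pairwise_pairs (n : ℕ) : (pairs n).Pairwise fun p q => toLex p < toLex q := by
  rw [pairs, List.pairwise_flatMap]
  constructor
  · intro i _
    rw [List.pairwise_map]
    refine List.pairwise_lt_range.imp fun {j k} h => ?_
    exact Prod.Lex.toLex_lt_toLex.2 (.inr ⟨rfl, h⟩)
  · refine List.pairwise_lt_range.imp fun {i j} h x hx y hy => ?_
    simp only [List.mem_map] at hx hy
    obtain ⟨_, -, rfl⟩ := hx
    obtain ⟨_, -, rfl⟩ := hy
    exact Prod.Lex.toLex_lt_toLex.2 (.inl h)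

theorem nodup_pairs (n : ℕ) : (pairs n).Nodup :=
  (pairwise_pairs n).imp fun h e => by rw [e] at h; exact lt_irrefl _ h

theorem mem_grow {S : List (ℕ × ℕ)} {p : ℕ × ℕ} :
    p ∈ grow n adj S ↔ p ∈ pairs n ∧ (p ∈ S ∨ ∃ q ∈ S, linked adj q p = true) := by
  simp [grow, memb_iff]

/-- A link compares two different colours on pairs that contain the new vertex, so one of these
pairs is an edge, and edges stay below `n`. -/
theorem linked_mem_pairs (hn : ∀ i j, adj i j = true → i < n ∧ j < n) {p q : ℕ × ℕ}
    (h : linked adj p q = true) (hp : p ∈ pairs n) : q ∈ pairs n := by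
  rw [mem_pairs] at hp ⊢
  have key : ∀ x y : Bool, y ≠ x → x = true ∨ y = true := by decide
  rw [linked_iff] at h
  rcases h with ⟨x, y, z, rfl, rfl, e₁, e₂⟩ | ⟨x, y, z, rfl, rfl, e₁, e₂⟩
  · refine ⟨hp.1, ?_⟩
    rcases key _ _ e₂ with h | h
    · exact (hn _ _ (e₁ ▸ h)).2
    · exact (hn _ _ h).2
  · refine ⟨?_, hp.2⟩
    rcases key _ _ e₂ with h | h
    · exact (hn _ _ (e₁ ▸ h)).1
    · exact (hn _ _ h).2

/-- Saturation: as long as an iterate is not closed, a round adds a new pair. All iterates consist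
of pairs below `n`, so as many rounds as there are pairs suffice. -/
theorem mem_linkClass (hn : ∀ i j, adj i j = true → i < n ∧ j < n) {p q : ℕ × ℕ}
    (hp : p ∈ pairs n) : q ∈ linkClass n adj p ↔ Conn adj p q := by
  have hsub : ∀ k, ∀ x ∈ (grow n adj)^[k] [p], x ∈ pairs n := by
    intro k
    cases k with
    | zero => intro x hx; rw [Function.iterate_zero, id_eq, List.mem_singleton] at hx; rwa [hx]
    | succ k =>
      intro x hx
      rw [Function.iterate_succ_apply'] at hx
      exact (mem_grow.1 hx).1
  have hconn : ∀ k, ∀ x ∈ (grow n adj)^[k] [p], Conn adj p x := by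
    intro k
    induction k with
    | zero =>
      intro x hx
      rw [Function.iterate_zero, id_eq, List.mem_singleton] at hx
      rw [hx]; exact .refl
    | succ k ih =>
      intro x hx
      rw [Function.iterate_succ_apply'] at hx
      rcases (mem_grow.1 hx).2 with h | ⟨y, hy, h⟩
      · exact ih x h
      · exact (ih y hy).tail h
  have hself : ∀ k, p ∈ (grow n adj)^[k] [p] := by
    intro k
    induction k with
    | zero => simp
    | succ k ih => rw [Function.iterate_succ_apply']; exact mem_grow.2 ⟨hp, .inl ih⟩
  have hclosed : ∀ k, (∀ x ∈ grow n adj ((grow n adj)^[k] [p]), x ∈ (grow n adj)^[k] [p]) ∨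
      k + 1 ≤ ((grow n adj)^[k] [p]).toFinset.card := by
    intro k
    induction k with
    | zero => right; simp
    | succ k ih =>
      rw [Function.iterate_succ_apply']
      set S := (grow n adj)^[k] [p] with hS
      have hmono : ∀ x ∈ S, x ∈ grow n adj S := fun x hx => mem_grow.2 ⟨hsub k x hx, .inl hx⟩
      by_cases hc : ∀ x ∈ grow n adj S, x ∈ S
      · left
        intro x hx
        obtain ⟨h₁, h₂⟩ := mem_grow.1 hx
        refine mem_grow.2 ⟨h₁, ?_⟩
        rcases h₂ with h | ⟨y, hy, h⟩
        · exact .inl (hc x h)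
        · exact .inr ⟨y, hc y hy, h⟩
      · right
        have hlt : S.toFinset.card < (grow n adj S).toFinset.card := by
          refine Finset.card_lt_card (Finset.ssubset_iff_subset_ne.2 ⟨fun x hx => ?_, fun h => ?_⟩)
          · rw [List.mem_toFinset] at hx ⊢
            exact hmono x hx
          · exact hc fun x hx => by
              rw [← List.mem_toFinset] at hx ⊢
              rwa [h]
        have := ih.resolve_left hc
        omega
  constructor
  · exact hconn _ q
  · intro h
    have hfin : ∀ x ∈ grow n adj (linkClass n adj p), x ∈ linkClass n adj p := by
      rcases hclosed (pairs n).length with h | h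
      · exact h
      · exfalso
        have h₁ : ((grow n adj)^[(pairs n).length] [p]).toFinset.card ≤ (pairs n).toFinset.card :=
          Finset.card_le_card fun x hx => by
            rw [List.mem_toFinset] at hx ⊢
            exact hsub _ x hx
        have h₂ := List.toFinset_card_le (pairs n)
        omega
    have : q ∈ linkClass n adj p ∧ q ∈ pairs n := by
      induction h with
      | refl => exact ⟨hself _, hp⟩
      | tail _ h ih =>
        have hq := linked_mem_pairs hn h ih.2
        exact ⟨hfin _ (mem_grow.2 ⟨hq, .inr ⟨_, ih.1, h⟩⟩), hq⟩
    exact this.1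

theorem conn_mem_pairs (hn : ∀ i j, adj i j = true → i < n ∧ j < n) {p q : ℕ × ℕ}
    (h : Conn adj p q) (hp : p ∈ pairs n) : q ∈ pairs n := by
  induction h with
  | refl => exact hp
  | tail _ h ih => exact linked_mem_pairs hn h ih

/-- Classes do not leave the range and `pairs n` is in lexicographic order, so the first match is
the first representative. The default of `headD` is never met, because `(u, v)` itself matches. -/
theorem orient_iff (hn : ∀ i j, adj i j = true → i < n ∧ j < n) {u v : ℕ} (hu : u < n)
    (hv : v < n) : orient n adj u v = true ↔ Forward adj u v := by
  have huv : (u, v) ∈ pairs n := mem_pairs.2 ⟨hu, hv⟩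
  rw [orient, memb_iff]
  set F := (pairs n).filter fun p => memb p (linkClass n adj (u, v)) ||
    memb (p.2, p.1) (linkClass n adj (u, v)) with hF
  have hmem : ∀ p : ℕ × ℕ, p ∈ F ↔ Conn adj (u, v) p ∨ Conn adj (u, v) p.swap := by
    intro p
    rw [hF, List.mem_filter, Bool.or_eq_true, memb_iff, memb_iff, mem_linkClass hn huv,
      mem_linkClass hn huv]
    refine ⟨fun h => h.2, fun h => ⟨?_, h⟩⟩
    rcases h with h | h
    · exact conn_mem_pairs hn h huv
    · have := conn_mem_pairs hn h huv
      rw [mem_pairs] at this ⊢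
      exact this.symm
  have hsorted : F.Pairwise fun p q => toLex p < toLex q :=
    (pairwise_pairs n).sublist List.filter_sublist
  rcases hc : F with _ | ⟨p, t⟩
  · have := (hmem (u, v)).2 (.inl .refl)
    rw [hc] at this
    cases this
  · have hp : IsFirst adj u v p := by
      refine ⟨(hmem p).1 (by rw [hc]; exact List.mem_cons_self), fun q hq => ?_⟩
      have hq' := (hmem q).2 hq
      rw [hc] at hq' hsorted
      rcases List.mem_cons.1 hq' with rfl | h
      · exact le_rfl
      · exact ((List.pairwise_cons.1 hsorted).1 q h).le
    rw [List.headD_cons, mem_linkClass hn huv]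
    constructor
    · exact fun h => ⟨p, hp, h⟩
    · rintro ⟨q, hq, h⟩
      rwa [hp.unique hq]

end Program

end StackProg

/-! ### Sorting, and inversions of two rankings -/

namespace StackProg

theorem eq_singleton_of_nodup {α : Type} {l : List α} {a : α} (hl : l.Nodup)
    (h : ∀ x, x ∈ l ↔ x = a) : l = [a] := by
  rcases l with _ | ⟨x, _ | ⟨y, t⟩⟩
  · exact absurd ((h a).2 rfl) (by simp)
  · rw [(h x).1 (by simp)]
  · have h₁ := (h x).1 (by simp)
    have h₂ := (h y).1 (by simp)
    rw [h₁, h₂] at hl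
    simp at hl

theorem range_eq_map_finRange (n : ℕ) : List.range n = (List.finRange n).map Fin.val := by
  simp

/-- A list of numbers sorted by a strict total order is a permutation. -/
theorem exists_ranking_sorted (n : ℕ) (r : ℕ → ℕ → Bool)
    (total : ∀ u v, u < n → v < n → u ≠ v → r u v = true ∨ r v u = true)
    (asymm : ∀ u v, u < n → v < n → u ≠ v → r u v = true → r v u = true → False)
    (trans : ∀ a b c, a < n → b < n → c < n → a ≠ b → a ≠ c → b ≠ c → r a b = true →
      r b c = true → r a c = true) :
    ∃ π : Ranking n, sorted n r = (List.ofFn π).map Fin.val ∧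
      ∀ x y : Fin n, x ≠ y → (π.Before x y ↔ r x y = true) := by
  set below : ℕ → List ℕ := fun v => (List.range n).filter fun u => r u v && !decide (u = v)
    with hbelow
  have hmem : ∀ u v, u ∈ below v ↔ u < n ∧ r u v = true ∧ u ≠ v := by
    intro u v
    simp [hbelow]
  have hnodup : ∀ v, (below v).Nodup := fun v => List.nodup_range.filter _
  have hlt : ∀ u v, u < n → v < n → u ≠ v → r u v = true → (below u).length < (below v).length := by
    intro u v hu hv huv h
    have hsub : u :: below u ⊆ below v := by
      intro x hx
      rcases List.mem_cons.1 hx with rfl | hx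
      · exact (hmem _ _).2 ⟨hu, h, huv⟩
      · obtain ⟨h₁, h₂, h₃⟩ := (hmem _ _).1 hx
        have hxv : x ≠ v := by
          rintro rfl
          exact asymm _ _ hu hv huv h h₂
        exact (hmem _ _).2 ⟨h₁, trans x u v h₁ hu hv h₃ hxv huv h₂ h, hxv⟩
    have hnd : (u :: below u).Nodup :=
      List.nodup_cons.2 ⟨fun h => ((hmem _ _).1 h).2.2 rfl, hnodup u⟩
    exact Nat.lt_of_succ_le (List.subperm_of_subset hnd hsub).length_le
  have hlen : ∀ v, v < n → (below v).length < n := by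
    intro v hv
    have hsub : v :: below v ⊆ List.range n := by
      intro x hx
      rcases List.mem_cons.1 hx with rfl | hx
      · exact List.mem_range.2 hv
      · exact List.mem_range.2 ((hmem _ _).1 hx).1
    have hnd : (v :: below v).Nodup :=
      List.nodup_cons.2 ⟨fun h => ((hmem _ _).1 h).2.2 rfl, hnodup v⟩
    have := (List.subperm_of_subset hnd hsub).length_le
    rw [List.length_cons, List.length_range] at this
    omega
  -- The position of an element is the number of its predecessors; the ranking is the inverse of
  -- this bijection.
  let rank : Fin n → Fin n := fun v => ⟨(below v).length, hlen v v.2⟩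
  have hrank : ∀ x y : Fin n, x ≠ y → (rank x < rank y ↔ r x y = true) := by
    intro x y hxy
    have hxy' : (x : ℕ) ≠ y := fun h => hxy (Fin.ext h)
    constructor
    · intro h
      refine (total x y x.2 y.2 hxy').resolve_right fun h' => ?_
      exact lt_asymm h (hlt y x y.2 x.2 hxy'.symm h')
    · exact hlt x y x.2 y.2 hxy'
  have hinj : Function.Injective rank := by
    intro x y h
    by_contra hxy
    have hxy' : (x : ℕ) ≠ y := fun h => hxy (Fin.ext h)
    rcases total x y x.2 y.2 hxy' with h' | h'
    · exact absurd h ((hrank x y hxy).2 h').ne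
    · exact absurd h ((hrank y x (Ne.symm hxy)).2 h').ne'
  let e : Fin n ≃ Fin n := Equiv.ofBijective rank (Finite.injective_iff_bijective.1 hinj)
  refine ⟨e.symm, ?_, hrank⟩
  have hfilter : ∀ k : Fin n, ((List.range n).filter fun v => decide ((below v).length = k))
      = [(e.symm k : ℕ)] := by
    intro k
    refine eq_singleton_of_nodup (List.nodup_range.filter _) fun x => ?_
    simp only [List.mem_filter, List.mem_range, decide_eq_true_eq]
    constructor
    · rintro ⟨hx, h⟩
      have : e ⟨x, hx⟩ = k := Fin.ext h
      rw [← this, Equiv.symm_apply_apply]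
    · rintro rfl
      exact ⟨(e.symm k).2, congrArg Fin.val (e.apply_symm_apply k)⟩
  rw [sorted, List.ofFn_eq_map, List.map_map]
  conv_lhs => arg 2; rw [range_eq_map_finRange]
  rw [List.flatMap_map, List.map_eq_flatMap]
  exact congrArg (fun f => List.flatMap f (List.finRange n)) (funext hfilter)

theorem beforeIn_iff {n : ℕ} (π : Ranking n) {x y : Fin n} (hxy : x ≠ y) :
    beforeIn ((List.ofFn π).map Fin.val) x y = true ↔ π.Before x y := by
  have hF : ((List.ofFn π).map Fin.val).filter
      (fun z => decide (z = (x : ℕ)) || decide (z = (y : ℕ)))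
      = ((List.finRange n).filter fun i => decide (i = π.symm x) || decide (i = π.symm y)).map
        fun i => (π i : ℕ) := by
    rw [List.ofFn_eq_map, List.map_map, List.filter_map]
    congr 1
    refine List.filter_congr fun i _ => ?_
    simp [Fin.val_inj, Equiv.eq_symm_apply]
  have hne : π.symm x ≠ π.symm y := π.symm.injective.ne hxy
  rw [beforeIn, hF, decide_eq_true_eq]
  set F := (List.finRange n).filter fun i => decide (i = π.symm x) || decide (i = π.symm y) with hF'
  have hmem : ∀ i, i ∈ F ↔ i = π.symm x ∨ i = π.symm y := by simp [hF']
  have hsorted : F.Pairwise (· < ·) := (List.pairwise_lt_finRange n).sublist List.filter_sublist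
  rcases hc : F with _ | ⟨a, t⟩
  · have := (hmem (π.symm x)).2 (.inl rfl)
    rw [hc] at this
    cases this
  · rw [hc] at hsorted
    have hlt := (List.pairwise_cons.1 hsorted).1
    have ha := (hmem a).1 (by rw [hc]; exact List.mem_cons_self)
    have hx := (hmem (π.symm x)).2 (.inl rfl)
    have hy := (hmem (π.symm y)).2 (.inr rfl)
    rw [hc] at hx hy
    rw [List.map_cons, List.headD_cons, Fin.val_inj, ← Equiv.eq_symm_apply, Ranking.Before]
    rcases ha with rfl | rfl
    · simp only [true_iff]
      exact hlt _ ((List.mem_cons.1 hy).resolve_left hne.symm)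
    · constructor
      · intro h; exact absurd h.symm hne
      · intro h
        exact absurd (hlt _ ((List.mem_cons.1 hx).resolve_left hne)) (lt_asymm h)

/-- The value on the diagonal is the same for all rankings, which makes `differ` irreflexive. -/
theorem beforeIn_self {n : ℕ} (π : Ranking n) (x : Fin n) :
    beforeIn ((List.ofFn π).map Fin.val) x x = true := by
  rw [beforeIn, decide_eq_true_eq]
  rcases hc : ((List.ofFn π).map Fin.val).filter (fun z => decide (z = (x : ℕ)) || decide (z = x))
    with _ | ⟨a, t⟩
  · have : (x : ℕ) ∈ ((List.ofFn π).map Fin.val).filter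
        (fun z => decide (z = (x : ℕ)) || decide (z = x)) := by
      simp only [List.mem_filter, List.mem_map, List.mem_ofFn]
      exact ⟨⟨x, ⟨π.symm x, by simp⟩, rfl⟩, by simp⟩
    rw [hc] at this
    cases this
  · have : a ∈ ((List.ofFn π).map Fin.val).filter
        (fun z => decide (z = (x : ℕ)) || decide (z = x)) := by rw [hc]; exact List.mem_cons_self
    simpa using (List.mem_filter.1 this).2

end StackProg

/-! ### Disagreement graph and Kendall tau distance -/

/-- The pairs of candidates that are placed differently by two rankings. -/
def disagreementGraph {n : ℕ} (π π' : Ranking n) : SimpleGraph (Fin n) where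
  Adj x y := (π.Before x y ∧ π'.Before y x) ∨ (π.Before y x ∧ π'.Before x y)
  symm := ⟨fun _ _ h => h.symm⟩
  loopless := ⟨fun i h => by rcases h with h | h <;> exact lt_irrefl _ h.1⟩

/-- Naming every candidate by its position in `π` turns `π` into the natural order; the permutation
sends a position in `π` to the position of the same candidate in `π'`. -/
theorem isPermutationGraph_disagreementGraph {n : ℕ} (π π' : Ranking n) :
    IsPermutationGraph (disagreementGraph π π') := by
  refine ⟨n, π.trans π'.symm, ⟨⟨π.symm, fun {a b} => ?_⟩⟩⟩
  simp [inversionGraph, disagreementGraph, Ranking.Before]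

/-- Taking the set of endpoints matches the uncovered edges with the discordant pairs that survive
the deletion of `S`. -/
theorem kendallTauOn_add_covered {n : ℕ} (π π' : Ranking n) (S : Finset (Fin n)) :
    kendallTauOn Sᶜ π π' + {e ∈ (disagreementGraph π π').edgeSet | ∃ v ∈ S, v ∈ e}.ncard
      = (disagreementGraph π π').edgeSet.ncard := by
  classical
  set G := disagreementGraph π π' with hG
  have h₁ : kendallTauOn Sᶜ π π' = (G.edgeSet \ {e ∈ G.edgeSet | ∃ v ∈ S, v ∈ e}).ncard := by
    have hinj : Function.Injective (Sym2.toFinset : Sym2 (Fin n) → Finset (Fin n)) := by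
      intro a b h
      ext x
      rw [← Sym2.mem_toFinset, h, Sym2.mem_toFinset]
    rw [← Set.ncard_image_of_injective _ hinj, kendallTauOn, ← Set.ncard_coe_finset]
    congr 1
    ext p
    simp only [Finset.coe_filter, Finset.mem_powersetCard, Set.mem_ofPred_eq, Set.mem_image,
      Set.mem_sdiff]
    constructor
    · rintro ⟨⟨hp, hcard⟩, x, hx, y, hy, h⟩
      have hxy : x ≠ y := by
        rintro rfl
        exact lt_irrefl _ h.1
      have hpe : p = {x, y} := by
        symm
        apply Finset.eq_of_subset_of_card_le
        · intro z hz
          rcases Finset.mem_insert.1 hz with rfl | hz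
          · exact hx
          · rwa [Finset.mem_singleton.1 hz]
        · rw [hcard, Finset.card_pair hxy]
      refine ⟨s(x, y), ⟨?_, ?_⟩, ?_⟩
      · rw [SimpleGraph.mem_edgeSet]; exact .inl h
      · rintro ⟨-, v, hv, hve⟩
        have hvp : v ∈ p := by
          rw [hpe]
          rcases Sym2.mem_iff.1 hve with rfl | rfl <;> simp
        exact Finset.mem_compl.1 (hp hvp) hv
      · ext z
        rw [hpe, Sym2.mem_toFinset, Sym2.mem_iff]
        simp
    · rintro ⟨e, ⟨he, hS⟩, rfl⟩
      induction e with
      | h x y =>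
      rw [SimpleGraph.mem_edgeSet] at he
      have hxy : x ≠ y := he.ne
      have hset : (s(x, y)).toFinset = {x, y} := by
        ext z
        rw [Sym2.mem_toFinset, Sym2.mem_iff]
        simp
      refine ⟨⟨fun z hz => ?_, ?_⟩, ?_⟩
      · rw [Sym2.mem_toFinset] at hz
        rw [Finset.mem_compl]
        exact fun hzS => hS ⟨he, z, hzS, hz⟩
      · rw [hset, Finset.card_pair hxy]
      · rw [hset]
        rcases he with h | h
        · exact ⟨x, by simp, y, by simp, h⟩
        · exact ⟨y, by simp, x, by simp, h⟩
  rw [h₁]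
  exact Set.ncard_sdiff_add_ncard_of_subset (fun e he => he.1)

namespace StackProg

theorem edgeCount_eq {n : ℕ} (G : SimpleGraph (Fin n)) (adj : ℕ → ℕ → Bool)
    (h : ∀ x y : Fin n, adj x y = true ↔ G.Adj x y) : edgeCount n adj = G.edgeSet.ncard := by
  classical
  set A : Set (Fin n × Fin n) := {p | p.1 < p.2 ∧ G.Adj p.1 p.2} with hA
  have h₁ : G.edgeSet = (fun p : Fin n × Fin n => s(p.1, p.2)) '' A := by
    ext e
    induction e with
    | h x y =>
    rw [SimpleGraph.mem_edgeSet]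
    constructor
    · intro hxy
      rcases lt_or_gt_of_ne hxy.ne with hlt | hlt
      · exact ⟨(x, y), ⟨hlt, hxy⟩, rfl⟩
      · exact ⟨(y, x), ⟨hlt, hxy.symm⟩, Sym2.eq_swap⟩
    · rintro ⟨⟨a, b⟩, ⟨-, hab⟩, he⟩
      rw [← SimpleGraph.mem_edgeSet, ← he]
      exact hab
  have h₂ : Set.InjOn (fun p : Fin n × Fin n => s(p.1, p.2)) A := by
    rintro ⟨a, b⟩ ⟨hab, -⟩ ⟨c, d⟩ ⟨hcd, -⟩ he
    dsimp only at hab hcd he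
    rcases Sym2.eq_iff.1 he with ⟨rfl, rfl⟩ | ⟨rfl, rfl⟩
    · rfl
    · exact absurd hab (lt_asymm hcd)
  have h₃ : (((pairs n).filter fun p => decide (p.1 < p.2) && adj p.1 p.2).toFinset :
      Set (ℕ × ℕ)) = (fun p : Fin n × Fin n => ((p.1 : ℕ), (p.2 : ℕ))) '' A := by
    ext ⟨i, j⟩
    simp only [List.coe_toFinset, List.mem_filter, mem_pairs, Bool.and_eq_true, decide_eq_true_eq,
      Set.mem_ofPred_eq, Set.mem_image, hA]
    constructor
    · rintro ⟨⟨hi, hj⟩, hlt, hadj⟩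
      exact ⟨(⟨i, hi⟩, ⟨j, hj⟩), ⟨hlt, (h ⟨i, hi⟩ ⟨j, hj⟩).1 hadj⟩, rfl⟩
    · rintro ⟨⟨a, b⟩, ⟨hlt, hab⟩, he⟩
      cases he
      exact ⟨⟨a.2, b.2⟩, hlt, (h a b).2 hab⟩
  have h₄ : Function.Injective (fun p : Fin n × Fin n => ((p.1 : ℕ), (p.2 : ℕ))) := by
    rintro ⟨a, b⟩ ⟨c, d⟩ he
    simp only [Prod.mk.injEq, Fin.val_inj] at he
    exact Prod.ext he.1 he.2
  rw [h₁, h₂.ncard_image, ← Set.ncard_image_of_injective A h₄, ← h₃,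
    Set.ncard_coe_finset, List.toFinset_card_of_nodup ((nodup_pairs n).filter _)]
  rfl

/-! ### Parsing -/

open Computability Turing

theorem chunks_append {sep : Γ'} {a : List Γ'} (h : sep ∉ a) (b : List Γ') :
    chunks sep (a ++ sep :: b) = a :: chunks sep b := by
  induction a with
  | nil => simp [chunks]
  | cons x a ih =>
    rw [List.mem_cons, not_or] at h
    rw [List.cons_append, chunks, ih h.2]
    simp [Ne.symm h.1]

theorem length_chunks_cons {sep x : Γ'} (h : x ≠ sep) (l : List Γ') :
    (chunks sep (x :: l)).length = (chunks sep l).length := by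
  rw [chunks]
  simp only [h, decide_false, cond_false]
  cases chunks sep l <;> rfl

theorem eq_bit_of_mem_bin {n : ℕ} {s : Γ'} (h : s ∈ bin n) : ∃ b, s = .bit b := by
  obtain ⟨b, -, rfl⟩ := List.mem_map.1 h
  exact ⟨b, rfl⟩

theorem notMem_bin {n : ℕ} {s : Γ'} (h : ∀ b, s ≠ .bit b) : s ∉ bin n := fun hs => by
  obtain ⟨b, hb⟩ := eq_bit_of_mem_bin hs
  exact h b hb

theorem notMem_natStr {n : ℕ} {s : Γ'} (h : ∀ b, s ≠ .bit b) (h' : s ≠ .comma) :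
    s ∉ natStr n := by
  rw [natStr, List.mem_append, List.mem_singleton, not_or]
  exact ⟨notMem_bin h, h'⟩

theorem notMem_flatMap_natStr {l : List ℕ} {s : Γ'} (h : ∀ b, s ≠ .bit b) (h' : s ≠ .comma) :
    s ∉ l.flatMap natStr := by
  rw [List.mem_flatMap]
  rintro ⟨n, -, hn⟩
  exact notMem_natStr h h' hn

theorem chunks_flatMap_natStr (l : List ℕ) : chunks .comma (l.flatMap natStr) = l.map bin := by
  induction l with
  | nil => rfl
  | cons n l ih =>
    rw [List.flatMap_cons, natStr, List.append_assoc, List.singleton_append,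
      chunks_append (notMem_bin (by simp)), ih, List.map_cons]

theorem bin_injective : Function.Injective bin := by
  intro m n h
  have h' : encodeNat m = encodeNat n := List.map_injective_iff.2 (fun _ _ h => by cases h; rfl) h
  rw [← decode_encodeNat m, h', decode_encodeNat]

/-- Digits determine the number, so at most one candidate matches; from `N` on there is none and the
default `N` appears. -/
theorem unbin_bin (N j : ℕ) : unbin N (bin j) = min j N := by
  have h : ∀ i, decide (bin i = bin j) = decide (i = j) := fun i => by
    rw [decide_eq_decide]; exact bin_injective.eq_iff
  simp only [unbin, h]
  rcases lt_or_ge j N with hj | hj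
  · rw [eq_singleton_of_nodup (a := j) (List.nodup_range.filter _)
      fun x => by simp only [List.mem_filter, List.mem_range, decide_eq_true_eq]; omega]
    rw [List.headD_cons]; omega
  · have : (List.range N).filter (fun i => decide (i = j)) = [] := by
      rw [List.filter_eq_nil_iff]
      intro x hx
      rw [List.mem_range] at hx
      simp only [decide_eq_true_eq]
      omega
    rw [this, List.headD_nil]; omega

theorem numbers_eq (n : ℕ) (pre : List Γ') (hpre : ∀ s ∈ pre, s = .bra) (l : List ℕ)
    (hl : ∀ i ∈ l, i < n) : numbers n (pre ++ l.flatMap natStr) = l := by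
  have h₁ : pre.filter (fun x => !decide (x = .bra)) = [] := by
    rw [List.filter_eq_nil_iff]
    intro s hs
    simp [hpre s hs]
  have h₂ : (l.flatMap natStr).filter (fun x => !decide (x = .bra)) = l.flatMap natStr := by
    rw [List.filter_eq_self]
    intro s hs
    have : s ≠ .bra := fun h => notMem_flatMap_natStr (l := l) (s := .bra) (by simp) (by simp) (h ▸ hs)
    simp [this]
  rw [numbers, List.filter_append, h₁, h₂, List.nil_append, chunks_flatMap_natStr, List.map_map]
  refine (List.map_congr_left fun i hi => ?_).trans (List.map_id l)
  have := hl i hi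
  simp only [Function.comp_apply, unbin_bin, id_eq]
  omega

theorem int_eq (z : ℤ) : InstEnc.int z = .bit (decide (z < 0)) :: natStr z.natAbs := rfl

theorem notMem_int {z : ℤ} {s : Γ'} (h : ∀ b, s ≠ .bit b) (h' : s ≠ .comma) :
    s ∉ InstEnc.int z := by
  rw [int_eq, List.mem_cons, not_or]
  exact ⟨h _, notMem_natStr h h'⟩

theorem chunks_int_append (z : ℤ) (l : List Γ') : chunks .comma (InstEnc.int z ++ l)
    = (.bit (decide (z < 0)) :: bin z.natAbs) :: chunks .comma l := by
  have : InstEnc.int z ++ l = (.bit (decide (z < 0)) :: bin z.natAbs) ++ .comma :: l := by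
    simp [int_eq, natStr]
  rw [this, chunks_append]
  rw [List.mem_cons, not_or]
  exact ⟨by simp, notMem_bin (by simp)⟩

end StackProg

/-! ### Correctness of the reductions -/

namespace StackProg

open Computability Turing

theorem flatMap_congr_finRange {n : ℕ} {α : Type} {f : ℕ → List α} {g : Fin n → List α}
    (h : ∀ i : Fin n, f i = g i) : (List.range n).flatMap f = (List.ofFn id).flatMap g := by
  rw [range_eq_map_finRange, List.flatMap_map, List.ofFn_id]
  exact congrArg (fun f => List.flatMap f (List.finRange n)) (funext h)

theorem ranking_eq {n : ℕ} (π : Ranking n) :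
    InstEnc.ranking π = listStr ((List.ofFn π).map Fin.val) := by
  rw [listStr, List.flatMap_map]; rfl

theorem family_nat_eq {n : ℕ} (f : Fin n → ℕ) :
    InstEnc.family InstEnc.nat f = listStr (List.ofFn f) := rfl

theorem cd_eq (m : ℕ) (ρ X : Ranking m) (cost : Fin m → ℕ) (bgt : ℕ) (k : ℤ) :
    InstEnc.cd ⟨m, [ρ], X, cost, bgt, k⟩ = listStr ((List.ofFn X).map Fin.val) ++
      (.bra :: (listStr ((List.ofFn ρ).map Fin.val) ++ [.ket])) ++ listStr (List.ofFn cost) ++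
      natStr bgt ++ InstEnc.int k := by
  rw [InstEnc.cd, ranking_eq, InstEnc.list, List.flatMap_cons, List.flatMap_nil, List.append_nil,
    ranking_eq, family_nat_eq]
  rfl

open Classical in
theorem matrixStr_eq {n : ℕ} (G : SimpleGraph (Fin n)) (adj : ℕ → ℕ → Bool)
    (h : ∀ x y : Fin n, adj x y = true ↔ G.Adj x y) : matrixStr n adj =
      InstEnc.family (fun i => InstEnc.family (fun j => [Γ'.bit (decide (G.Adj i j))]) id) id := by
  have h' : ∀ i j : Fin n, [bif adj i j then Γ'.bit true else .bit false]
      = [Γ'.bit (decide (G.Adj i j))] := by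
    intro i j
    have : adj i j = decide (G.Adj i j) := by rw [Bool.eq_iff_iff, h, decide_eq_true_iff]
    rw [this]
    cases decide (G.Adj i j) <;> rfl
  rw [matrixStr, InstEnc.family, InstEnc.list]
  congr 2
  refine flatMap_congr_finRange fun i => ?_
  rw [InstEnc.family, InstEnc.list]
  congr 2
  exact flatMap_congr_finRange (h' i)

theorem chunks_cd (m : ℕ) (ρ X : Ranking m) (cost : Fin m → ℕ) (bgt : ℕ) (k : ℤ) :
    chunks .ket (InstEnc.cd ⟨m, [ρ], X, cost, bgt, k⟩ ++ [.ket]) =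
      [.bra :: ((List.ofFn X).map Fin.val).flatMap natStr,
        .bra :: .bra :: ((List.ofFn ρ).map Fin.val).flatMap natStr, [],
        .bra :: (List.ofFn cost).flatMap natStr, natStr bgt ++ InstEnc.int k] := by
  have hf : ∀ l : List ℕ, Γ'.ket ∉ l.flatMap natStr :=
    fun l => notMem_flatMap_natStr (by simp) (by simp)
  have h : InstEnc.cd ⟨m, [ρ], X, cost, bgt, k⟩ ++ [.ket] =
      (.bra :: ((List.ofFn X).map Fin.val).flatMap natStr) ++ .ket ::
      ((.bra :: .bra :: ((List.ofFn ρ).map Fin.val).flatMap natStr) ++ .ket ::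
      ([] ++ .ket :: ((.bra :: (List.ofFn cost).flatMap natStr) ++ .ket ::
      ((natStr bgt ++ InstEnc.int k) ++ .ket :: [])))) := by
    simp only [cd_eq, listStr, List.cons_append, List.append_assoc, List.nil_append]
  rw [h, chunks_append (by simp [hf]), chunks_append (by simp [hf]), chunks_append (by simp),
    chunks_append (by simp [hf]), chunks_append]
  · rfl
  · rw [List.mem_append, not_or]
    exact ⟨notMem_natStr (by simp) (by simp), notMem_int (by simp) (by simp)⟩

/-- A negative `k` is matched by `e + 1`, more edges than exist. Otherwise the cap is invisible,
because the truncated difference vanishes for every `k ≥ e`. -/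
theorem coverStr_eq (e : ℕ) (k : ℤ) :
    coverStr e (.bit (decide (k < 0)) :: bin k.natAbs) =
      InstEnc.int (if k < 0 then (e + 1 : ℕ) else (e - min k.natAbs (e + 1) : ℕ)) := by
  have hnn : ∀ a : ℕ, InstEnc.int (a : ℤ) = .bit false :: natStr a := fun a => by
    rw [int_eq, Int.natAbs_natCast, decide_eq_false (by omega)]
  rw [coverStr]
  by_cases h : k < 0
  · simp only [h, decide_true, List.headD_cons, cond_true, if_true, hnn]
  · have : decide ((Γ'.bit false) = .bit true) = false := by decide
    simp only [h, decide_false, List.headD_cons, List.tail_cons, this, cond_false, if_false,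
      unbin_bin, hnn]

theorem differ_iff {n : ℕ} (π π' : Ranking n) (x y : Fin n) :
    differ ((List.ofFn π).map Fin.val) ((List.ofFn π').map Fin.val) x y = true ↔
      (disagreementGraph π π').Adj x y := by
  rw [differ, Bool.not_eq_true', beq_eq_false_iff_ne, Ne, Bool.eq_iff_iff]
  by_cases hxy : x = y
  · subst hxy
    rw [beforeIn_self, beforeIn_self]
    simp
  · rw [beforeIn_iff π hxy, beforeIn_iff π' hxy]
    have h₁ := π.symm.injective.ne hxy
    have h₂ := π'.symm.injective.ne hxy
    simp only [disagreementGraph, Ranking.Before]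
    omega

end StackProg

-- The set of deleted candidates itself is the cover, in the disagreement graph of `X` and the input
-- ranking. Costs and budget are copied, and only `t` is computed, so that distance plus covered
-- edges equals `e`.
open StackProg in
theorem CDInstance.exists_wpvc (I : CDInstance) (hI : I.OneRanking) :
    ∃ J : WPVCInstance, J.OnPermutationGraph ∧ InstEnc.wpvc J = wpvcOfCd (InstEnc.cd I) ∧
      (I.IsYes ↔ J.IsYes) := by
  obtain ⟨m, R, X, cost, bgt, k⟩ := I
  obtain ⟨ρ, hρ⟩ : ∃ ρ : Ranking m, R = [ρ] := List.length_eq_one_iff.1 hI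
  subst hρ
  set G := disagreementGraph X ρ with hG
  set e := G.edgeSet.ncard with he
  refine ⟨⟨m, G, cost, bgt, if k < 0 then (e + 1 : ℕ) else (e - min k.natAbs (e + 1) : ℕ)⟩,
    isPermutationGraph_disagreementGraph X ρ, ?_, ?_⟩
  · have hn : (chunks .comma (.bra :: (List.ofFn cost).flatMap natStr)).length = m := by
      rw [length_chunks_cons (by simp), chunks_flatMap_natStr, List.length_map, List.length_ofFn]
    have hlt : ∀ π : Ranking m, ∀ i ∈ (List.ofFn π).map Fin.val, i < m := by
      intro π i hi
      obtain ⟨j, -, rfl⟩ := List.mem_map.1 hi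
      exact j.2
    have hX := numbers_eq m [.bra] (by simp) _ (hlt X)
    have hR := numbers_eq m [.bra, .bra] (by simp) _ (hlt ρ)
    have hl : chunks .comma (natStr bgt ++ InstEnc.int k)
        = [bin bgt, .bit (decide (k < 0)) :: bin k.natAbs] := by
      rw [natStr, List.append_assoc, List.singleton_append, chunks_append (notMem_bin (by simp))]
      have := chunks_int_append k []
      rw [List.append_nil] at this
      rw [this]; rfl
    simp only [List.cons_append, List.nil_append] at hX hR
    simp only [wpvcOfCd, chunks_cd, List.drop_succ_cons, List.drop_zero, List.headD_cons,
      List.tail_cons, hn, hl, hX, hR]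
    rw [wpvcStr, edgeCount_eq G _ (differ_iff X ρ), coverStr_eq, matrixStr_eq G _ (differ_iff X ρ)]
    have hb : InstEnc.int (bgt : ℤ) = .bit false :: natStr bgt := by
      rw [int_eq, Int.natAbs_natCast, decide_eq_false (by omega)]
    rw [InstEnc.wpvc, family_nat_eq, hb]
    rfl
  · have hsum : ∀ Z : Finset (Fin m), ([ρ].map fun π => kendallTauOn Zᶜ X π).sum
        = kendallTauOn Zᶜ X ρ := fun Z => by simp
    simp only [CDInstance.IsYes, WPVCInstance.IsYes, hsum]
    refine exists_congr fun Z => ?_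
    have hk := kendallTauOn_add_covered X ρ Z
    rw [← hG, ← he] at hk
    rw [Nat.cast_le]
    refine and_congr_right fun _ => ?_
    split <;> omega

/-! ### From partial vertex cover to candidate deletion -/

namespace StackProg

open Computability Turing

theorem headD_drop {α : Type} (l : List α) (i : ℕ) (d : α) : (l.drop i).headD d = l[i]?.getD d := by
  rw [List.headD_eq_head?_getD, List.head?_drop]

/-- `lead` is the bracket that opens the matrix; it precedes only the first row, so the induction
needs it arbitrary. `mid` is the segment ended by the closing bracket of the matrix and belongs to
no row. -/
theorem chunks_rows (rows : List (List Γ'))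
    (hrows : ∀ b ∈ rows, ∀ s ∈ b, s = .bit true ∨ s = .bit false) (rest : List Γ') (lead : List Γ')
    (hlead : ∀ s ∈ lead, s = .bra) :
    ∃ pre mid, chunks .ket (lead ++ (rows.flatMap (fun b => .bra :: (b ++ [.ket])) ++ .ket :: rest))
        = pre ++ mid :: chunks .ket rest ∧
      pre.map (fun s => s.filter fun s => decide (s = .bit true) || decide (s = .bit false)) =
        rows := by
  have hk : Γ'.ket ∉ lead := fun h => by simpa using hlead _ h
  induction rows generalizing lead with
  | nil => exact ⟨[], lead, by rw [List.flatMap_nil, List.nil_append, chunks_append hk]; rfl, rfl⟩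
  | cons b rows ih =>
    obtain ⟨pre, mid, h₁, h₂⟩ := ih (fun b hb => hrows b (List.mem_cons_of_mem _ hb)) []
      (by simp) (by simp)
    have hb := hrows b List.mem_cons_self
    have hkb : Γ'.ket ∉ b := fun h => by simpa using hb _ h
    refine ⟨(lead ++ .bra :: b) :: pre, mid, ?_, ?_⟩
    · have : lead ++ ((b :: rows).flatMap (fun b => Γ'.bra :: (b ++ [.ket])) ++ .ket :: rest)
          = (lead ++ .bra :: b) ++ .ket ::
            ([] ++ (rows.flatMap (fun b => Γ'.bra :: (b ++ [.ket])) ++ .ket :: rest)) := by simp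
      rw [this, chunks_append (by simp [hk, hkb]), h₁, List.cons_append]
    · rw [List.map_cons, h₂, List.filter_append, List.filter_cons]
      have e₁ : lead.filter (fun s => decide (s = .bit true) || decide (s = .bit false)) = [] := by
        rw [List.filter_eq_nil_iff]
        intro s hs
        simp [hlead s hs]
      have e₂ : b.filter (fun s => decide (s = .bit true) || decide (s = .bit false)) = b := by
        rw [List.filter_eq_self]
        intro s hs
        simpa using hb s hs
      rw [e₁, e₂]
      simp

open Classical in
theorem adjOf_edgesOfRows {n : ℕ} (G : SimpleGraph (Fin n)) (pre rest : List (List Γ'))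
    (h : pre.map (fun s => s.filter fun s => decide (s = .bit true) || decide (s = .bit false)) =
      (List.finRange n).map fun i => (List.finRange n).map fun j => .bit (decide (G.Adj i j)))
    (i j : ℕ) : adjOf (edgesOfRows n (pre ++ rest)) i j = true ↔
      ∃ (hi : i < n) (hj : j < n), G.Adj ⟨i, hi⟩ ⟨j, hj⟩ := by
  rw [adjOf, memb_iff, edgesOfRows, List.mem_filter, mem_pairs, and_assoc, ← exists_prop]
  refine exists_congr fun hi => ?_
  rw [← exists_prop]
  refine exists_congr fun hj => ?_
  have hlen : pre.length = n := by simpa using congrArg List.length h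
  have hrow := congrArg (fun l => l[i]?) h
  simp only [List.getElem?_map] at hrow
  rw [List.getElem?_eq_getElem (by omega), List.getElem?_eq_getElem (by simpa using hi),
    Option.map_some, Option.map_some, Option.some.injEq] at hrow
  have hi' : i < pre.length := by omega
  rw [headD_drop, headD_drop, List.getElem?_append_left hi', List.getElem?_eq_getElem hi',
    Option.getD_some, hrow, List.getElem?_map, List.getElem?_eq_getElem (by simpa using hj)]
  simp

open Classical in
theorem cdOfWpvc_eq (I : WPVCInstance) : ∃ E : List (ℕ × ℕ),
    (∀ i j, adjOf E i j = true ↔ ∃ (hi : i < I.n) (hj : j < I.n), I.G.Adj ⟨i, hi⟩ ⟨j, hj⟩) ∧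
    cdOfWpvc (InstEnc.wpvc I) = cdStr I.n E (.bra :: (List.ofFn I.w).flatMap natStr)
      (.bit (decide (I.W < 0)) :: bin I.W.natAbs) (.bit (decide (I.t < 0)) :: bin I.t.natAbs) := by
  obtain ⟨n, G, w, W, t⟩ := I
  set rows : List (List Γ') := (List.finRange n).map fun i =>
    (List.finRange n).map fun j => .bit (decide (G.Adj i j)) with hrows
  set ws : List Γ' := .bra :: (List.ofFn w).flatMap natStr with hws
  have hs : InstEnc.wpvc ⟨n, G, w, W, t⟩ ++ [.ket] = [.bra] ++
      (rows.flatMap (fun b => .bra :: (b ++ [.ket])) ++ .ket ::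
        (ws ++ .ket :: ((InstEnc.int W ++ InstEnc.int t) ++ .ket :: []))) := by
    have h : ∀ i : Fin n, (List.finRange n).flatMap (fun j => [Γ'.bit (decide (G.Adj i j))])
        = (List.finRange n).map fun j => .bit (decide (G.Adj i j)) :=
      fun i => List.map_eq_flatMap.symm
    simp only [InstEnc.wpvc, InstEnc.family, InstEnc.list, List.ofFn_id, h, hrows, hws,
      List.flatMap_map, List.cons_append, List.append_assoc, List.nil_append]
    rfl
  obtain ⟨pre, mid, h₁, h₂⟩ := chunks_rows rows (by
    intro b hb s hs
    obtain ⟨i, -, rfl⟩ := List.mem_map.1 hb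
    obtain ⟨j, -, rfl⟩ := List.mem_map.1 hs
    cases decide (G.Adj i j) <;> simp)
    (ws ++ .ket :: ((InstEnc.int W ++ InstEnc.int t) ++ .ket :: [])) [.bra] (by simp)
  have hw : Γ'.ket ∉ ws := by
    simpa [hws] using notMem_flatMap_natStr (l := List.ofFn w) (s := .ket) (by simp) (by simp)
  have hi : ∀ z, Γ'.ket ∉ InstEnc.int z := fun z => notMem_int (by simp) (by simp)
  have h₃ : chunks .ket (ws ++ .ket :: ((InstEnc.int W ++ InstEnc.int t) ++ .ket :: []))
      = [ws, InstEnc.int W ++ InstEnc.int t] := by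
    rw [chunks_append hw, chunks_append (by simp [hi])]
    rfl
  rw [← hs, h₃] at h₁
  refine ⟨_, adjOf_edgesOfRows G pre [mid, ws, InstEnc.int W ++ InstEnc.int t] h₂, ?_⟩
  have hn : (chunks .comma ws).length = n := by
    rw [hws, length_chunks_cons (by simp), chunks_flatMap_natStr, List.length_map, List.length_ofFn]
  have hl : chunks .comma (InstEnc.int W ++ InstEnc.int t)
      = [.bit (decide (W < 0)) :: bin W.natAbs, .bit (decide (t < 0)) :: bin t.natAbs] := by
    have := chunks_int_append t []
    rw [List.append_nil] at this
    rw [chunks_int_append, this]; rfl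
  simp only [cdOfWpvc, h₁, List.reverse_append, List.reverse_cons, List.reverse_nil,
    List.nil_append, List.cons_append, List.headD_cons, List.tail_cons, hn, hl]

/-- The bound on the distance, for `e` edges and the integers `W`, `t`. -/
def distBound (e : ℕ) (W t : ℤ) : ℤ :=
  if W < 0 then -1 else if t < 0 then e else if e < t.natAbs then -1 else (e - t.natAbs : ℕ)

/-- Reading `t` with the cap `e + 1` loses nothing: the cap is attained exactly if `t` exceeds `e`.
-/
theorem boundStr_eq (e : ℕ) (W t : ℤ) : boundStr e (.bit (decide (W < 0)) :: bin W.natAbs)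
    (.bit (decide (t < 0)) :: bin t.natAbs) = InstEnc.int (distBound e W t) := by
  have hnn : ∀ a : ℕ, InstEnc.int (a : ℤ) = .bit false :: natStr a := fun a => by
    rw [int_eq, Int.natAbs_natCast, decide_eq_false (by omega)]
  have hneg : InstEnc.int (-1) = [.bit true, .bit true, .comma] := rfl
  have hft : decide ((Γ'.bit false) = .bit true) = false := by decide
  rw [boundStr, distBound]
  by_cases hW : W < 0
  · simp only [hW, decide_true, List.headD_cons, cond_true, if_true, hneg]
  by_cases ht : t < 0
  · simp only [hW, ht, decide_true, decide_false, List.headD_cons, hft, cond_true, cond_false,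
      if_true, if_false, hnn]
  by_cases h : e < t.natAbs
  · have : min t.natAbs (e + 1) = e + 1 := by omega
    simp only [hW, ht, h, decide_true, decide_false, List.headD_cons, List.tail_cons, hft,
      cond_true, cond_false, if_true, if_false, unbin_bin, this, hneg]
  · have h₁ : min t.natAbs (e + 1) = t.natAbs := by omega
    have h₂ : ¬t.natAbs = e + 1 := by omega
    simp only [hW, ht, h, decide_false, List.headD_cons, List.tail_cons, hft,
      cond_false, if_false, unbin_bin, h₁, h₂, hnn]

/-- Links are defined on all natural numbers, so the orders must be too. With the identity from `n`
on, the added vertices come last in both orders and are isolated. -/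
theorem exists_extend {n : ℕ} (e : Equiv.Perm (Fin n)) : ∃ p : ℕ → ℕ, p.Injective ∧
    (∀ i (hi : i < n), p i = e ⟨i, hi⟩) ∧ ∀ i, n ≤ i → p i = i := by
  refine ⟨fun i => if hi : i < n then e ⟨i, hi⟩ else i, fun i j h => ?_, fun i hi => dif_pos hi,
    fun i hi => dif_neg (by omega)⟩
  dsimp only at h
  split at h <;> split at h
  · simpa using e.injective (Fin.ext h)
  · have := (e ⟨i, ‹_›⟩).2; omega
  · have := (e ⟨j, ‹_›⟩).2; omega
  · exact h

/-- The isomorphism with the inversion graph provides the first order, and following it by the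
permutation provides the second. -/
theorem exists_realizes {n : ℕ} {G : SimpleGraph (Fin n)} (hG : IsPermutationGraph G)
    (adj : ℕ → ℕ → Bool)
    (h : ∀ i j, adj i j = true ↔ ∃ (hi : i < n) (hj : j < n), G.Adj ⟨i, hi⟩ ⟨j, hj⟩) :
    ∃ p₁ p₂ : ℕ → ℕ, p₁.Injective ∧ p₂.Injective ∧ Realizes p₁ p₂ adj := by
  obtain ⟨m, π, ⟨φ⟩⟩ := hG
  obtain rfl : n = m := by simpa using Fintype.card_congr φ.toEquiv
  obtain ⟨p₁, i₁, a₁, b₁⟩ := exists_extend φ.toEquiv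
  obtain ⟨p₂, i₂, a₂, b₂⟩ := exists_extend (φ.toEquiv.trans π)
  refine ⟨p₁, p₂, i₁, i₂, fun i j => ?_⟩
  have hlt : ∀ i, i < n → p₁ i < n ∧ p₂ i < n := fun i hi => by
    rw [a₁ i hi, a₂ i hi]; exact ⟨Fin.is_lt _, Fin.is_lt _⟩
  rw [h]
  by_cases hi : i < n
  · by_cases hj : j < n
    · rw [a₁ i hi, a₁ j hj, a₂ i hi, a₂ j hj]
      simp only [hi, hj, exists_true_left, Fin.val_fin_lt]
      exact φ.map_adj_iff.symm
    · have := hlt i hi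
      rw [b₁ j (by omega), b₂ j (by omega)]
      constructor
      · rintro ⟨_, h, _⟩; exact absurd h hj
      · omega
  · rw [b₁ i (by omega), b₂ i (by omega)]
    constructor
    · rintro ⟨h, _⟩; exact absurd h hi
    · by_cases hj : j < n
      · have := hlt j hj; omega
      · rw [b₁ j (by omega), b₂ j (by omega)]; omega

/-- The two sorted lists are rankings, and the graph is the graph of their disagreements. -/
theorem exists_rankings {n : ℕ} {G : SimpleGraph (Fin n)} (hG : IsPermutationGraph G)
    (adj : ℕ → ℕ → Bool)
    (h : ∀ i j, adj i j = true ↔ ∃ (hi : i < n) (hj : j < n), G.Adj ⟨i, hi⟩ ⟨j, hj⟩) :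
    ∃ X ρ : Ranking n, sorted n (orient n adj) = (List.ofFn X).map Fin.val ∧
      sorted n (fun u v => !(orient n adj u v == adj u v)) = (List.ofFn ρ).map Fin.val ∧
      disagreementGraph X ρ = G := by
  obtain ⟨p₁, p₂, i₁, i₂, hr⟩ := exists_realizes hG adj h
  have hn : ∀ i j, adj i j = true → i < n ∧ j < n := fun i j hij => by
    obtain ⟨hi, hj, -⟩ := (h i j).1 hij
    exact ⟨hi, hj⟩
  have ho : ∀ {u v}, u < n → v < n → (orient n adj u v = true ↔ Forward adj u v) :=
    fun hu hv => orient_iff hn hu hv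
  have ho₂ : ∀ {u v}, u < n → v < n → u ≠ v →
      ((!(orient n adj u v == adj u v)) = true ↔ Forward₂ adj u v) := by
    intro u v hu hv huv
    have h₁ := ho hu hv
    have h₂ : ¬Forward adj u v ↔ Forward adj v u :=
      ⟨(Forward.total hr.symm u v).resolve_left, fun h h' => hr.forward_asymm i₁ i₂ huv h' h⟩
    rw [Forward₂, ← h₂, ← h₁]
    cases adj u v <;> cases orient n adj u v <;> simp
  obtain ⟨X, hX, hXb⟩ := exists_ranking_sorted n (orient n adj)
    (fun u v hu hv _ => by rw [ho hu hv, ho hv hu]; exact Forward.total hr.symm u v)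
    (fun u v hu hv huv h h' => hr.forward_asymm i₁ i₂ huv ((ho hu hv).1 h) ((ho hv hu).1 h'))
    (fun a b c ha hb hc nab nac nbc hab hbc => (ho ha hc).2
      (hr.forward_trans i₁ i₂ nab nac nbc ((ho ha hb).1 hab) ((ho hb hc).1 hbc)))
  obtain ⟨ρ, hρ, hρb⟩ := exists_ranking_sorted n (fun u v => !(orient n adj u v == adj u v))
    (fun u v hu hv huv => by
      rw [ho₂ hu hv huv, ho₂ hv hu huv.symm]; exact hr.forward₂_total u v)
    (fun u v hu hv huv h h' =>
      hr.forward₂_asymm i₁ i₂ huv ((ho₂ hu hv huv).1 h) ((ho₂ hv hu huv.symm).1 h'))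
    (fun a b c ha hb hc nab nac nbc hab hbc => (ho₂ ha hc nac).2
      (hr.forward₂_trans i₁ i₂ nab nac nbc ((ho₂ ha hb nab).1 hab) ((ho₂ hb hc nbc).1 hbc)))
  refine ⟨X, ρ, hX, hρ, ?_⟩
  ext x y
  have hadj : adj x y = true ↔ G.Adj x y := by simp [h]
  by_cases hxy : x = y
  · subst hxy; simp
  have hb : ∀ π : Ranking n, π.Before y x ↔ ¬π.Before x y := fun π => by
    have := π.symm.injective.ne hxy
    simp only [Ranking.Before]
    omega
  rw [← hadj]
  simp only [disagreementGraph]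
  rw [hb X, hb ρ, hXb x y hxy, hρb x y hxy]
  cases adj x y <;> cases orient n adj x y <;> simp

end StackProg

-- The computed rankings have `G` itself as disagreement graph, so vertices are candidates and a
-- cover is a deletion set. For negative `W` no cover exists, and `distBound` is then `-1`.
open StackProg in
theorem WPVCInstance.exists_cd (I : WPVCInstance) (hI : I.OnPermutationGraph) :
    ∃ J : CDInstance, J.OneRanking ∧ InstEnc.cd J = cdOfWpvc (InstEnc.wpvc I) ∧
      (I.IsYes ↔ J.IsYes) := by
  obtain ⟨E, hE, hcd⟩ := cdOfWpvc_eq I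
  obtain ⟨n, G, w, W, t⟩ := I
  obtain ⟨X, ρ, hX, hρ, hG⟩ := exists_rankings hI (adjOf E) hE
  refine ⟨⟨n, [ρ], X, w, W.natAbs, distBound G.edgeSet.ncard W t⟩, rfl, ?_, ?_⟩
  · have hadj : ∀ x y : Fin n, adjOf E x y = true ↔ G.Adj x y := fun x y => by simp [hE]
    rw [hcd, cd_eq, cdStr, hX, hρ, edgeCount_eq G _ hadj, boundStr_eq]
    rfl
  · have hsum : ∀ Z : Finset (Fin n), ([ρ].map fun π => kendallTauOn Zᶜ X π).sum
        = kendallTauOn Zᶜ X ρ := fun Z => by simp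
    simp only [CDInstance.IsYes, WPVCInstance.IsYes, hsum]
    refine exists_congr fun Z => ?_
    have hk := kendallTauOn_add_covered X ρ Z
    rw [hG] at hk
    rw [distBound]
    dsimp only at hk ⊢
    split_ifs <;> omega

/-! ### Polynomial time functions on strings as machines -/

namespace StackProg

open Computability Turing Frag
open Coded (dat)

theorem dat_str (l : List Γ') : dat l = strDat l := by
  induction l with
  | nil => rfl
  | cons s l ih => rw [dat_cons, ih]; rfl

/-- Functions that are computed on encodings by a polynomial time function on strings are
polynomial time computable. -/
theorem computable_of_PT {α β : Type} {ea : α → List Γ'} {eb : β → List Γ'} {f : α → β}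
    {g : List Γ' → List Γ'} (hg : PT g) (h : ∀ a, eb (f a) = g (ea a)) :
    Nonempty (TM2ComputableInPolyTime ea eb f) ∧
      ∃ p : Polynomial ℕ, ∀ a, (eb (f a)).length ≤ p.eval (ea a).length := by
  obtain ⟨F, P, hF⟩ := hg
  have hs : ∀ a, size (ea a) ≤ 12 * (ea a).length + 1 := fun a => by
    rw [size, dat_str]; exact length_enc_strDat _
  have hl : ∀ a, (eb (f a)).length ≤ P.eval (12 * (ea a).length + 1) := fun a => by
    refine (length_le_enc_strDat _).trans ?_
    rw [← dat_str, h]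
    exact (hF _).1.trans (polynomial_eval_mono P (hs a))
  constructor
  · refine Frag.computable (read.seq (F.seq write))
      ((19 * .X + 7) + (20 * P.comp (12 * .X + 1) + 6)) fun a => ?_
    have h₁ := run_read (ea a)
    have h₂ := (hF (ea a)).2 [] [] [] []
    have h₃ := run_write (eb (f a))
    rw [← dat_str, h] at h₃
    rw [← dat_str] at h₁
    simp only [List.append_nil] at h₂
    rw [h]
    refine (h₁.seq (h₂.seq h₃)).mono ?_
    have h₄ := polynomial_eval_mono P (hs a)
    have h₅ := hl a
    rw [h] at h₅
    simp only [Polynomial.eval_add, Polynomial.eval_mul, Polynomial.eval_X, Polynomial.eval_comp,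
      Polynomial.eval_ofNat, Polynomial.eval_one]
    omega
  · refine ⟨P.comp (12 * .X + 1), fun a => ?_⟩
    simpa using hl a

end StackProg

open StackProg in
/-- A polynomial time function on strings that is a reduction on the encodings of instances. -/
theorem polyTimeReduction {α β : Type} {encα : α → List Computability.Γ'} {C P : α → Prop}
    {encβ : β → List Computability.Γ'} {D Q : β → Prop}
    {g : List Computability.Γ' → List Computability.Γ'} (hg : PT g)
    (h : ∀ a, C a → ∃ b, D b ∧ encβ b = g (encα a) ∧ (P a ↔ Q b)) :
    PolyTimeReducesOn encα C P encβ D Q ∧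
      (PolyTimeSolvableOn encβ D Q → PolyTimeSolvableOn encα C P) := by
  choose f hD he hPQ using h
  obtain ⟨hf, p, hp⟩ := computable_of_PT (ea := fun a : {a // C a} => encα a)
    (eb := fun b : {b // D b} => encβ b) (f := fun a => ⟨f a.1 a.2, hD a.1 a.2⟩) hg
    fun a => he a.1 a.2
  exact ⟨⟨_, hf, fun a => hPQ a.1 a.2⟩,
    PolyTimeSolvableOn.of_reduction hf p hp fun a => hPQ a.1 a.2⟩

theorem mainTheorem6 :
    PolyTimeReducesOn InstEnc.wpvc WPVCInstance.OnPermutationGraph WPVCInstance.IsYes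
      InstEnc.cd CDInstance.OneRanking CDInstance.IsYes ∧
    PolyTimeReducesOn InstEnc.cd CDInstance.OneRanking CDInstance.IsYes
      InstEnc.wpvc WPVCInstance.OnPermutationGraph WPVCInstance.IsYes ∧
    (PolyTimeSolvableOn InstEnc.cd CDInstance.OneRanking CDInstance.IsYes ↔
      PolyTimeSolvableOn InstEnc.wpvc WPVCInstance.OnPermutationGraph WPVCInstance.IsYes) := by
  have h₁ := polyTimeReduction (encα := InstEnc.wpvc) (C := WPVCInstance.OnPermutationGraph)
    (P := WPVCInstance.IsYes) (encβ := InstEnc.cd) (D := CDInstance.OneRanking)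
    (Q := CDInstance.IsYes) StackProg.polyTime_cdOfWpvc
    WPVCInstance.exists_cd
  have h₂ := polyTimeReduction (encα := InstEnc.cd) (C := CDInstance.OneRanking)
    (P := CDInstance.IsYes) (encβ := InstEnc.wpvc) (D := WPVCInstance.OnPermutationGraph)
    (Q := WPVCInstance.IsYes) StackProg.polyTime_wpvcOfCd
    CDInstance.exists_wpvc
  exact ⟨h₁.1, h₂.1, h₁.2, h₂.2⟩
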